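/- Let $G$ be a finite group and $k$ a field. Let $\mathrm{mod}(kG)$ be the category of finitely generated left $kG$-modules and $D_b(kG)=D_b(\mathrm{mod}(kG))$ its bounded derived category, i.e. the Verdier quotient of the bounded homotopy category $K_b(\mathrm{mod}(kG))$ by the acyclic complexes. Let $\mathrm{perm}(G;k)\subseteq\mathrm{mod}(kG)$ be the full subcategory of permutation modules, i.e. of modules isomorphic to $k(A)$, the $k$-vector space with basis $A$ and the induced $G$-action, for some finite left $G$-set $A$. Let $K_{b,\mathrm{ac}}(\mathrm{perm}(G;k))\subseteq K_b(\mathrm{perm}(G;k))$ be the full subcategory of those complexes that are acyclic as complexes of $kG$-modules. The inclusion $\mathrm{perm}(G;k)\subseteq\mathrm{mod}(kG)$ induces a functor $\Upsilon\colon K_b(\mathrm{perm}(G;k))\to D_b(kG)$, hence a functor from the Verdier quotient $K_b(\mathrm{perm}(G;k))/K_{b,\mathrm{ac}}(\mathrm{perm}(G;k))$ to $D_b(kG)$ and, since $D_b(kG)$ is idempotent-complete, a functor on the idempotent completion $(-)^\natural$ $$\bar\Upsilon\colon\left(\frac{K_b(\mathrm{perm}(G;k))}{K_{b,\mathrm{ac}}(\mathrm{perm}(G;k))}\right)^{\natural}\longrightarrow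 D_b(kG).$$ For an integer $m$, an $m$-free permutation resolution of a bounded complex $X$ of finitely generated $kG$-modules is a quasi-isomorphism of complexes $P\to X$, where $P$ is a bounded complex of permutation modules such that $P_i$ is a free $kG$-module for all $i\le m$ (homological indexing). Let $\mathcal A(G;k)\subseteq D_b(kG)$ be the full subcategory of those bounded complexes $X$ which admit $m$-free permutation resolutions for all $m\ge 0$, and let $\mathcal A(G;k)^\natural$ be the full subcategory of those $X\in D_b(kG)$ for which there is $Y\in D_b(kG)$ with $X\oplus Y$ isomorphic to an object of $\mathcal A(G;k)$. Then: 1. $\mathcal A(G;k)^\natural=D_b(kG)$. 2. $D_b(kG)$ is idempotent-complete, and $\bar\Upsilon$ is an equivalence of categories. 3. If $G$ is a $p$-group, where the prime $p$ is the characteristic of $k$, then $\mathcal A(G;k)=D_b(kG)$. -/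

import Mathlib

open CategoryTheory CategoryTheory.Limits CategoryTheory.Pretriangulated

universe u v

/-! ## Bounded complexes and bounded homotopy categories

Complexes are cohomologically indexed: homological degree `i` is cohomological degree `-i`. -/

namespace BoundedHomotopy

section Additive

variable (C : Type*) [Category C] [Preadditive C]

/-- A cochain complex is bounded if it is zero outside a finite range of degrees. -/
def IsBounded : ObjectProperty (CochainComplex C ℤ) :=
  fun K ↦ (∃ a : ℤ, K.IsStrictlyGE a) ∧ (∃ b : ℤ, K.IsStrictlyLE b)

/-- The objects of the homotopy category whose underlying complex is bounded. -/
def bounded : ObjectProperty (HomotopyCategory C (ComplexShape.up ℤ)) :=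
  fun K ↦ IsBounded C K.as

/-- The bounded homotopy category `K_b(C)` of an additive category `C`. -/
abbrev Kb := (bounded C).FullSubcategory

variable {C} in
theorem bounded_quotient_obj_iff (K : CochainComplex C ℤ) :
    bounded C ((HomotopyCategory.quotient _ _).obj K) ↔ IsBounded C K := Iff.rfl

instance [HasZeroObject C] : (bounded C).ContainsZero where
  exists_zero :=
    ⟨(HomotopyCategory.quotient _ _).obj (HomologicalComplex.zero),
      Functor.map_isZero _ HomologicalComplex.isZero_zero,
      ⟨0, ⟨fun _ _ ↦ isZero_zero C⟩⟩, ⟨0, ⟨fun _ _ ↦ isZero_zero C⟩⟩⟩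

instance : (bounded C).IsStableUnderShift ℤ where
  isStableUnderShiftBy n :=
    { le_shift K hK := by
        obtain ⟨K : CochainComplex _ _, rfl⟩ := K.quotient_obj_surjective
        obtain ⟨⟨a, _⟩, ⟨b, _⟩⟩ : IsBounded C K := hK
        rw [ObjectProperty.prop_shift_iff, HomotopyCategory.shift_quotient_obj,
          bounded_quotient_obj_iff]
        exact ⟨⟨a - n, CochainComplex.isStrictlyGE_shift K a n (a - n) (by lia)⟩,
          ⟨b - n, CochainComplex.isStrictlyLE_shift K b n (b - n) (by lia)⟩⟩ }

theorem isBounded_mappingCone [HasBinaryBiproducts C] {K L : CochainComplex C ℤ} (f : K ⟶ L)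
    (hK : IsBounded C K) (hL : IsBounded C L) :
    IsBounded C (CochainComplex.mappingCone f) := by
  obtain ⟨⟨a, _⟩, ⟨b, _⟩⟩ := hK
  obtain ⟨⟨a', _⟩, ⟨b', _⟩⟩ := hL
  refine ⟨⟨min (a - 1) a', ?_⟩, ⟨max b b', ?_⟩⟩
  · rw [CochainComplex.isStrictlyGE_iff]
    intro i hi
    rw [CochainComplex.mappingCone.isZero_X_iff]
    exact ⟨K.isZero_of_isStrictlyGE a _ (by lia), L.isZero_of_isStrictlyGE a' _ (by lia)⟩
  · rw [CochainComplex.isStrictlyLE_iff]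
    intro i hi
    rw [CochainComplex.mappingCone.isZero_X_iff]
    exact ⟨K.isZero_of_isStrictlyLE b _ (by lia), L.isZero_of_isStrictlyLE b' _ (by lia)⟩

instance [HasZeroObject C] [HasBinaryBiproducts C] : (bounded C).IsTriangulatedClosed₃ where
  ext₃' T hT h₁ h₂ := by
    obtain ⟨f : T.obj₁.as ⟶ T.obj₂.as, hf⟩ :=
      (HomotopyCategory.quotient _ _).map_surjective T.mor₁
    exact ⟨_, (bounded_quotient_obj_iff _).2 (isBounded_mappingCone C f h₁ h₂),
      ⟨Triangle.π₃.mapIso (isoTriangleOfIso₁₂ T _ hT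
        (HomotopyCategory.mappingCone_triangleh_distinguished f)
        (Iso.refl _) (Iso.refl _) (by
          simp only [Iso.refl_hom, CochainComplex.mappingCone.triangleh]
          exact (Category.comp_id _).trans (hf.symm.trans (Category.id_comp _).symm)))⟩⟩

instance [HasZeroObject C] [HasBinaryBiproducts C] : (bounded C).IsTriangulated where
  toIsTriangulatedClosed₂ := .of_isTriangulatedClosed₃

end Additive

section Functor

variable {C D : Type*} [Category C] [Preadditive C] [Category D] [Preadditive D]

/-- The functor `K_b(C) ⥤ K_b(D)` induced by an additive functor `C ⥤ D`. -/
noncomputable def mapKb (F : C ⥤ D) [F.Additive] : Kb C ⥤ Kb D :=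
  (bounded D).lift ((bounded C).ι ⋙ F.mapHomotopyCategory (ComplexShape.up ℤ)) (by
    rintro ⟨K, hK⟩
    obtain ⟨K : CochainComplex _ _, rfl⟩ := K.quotient_obj_surjective
    obtain ⟨⟨a, _⟩, ⟨b, _⟩⟩ : IsBounded C K := hK
    exact ⟨⟨a, inferInstanceAs (CochainComplex.IsStrictlyGE
        ((F.mapHomologicalComplex _).obj K) a)⟩,
      ⟨b, inferInstanceAs (CochainComplex.IsStrictlyLE
        ((F.mapHomologicalComplex _).obj K) b)⟩⟩)

noncomputable instance (F : C ⥤ D) [F.Additive] : (mapKb F).CommShift ℤ :=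
  inferInstanceAs (((bounded D).lift ((bounded C).ι ⋙
    F.mapHomotopyCategory (ComplexShape.up ℤ)) _).CommShift ℤ)

instance (F : C ⥤ D) [F.Additive] [HasZeroObject C] [HasBinaryBiproducts C]
    [HasZeroObject D] [HasBinaryBiproducts D] : (mapKb F).IsTriangulated :=
  (bounded D).isTriangulated_lift ((bounded C).ι ⋙ F.mapHomotopyCategory (ComplexShape.up ℤ)) _

end Functor

section Abelian

variable (A : Type*) [Category A] [Abelian A]

/-- The acyclic bounded complexes, as a full subcategory of `K_b(A)`. -/
def acyclic : ObjectProperty (Kb A) :=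
  (HomotopyCategory.subcategoryAcyclic A).inverseImage (bounded A).ι

instance : (acyclic A).IsClosedUnderIsomorphisms := by
  dsimp only [acyclic]
  infer_instance

instance : (acyclic A).IsTriangulated := by
  dsimp only [acyclic]
  infer_instance

/-- The bounded derived category `D_b(A)` of an abelian category `A`: the Verdier quotient of
`K_b(A)` by the acyclic complexes. -/
abbrev Db := (acyclic A).trW.Localization

variable {A} in
/-- The bounded complex which a given object of `D_b(A)` is. (The objects of `D_b(A)` are those of
`K_b(A)`, hence bounded complexes.) -/
def Db.complex (X : Db A) : CochainComplex A ℤ :=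
  ((Localization.Construction.objEquiv (acyclic A).trW).symm X).obj.as

end Abelian

end BoundedHomotopy

/-! ## Permutation modules -/

namespace PermutationModules

open BoundedHomotopy

variable (R : Type u) [CommRing R] (G : Type v) [Group G]

instance [IsNoetherianRing R] [Finite G] : IsNoetherianRing (MonoidAlgebra R G) :=
  have : Module.Finite R (MonoidAlgebra R G) :=
    Module.Finite.equiv (MonoidAlgebra.coeffLinearEquiv (M := G) R (S := R)).symm
  IsNoetherianRing.of_finite R (MonoidAlgebra R G)

/-- The category `mod(RG)` of finitely generated left modules over the group ring `RG`. -/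
abbrev ModG := FGModuleCat.{max u v} (MonoidAlgebra R G)

/-- The permutation modules: an `RG`-module is a permutation module if it is isomorphic to the free
`R`-module `R(A)` on a finite left `G`-set `A`, with `G` acting `R`-linearly through the action
on the basis `A`. -/
def isPerm : ObjectProperty (ModG R G) := fun M ↦
  ∃ (A : Type) (_ : Finite A) (_ : MulAction G A),
    Nonempty (M ≃ₗ[MonoidAlgebra R G] (Representation.ofMulAction R G A).asModule)

/-- The additive category `perm(G;R)` of permutation modules. -/
abbrev Perm := (isPerm R G).FullSubcategory

theorem isPerm_of_equiv {M N : ModG R G} (e : M ≃ₗ[MonoidAlgebra R G] N) (h : isPerm R G M) :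
    isPerm R G N := by
  obtain ⟨A, hA, hGA, ⟨f⟩⟩ := h
  exact ⟨A, hA, hGA, ⟨e.symm.trans f⟩⟩

instance : (isPerm R G).IsClosedUnderIsomorphisms where
  of_iso e h := isPerm_of_equiv R G (FGModuleCat.isoToLinearEquiv e) h

theorem isPerm_of_subsingleton (M : ModG R G) [Subsingleton M] : isPerm R G M := by
  let _ : MulAction G PEmpty.{1} :=
    { smul := fun _ a ↦ a.elim, one_smul := fun a ↦ a.elim, mul_smul := fun _ _ a ↦ a.elim }
  have : Subsingleton (Representation.ofMulAction R G PEmpty.{1}).asModule :=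
    (MonoidAlgebra.coeffLinearEquiv R (S := R) (M := PEmpty.{1})).toEquiv.subsingleton
  exact ⟨PEmpty, inferInstance, inferInstance, ⟨0⟩⟩

/-- The map `R(A) → R(B)` induced by a `G`-equivariant map `A → B`. -/
noncomputable def permMap {A B : Type} [MulAction G A] [MulAction G B] (f : A → B)
    (hf : ∀ (g : G) (a : A), f (g • a) = g • f a) :
    (Representation.ofMulAction R G A).asModule →ₗ[MonoidAlgebra R G]
      (Representation.ofMulAction R G B).asModule :=
  Representation.IntertwiningMap.equivLinearMapAsModule _ _
    { toLinearMap := MonoidAlgebra.mapDomainLinearMap R R f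
      isIntertwining' := fun g ↦ by
        ext a
        simp [hf] }

/-- `R(A) × R(B)` is isomorphic to `R(A ⊔ B)`. -/
theorem exists_permSumEquiv (A B : Type) [MulAction G A] [MulAction G B] :
    Nonempty (((Representation.ofMulAction R G A).asModule ×
      (Representation.ofMulAction R G B).asModule) ≃ₗ[MonoidAlgebra R G]
      (Representation.ofMulAction R G (A ⊕ B)).asModule) := by
  refine ⟨LinearEquiv.ofBijective
    (LinearMap.coprod (permMap R G Sum.inl fun _ _ ↦ rfl) (permMap R G Sum.inr fun _ _ ↦ rfl)) ?_⟩
  let e : (MonoidAlgebra R A × MonoidAlgebra R B) ≃ₗ[R] MonoidAlgebra R (A ⊕ B) :=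
    ((MonoidAlgebra.coeffLinearEquiv R).prodCongr (MonoidAlgebra.coeffLinearEquiv R)).trans
      ((Finsupp.sumFinsuppLEquivProdFinsupp R).symm.trans
        (MonoidAlgebra.coeffLinearEquiv R).symm)
  have he : (e : (MonoidAlgebra R A × MonoidAlgebra R B) →ₗ[R] MonoidAlgebra R (A ⊕ B)) =
      LinearMap.coprod (MonoidAlgebra.mapDomainLinearMap R R Sum.inl)
        (MonoidAlgebra.mapDomainLinearMap R R Sum.inr) := by
    ext x y
    · rcases y with y | y <;> simp [e]
    · rcases y with y | y <;> simp [e]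
  have := e.bijective
  rw [← LinearEquiv.coe_coe, he] at this
  exact this

theorem isPerm_prod (M N : ModG R G) (hM : isPerm R G M) (hN : isPerm R G N) :
    isPerm R G (FGModuleCat.of (MonoidAlgebra R G) (M × N)) := by
  obtain ⟨A, _, _, ⟨e⟩⟩ := hM
  obtain ⟨B, _, _, ⟨f⟩⟩ := hN
  obtain ⟨s⟩ := exists_permSumEquiv R G A B
  exact ⟨A ⊕ B, inferInstance, inferInstance, ⟨(e.prodCongr f).trans s⟩⟩

/-- The product of modules, as a binary product in `mod(RG)`. -/
noncomputable def prodIsLimit (M N : ModG R G) :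
    IsLimit (BinaryFan.mk (P := FGModuleCat.of (MonoidAlgebra R G) (M × N))
      (FGModuleCat.ofHom (LinearMap.fst (MonoidAlgebra R G) M N) : _ ⟶ M)
      (FGModuleCat.ofHom (LinearMap.snd (MonoidAlgebra R G) M N) : _ ⟶ N)) :=
  BinaryFan.IsLimit.mk _
    (fun f g ↦ FGModuleCat.ofHom (LinearMap.prod f.hom.hom g.hom.hom))
    (fun f g ↦ rfl) (fun f g ↦ rfl)
    (fun f g m hf hg ↦ by
      subst hf hg
      rfl)

variable [IsNoetherianRing R] [Finite G]

instance : (isPerm R G).ContainsZero where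
  exists_zero := by
    refine ⟨FGModuleCat.of (MonoidAlgebra R G) PUnit, ?_, isPerm_of_subsingleton R G _⟩
    rw [IsZero.iff_id_eq_zero]
    rfl

instance : (isPerm R G).IsClosedUnderBinaryProducts where
  limitsOfShape_le := by
    rintro X ⟨p⟩
    refine (isPerm R G).prop_of_iso ?_ (isPerm_prod R G _ _
      (p.prop_diag_obj (.mk .left)) (p.prop_diag_obj (.mk .right)))
    exact IsLimit.conePointUniqueUpToIso (prodIsLimit R G _ _)
      ((IsLimit.postcomposeHomEquiv (diagramIsoPair p.diag) _).2 p.isLimit)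

instance : HasBinaryProducts (Perm R G) :=
  inferInstanceAs (HasLimitsOfShape _ (isPerm R G).FullSubcategory)

instance : HasBinaryBiproducts (Perm R G) :=
  HasBinaryBiproducts.of_hasBinaryProducts

/-! ## The canonical functor -/

/-- The bounded derived category `D_b(RG) = D_b(mod(RG))`. -/
abbrev DbG := Db (ModG R G)

/-- The inclusion `perm(G;R) ⊆ mod(RG)` on bounded homotopy categories. -/
noncomputable abbrev inclKb : Kb (Perm R G) ⥤ Kb (ModG R G) := mapKb (isPerm R G).ι

/-- `K_{b,ac}(perm(G;R))`: the bounded complexes of permutation modules that are acyclic (as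
complexes of `RG`-modules). -/
def acyclicPerm : ObjectProperty (Kb (Perm R G)) :=
  (acyclic (ModG R G)).inverseImage (inclKb R G)

instance : (acyclicPerm R G).IsTriangulated := by
  dsimp only [acyclicPerm]
  infer_instance

/-- The canonical functor `Υ : K_b(perm(G;R)) ⥤ D_b(RG)`. -/
noncomputable def upsilon : Kb (Perm R G) ⥤ DbG R G :=
  inclKb R G ⋙ (acyclic (ModG R G)).trW.Q

/-- The Verdier quotient `K_b(perm(G;R)) / K_{b,ac}(perm(G;R))`. -/
abbrev PermQuotient := (acyclicPerm R G).trW.Localization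

/-- The functor `K_b(perm(G;R)) / K_{b,ac}(perm(G;R)) ⥤ D_b(RG)` induced by `Υ` through the
universal property of the Verdier quotient. -/
noncomputable def upsilonQuotient : PermQuotient R G ⥤ DbG R G :=
  Localization.Construction.lift (upsilon R G)
    ((acyclic (ModG R G)).inverseImage_trW_isInverted (inclKb R G) (acyclic (ModG R G)).trW.Q)

/-- The canonical functor `Ῡ : (K_b(perm(G;R)) / K_{b,ac}(perm(G;R)))^♮ ⥤ D_b(RG)`: the extension
of `upsilonQuotient` to the idempotent completion, which exists (and is unique up to
isomorphism) when `D_b(RG)` is idempotent complete. -/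
noncomputable def upsilonBar [IsIdempotentComplete (DbG R G)] :
    Idempotents.Karoubi (PermQuotient R G) ⥤ DbG R G :=
  (Idempotents.functorExtension (PermQuotient R G) (DbG R G)).obj (upsilonQuotient R G)

/-! ## The subcategory `A(G;R)` -/

variable {R G} in
/-- `X` admits an `m`-free permutation resolution: there is a quasi-isomorphism `s : P ⟶ X` where
`P` is a bounded complex of permutation modules whose terms in homological degrees `i ≤ m` are
free `RG`-modules. -/
def HasFreePermResolution (X : CochainComplex (ModG R G) ℤ) (m : ℤ) : Prop :=
  ∃ (P : CochainComplex (ModG R G) ℤ) (s : P ⟶ X),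
    IsBounded (ModG R G) P ∧ (∀ i : ℤ, isPerm R G (P.X i)) ∧
    (∀ i : ℤ, i ≤ m → Module.Free (MonoidAlgebra R G) (P.X (-i))) ∧ QuasiIso s

/-- The subcategory `A(G;R)` of `D_b(RG)`: the bounded complexes which admit `m`-free permutation
resolutions for all `m ≥ 0`. -/
def catA : ObjectProperty (DbG R G) :=
  fun X ↦ ∀ m : ℤ, 0 ≤ m → HasFreePermResolution X.complex m

/-- The idempotent completion `A(G;R)^♮`, realized inside `D_b(RG)`: the direct summands of objects
of `A(G;R)`. -/
def catANat : ObjectProperty (DbG R G) :=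
  fun X ↦ ∃ Y : DbG R G, (catA R G).isoClosure (X ⊞ Y)

end PermutationModules

/-!
# Free permutation resolutions and the bounded derived category of a finite group

The bounded derived category embeds fully faithfully in the derived category (`toDerived`), where
`𝒜(G;k)` becomes the class `resG` of the objects which are represented by complexes of permutation
modules that are free in arbitrarily many degrees. Two facts about maps out of a complex which is
projective in sufficiently many degrees, compared with the range of degrees of the target,
underlie everything: such maps lift from the derived category to chain maps (`exists_Q_map_eq`),
and they are null-homotopic if they vanish in the derived category (`quotient_map_eq_zero`). Hence
an abstract isomorphism with a resolution comes from a quasi-isomorphism of complexes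
(`ResAll.hasResolution`), and `𝒜(G;k)` is a triangulated subcategory (`isTriangulated_resAll`). It
is not clear beforehand that it is closed under retracts. But if `Z` is a retract of an object of
`𝒜(G;k)`, then `Z⟦1⟧ ⊞ Z` and `Z⟦3⟧ ⊞ Z` are in `𝒜(G;k)`, and if `Z` is moreover represented by
some bounded complex of permutation modules, this allows one to make the complex free in more and
more degrees: `Z` is in `𝒜(G;k)` (`resAll_of_retract`).

*Groups of order a power of the characteristic `p`.* All modules are iterated extensions of the
trivial module `k`, so it is enough to show that `k` is in `𝒜(G;k)`, and by induction this is
known for all proper subgroups; consequently it is known for all permutation modules without fixed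
points in the underlying set. Let `z` be a central element of order `p`. If `z` generates a direct
factor, `G = N × ⟨z⟩`, then the periodic resolution of the cyclic group turns a resolution for `N`
into one for `G` (`CyclicFactor.resMod_triv`). Otherwise, `G` acts on the join of the circles
indexed by `G ⧸ ⟨z⟩`, each of them subdivided into `p` arcs, in such a way that the points of the
circles form the `G`-set `G`. The join is a sphere of odd dimension, on whose cells `z` acts
freely. The choice of orientations that are invariant under `G` uses that `(-1) ^ card G = -1` in
`k`. Dimension shifting along `z - 1` and the norm of `z`, from the top degree of the sphere to
degree zero, shows that the embedding of `k` in the cohomology of degree zero has a retraction in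
the derived category, so that `k` is a retract of the complex of `z`-invariant cochains
(`exists_retract_kernel_zSub`). The terms of this complex are permutation modules on the
`z`-orbits of cells. If `G` fixed such an orbit, then the action on it would split off `⟨z⟩`
(`exists_hom_of_forall`); therefore the complex is in `𝒜(G;k)` by induction, and so is its retract
`k`.

*General groups.* Let `H` be a Sylow `p`-subgroup, or the trivial subgroup in characteristic zero.
As its index is invertible, each complex `X` is a retract of the coinduction of its restriction to
`H`, which is in `𝒜(G;k)`. Hence `X⟦1⟧ ⊞ X` is in `𝒜(G;k)` (`resG_Q_shift_biprod`), so that every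
object is a direct summand of an object of `𝒜(G;k)`, and in particular of a complex of permutation
modules.

*The functor `upsilonBar`.* Idempotents of the bounded derived category are split by induction on
the cohomological amplitude, along the truncation triangles (`isIdempotentComplete_Db`). In the
Verdier quotient of the permutation modules, each complex `P` is a retract of a complex which is
free in many degrees, namely of a resolution of `P⟦1⟧ ⊞ P` (`exists_permQ_cover`); by the two
facts above, the functor to the bounded derived category is full and faithful. Since every object
of the target is a retract of an object in the image, the functor becomes an equivalence on
idempotent completions (`isEquivalence_functorExtension_obj`).
-/

/-! ### Lifting morphisms of the derived category to chain maps -/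

namespace BoundedHomotopy

section Lifting

variable {A : Type*} [Category A] [Abelian A]

/-- The construction of a null-homotopy by descending induction: the family `h` satisfies the
equation of a homotopy in the degrees `≥ c + 1 - n`. -/
theorem exists_partial_homotopy {P N : CochainComplex A ℤ} (f : P ⟶ N) (b c : ℤ)
    [P.IsStrictlyLE c] (hP : ∀ i, b ≤ i → Projective (P.X i)) [N.IsStrictlyGE b]
    (hN : N.Acyclic) (n : ℕ) :
    ∃ h : ∀ i j : ℤ, P.X i ⟶ N.X j, ∀ i j l : ℤ, c + 1 - n ≤ i → j + 1 = i → i + 1 = l →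
      f.f i = P.d i l ≫ h l i + h i j ≫ N.d j i := by
  induction n with
  | zero =>
    exact ⟨fun _ _ ↦ 0, fun i j l hi _ _ ↦
      (P.isZero_of_isStrictlyLE c i (by push_cast at hi; lia)).eq_of_src _ _⟩
  | succ n ih =>
    obtain ⟨h, hh⟩ := ih
    set m : ℤ := c + 1 - (n + 1 : ℕ) with hm
    have hm' : c + 1 - (n : ℤ) = m + 1 := by push_cast at hm; lia
    -- The part of `f` in degree `m` which is not yet accounted for is a cocycle, so it lifts.
    have ht : (f.f m - P.d m (m + 1) ≫ h (m + 1) m) ≫ N.d m (m + 1) = 0 := by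
      have := hh (m + 1) m (m + 1 + 1) (by lia) rfl rfl
      rw [Preadditive.sub_comp, Category.assoc, f.comm, this]
      simp
    obtain ⟨s, hs⟩ : ∃ s : P.X m ⟶ N.X (m - 1),
        s ≫ N.d (m - 1) m = f.f m - P.d m (m + 1) ≫ h (m + 1) m := by
      by_cases hb : b ≤ m
      · have := hP m hb
        have hex := (HomologicalComplex.exactAt_iff' N (m - 1) m (m + 1)
          (by simp) (by simp)).1 (hN m)
        exact ⟨hex.liftFromProjective _ ht, hex.liftFromProjective_comp _ ht⟩
      · exact ⟨0, (N.isZero_of_isStrictlyGE b m (by lia)).eq_of_tgt _ _⟩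
    refine ⟨Function.update h m (Function.update (h m) (m - 1) s), fun i j l hi hj hl ↦ ?_⟩
    rw [Function.update_of_ne (show l ≠ m by lia)]
    by_cases him : i = m
    · rw [him] at hi hj hl ⊢
      obtain rfl : j = m - 1 := by lia
      subst hl
      simp [hs]
    · rw [Function.update_of_ne him]
      exact hh i j l (by lia) hj hl

/-- A morphism from a bounded above complex `P` to an acyclic complex which vanishes below
degree `b` is null-homotopic as soon as `P` is projective in the degrees `≥ b`. -/
theorem nonempty_homotopy_zero {P N : CochainComplex A ℤ} (f : P ⟶ N) (b c : ℤ)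
    [P.IsStrictlyLE c] (hP : ∀ i, b ≤ i → Projective (P.X i)) [N.IsStrictlyGE b]
    (hN : N.Acyclic) : Nonempty (Homotopy f 0) := by
  obtain ⟨h, hh⟩ := exists_partial_homotopy f b c hP hN (c + 1 - b).toNat
  refine ⟨{ hom := fun i j ↦ if j + 1 = i then h i j else 0
            zero := fun i j hij ↦ if_neg (by simpa using hij)
            comm := fun i ↦ ?_ }⟩
  by_cases hi : b ≤ i
  · rw [dNext_eq _ (show (ComplexShape.up ℤ).Rel i (i + 1) by simp),
      prevD_eq _ (show (ComplexShape.up ℤ).Rel (i - 1) i by simp),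
      if_pos rfl, if_pos (by lia), HomologicalComplex.zero_f, add_zero]
    exact hh i (i - 1) (i + 1) (by lia) (by lia) rfl
  · exact (N.isZero_of_isStrictlyGE b i (by lia)).eq_of_tgt _ _

/-- The vanishing of `nonempty_homotopy_zero`, in the homotopy category. -/
theorem quotient_hom_eq_zero {P N : CochainComplex A ℤ} (b c : ℤ)
    [P.IsStrictlyLE c] (hP : ∀ i, b ≤ i → Projective (P.X i)) [N.IsStrictlyGE b]
    (hN : N.Acyclic) (f : (HomotopyCategory.quotient A (ComplexShape.up ℤ)).obj P ⟶
      (HomotopyCategory.quotient A (ComplexShape.up ℤ)).obj N) : f = 0 := by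
  obtain ⟨f, rfl⟩ := (HomotopyCategory.quotient _ _).map_surjective f
  obtain ⟨h⟩ := nonempty_homotopy_zero f b c hP hN
  rw [HomotopyCategory.eq_of_homotopy f 0 h, Functor.map_zero]

theorem isStrictlyGE_mappingCone {K L : CochainComplex A ℤ} (f : K ⟶ L) (b : ℤ)
    [K.IsStrictlyGE (b + 1)] [L.IsStrictlyGE b] :
    (CochainComplex.mappingCone f).IsStrictlyGE b := by
  rw [CochainComplex.isStrictlyGE_iff]
  intro i hi
  rw [CochainComplex.mappingCone.isZero_X_iff]
  exact ⟨K.isZero_of_isStrictlyGE (b + 1) _ (by lia), L.isZero_of_isStrictlyGE b _ (by lia)⟩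

theorem acyclic_mappingCone {K L : CochainComplex A ℤ} (f : K ⟶ L) [QuasiIso f] :
    (CochainComplex.mappingCone f).Acyclic := by
  rw [← HomotopyCategory.quotient_obj_mem_subcategoryAcyclic_iff_acyclic]
  refine ((HomotopyCategory.subcategoryAcyclic A).trW_iff_of_distinguished _
    (HomotopyCategory.mappingCone_triangleh_distinguished f)).1 ?_
  rw [← HomotopyCategory.quasiIso_eq_trW_subcategoryAcyclic]
  exact (HomotopyCategory.quotient_map_mem_quasiIso_iff f).2 ‹_›

variable [HasDerivedCategory A]

open DerivedCategory

/-- A morphism in the derived category, from a complex `P` to a complex `X` which vanishes in the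
degrees `≤ b`, is a chain map as soon as `P` is projective in the degrees `≥ b`: there are no maps
from `P` to the cones of the quasi-isomorphisms out of `X`. -/
theorem exists_Q_map_eq {P X : CochainComplex A ℤ} (b c : ℤ) [P.IsStrictlyLE c]
    (hP : ∀ i, b ≤ i → Projective (P.X i)) [X.IsStrictlyGE (b + 1)]
    (φ : Q.obj P ⟶ Q.obj X) : ∃ f : P ⟶ X, Q.map f = φ := by
  obtain ⟨X', _, g, s, hs, rfl⟩ := left_fac_of_isStrictlyGE φ (b + 1)
  rw [isIso_Q_map_iff_quasiIso] at hs
  have := X'.isStrictlyGE_of_ge b (b + 1) (by lia)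
  have := isStrictlyGE_mappingCone s b
  obtain ⟨f, hf⟩ := Triangle.coyoneda_exact₂ _
    (HomotopyCategory.mappingCone_triangleh_distinguished s)
    ((HomotopyCategory.quotient A (ComplexShape.up ℤ)).map g)
    (quotient_hom_eq_zero b c hP (acyclic_mappingCone s) _)
  obtain ⟨f : P ⟶ X, rfl⟩ := (HomotopyCategory.quotient _ _).map_surjective f
  refine ⟨f, ?_⟩
  have h : (HomotopyCategory.quotient A (ComplexShape.up ℤ)).map g =
    (HomotopyCategory.quotient A (ComplexShape.up ℤ)).map (f ≫ s) := by
    rw [Functor.map_comp]; exact hf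
  rw [IsIso.eq_comp_inv, ← Q.map_comp]
  exact (DerivedCategory.Q_map_eq_of_homotopy _ (HomotopyCategory.homotopyOfEq _ _ h)).symm

/-- A chain map which vanishes in the derived category factors, up to homotopy, through an
acyclic complex, which lives in the same range of degrees as the target. -/
theorem exists_factor_acyclic {P X : CochainComplex A ℤ} (b : ℤ) [X.IsStrictlyGE b]
    (f : P ⟶ X) (hf : Q.map f = 0) :
    ∃ (N : CochainComplex A ℤ) (_ : N.IsStrictlyGE b) (_ : N.Acyclic) (g : P ⟶ N)
      (h : (HomotopyCategory.quotient A (ComplexShape.up ℤ)).obj N ⟶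
        (HomotopyCategory.quotient A (ComplexShape.up ℤ)).obj X),
      (HomotopyCategory.quotient A (ComplexShape.up ℤ)).map f =
        (HomotopyCategory.quotient A (ComplexShape.up ℤ)).map g ≫ h := by
  have h : Qh.map ((HomotopyCategory.quotient A (ComplexShape.up ℤ)).map f) = Qh.map 0 := by
    rw [← cancel_mono ((quotientCompQhIso A).hom.app X), quotientCompQhIso_hom_naturality, hf]
    simp
  rw [MorphismProperty.map_eq_iff_postcomp Qh (HomotopyCategory.quasiIso A _)] at h
  obtain ⟨Z, s, hs, fac⟩ := h
  obtain ⟨Z : CochainComplex A ℤ, rfl⟩ := HomotopyCategory.quotient_obj_surjective Z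
  obtain ⟨s, rfl⟩ := (HomotopyCategory.quotient _ _).map_surjective s
  rw [HomotopyCategory.quotient_map_mem_quasiIso_iff] at hs
  have : QuasiIso s := hs
  -- Truncating the target of `s` makes the cone live in the degrees `≥ b - 1`.
  let s' : X ⟶ Z.truncGE b := s ≫ Z.πTruncGE b
  have : QuasiIso s' := by
    have : QuasiIso (CochainComplex.truncGEMap s b) := by
      rw [CochainComplex.quasiIso_truncGEMap_iff]; infer_instance
    have := CochainComplex.πTruncGE_naturality s b
    dsimp [s']
    rw [← this]
    infer_instance
  have h0 : (HomotopyCategory.quotient A (ComplexShape.up ℤ)).map f ≫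
      (HomotopyCategory.quotient A (ComplexShape.up ℤ)).map s' = 0 := by
    dsimp [s']
    rw [Functor.map_comp, reassoc_of% fac]
    simp
  have := X.isStrictlyGE_of_ge (b - 1) b (by lia)
  have : X.IsStrictlyGE (b - 1 + 1) := by rwa [sub_add_cancel]
  have := (Z.truncGE b).isStrictlyGE_of_ge (b - 1) b (by lia)
  have := isStrictlyGE_mappingCone s' (b - 1)
  have := CochainComplex.isStrictlyGE_shift (CochainComplex.mappingCone s') (b - 1) (-1) b (by lia)
  obtain ⟨g, hg⟩ := Triangle.coyoneda_exact₂ _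
    (inv_rot_of_distTriang _ (HomotopyCategory.mappingCone_triangleh_distinguished s'))
    ((HomotopyCategory.quotient A (ComplexShape.up ℤ)).map f) h0
  have hac : ((CochainComplex.mappingCone s')⟦(-1 : ℤ)⟧).Acyclic := by
    rw [← HomotopyCategory.quotient_obj_mem_subcategoryAcyclic_iff_acyclic,
      ← HomotopyCategory.shift_quotient_obj]
    refine (HomotopyCategory.subcategoryAcyclic A).le_shift _ _ ?_
    rw [HomotopyCategory.quotient_obj_mem_subcategoryAcyclic_iff_acyclic]
    exact acyclic_mappingCone s'
  let e := ((HomotopyCategory.quotient A (ComplexShape.up ℤ)).commShiftIso (-1 : ℤ)).app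
    (CochainComplex.mappingCone s')
  have key : ∀ g₀ : (HomotopyCategory.quotient A (ComplexShape.up ℤ)).obj P ⟶
      ((HomotopyCategory.quotient A (ComplexShape.up ℤ)).obj
        (CochainComplex.mappingCone s'))⟦(-1 : ℤ)⟧,
      ∃ g' : P ⟶ (CochainComplex.mappingCone s')⟦(-1 : ℤ)⟧,
        g₀ = (HomotopyCategory.quotient A (ComplexShape.up ℤ)).map g' ≫ e.hom := fun g₀ ↦ by
    obtain ⟨g', hg'⟩ := (HomotopyCategory.quotient A (ComplexShape.up ℤ)).map_surjective
      (g₀ ≫ e.inv)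
    refine ⟨g', ?_⟩
    rw [hg']
    simp
  obtain ⟨g', hg'⟩ := key g
  refine ⟨(CochainComplex.mappingCone s')⟦(-1 : ℤ)⟧, inferInstance, hac, g',
    e.hom ≫ (CochainComplex.mappingCone.triangleh s').invRotate.mor₁, hg.trans ?_⟩
  subst hg'
  exact Category.assoc _ _ _

/-- A chain map to a complex which vanishes below degree `b` is null-homotopic if it vanishes in the
derived category and its source is projective in the degrees `≥ b`. -/
theorem quotient_map_eq_zero {P X : CochainComplex A ℤ} (b c : ℤ) [P.IsStrictlyLE c]
    (hP : ∀ i, b ≤ i → Projective (P.X i)) [X.IsStrictlyGE b]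
    (f : P ⟶ X) (hf : Q.map f = 0) :
    (HomotopyCategory.quotient A (ComplexShape.up ℤ)).map f = 0 := by
  obtain ⟨N, _, hN, g, h, e⟩ := exists_factor_acyclic b f hf
  rw [e, quotient_hom_eq_zero b c hP hN ((HomotopyCategory.quotient _ _).map g), zero_comp]

/-- A chain map between bounded complexes which vanishes in the derived category factors, up to
homotopy, through a bounded acyclic complex. -/
theorem exists_factor_bounded_acyclic {P X : CochainComplex A ℤ} (b c : ℤ) [P.IsStrictlyLE c]
    [X.IsStrictlyGE b] (f : P ⟶ X) (hf : Q.map f = 0) :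
    ∃ (N : CochainComplex A ℤ) (_ : IsBounded A N) (_ : N.Acyclic) (g : P ⟶ N)
      (h : (HomotopyCategory.quotient A (ComplexShape.up ℤ)).obj N ⟶
        (HomotopyCategory.quotient A (ComplexShape.up ℤ)).obj X),
      (HomotopyCategory.quotient A (ComplexShape.up ℤ)).map f =
        (HomotopyCategory.quotient A (ComplexShape.up ℤ)).map g ≫ h := by
  obtain ⟨N, _, hN, g, h, e⟩ := exists_factor_acyclic b f hf
  refine ⟨N.truncLE c, ⟨⟨b, inferInstance⟩, ⟨c, inferInstance⟩⟩, hN.truncLE _,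
    inv (P.ιTruncLE c) ≫ CochainComplex.truncLEMap g c,
    (HomotopyCategory.quotient _ _).map (N.ιTruncLE c) ≫ h, ?_⟩
  rw [e, ← Category.assoc, ← Functor.map_comp, Category.assoc,
    CochainComplex.ιTruncLE_naturality, IsIso.inv_hom_id_assoc]

end Lifting

/-! ### The bounded derived category inside the derived category -/

section Of

variable {C : Type*} [Category C] [Preadditive C]

/-- A bounded complex, as an object of the bounded homotopy category. -/
def Kb.of (K : CochainComplex C ℤ) (hK : IsBounded C K) : Kb C :=
  ⟨(HomotopyCategory.quotient C (ComplexShape.up ℤ)).obj K, hK⟩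

/-- The homotopy class of a chain map between bounded complexes. -/
def Kb.homOf {K L : CochainComplex C ℤ} (hK : IsBounded C K) (hL : IsBounded C L) (f : K ⟶ L) :
    Kb.of K hK ⟶ Kb.of L hL :=
  ObjectProperty.homMk ((HomotopyCategory.quotient C (ComplexShape.up ℤ)).map f)

theorem Kb.exists_eq_of (X : Kb C) : ∃ K hK, X = Kb.of (C := C) K hK :=
  ⟨X.obj.as, X.property, rfl⟩

theorem Kb.exists_eq_homOf {K L : CochainComplex C ℤ} {hK : IsBounded C K} {hL : IsBounded C L}
    (φ : Kb.of K hK ⟶ Kb.of L hL) : ∃ f : K ⟶ L, φ = Kb.homOf hK hL f := by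
  obtain ⟨f, hf⟩ := (HomotopyCategory.quotient C (ComplexShape.up ℤ)).map_surjective φ.hom
  exact ⟨f, by ext; exact hf.symm⟩

theorem Kb.homOf_comp {K L M : CochainComplex C ℤ} (hK : IsBounded C K) (hL : IsBounded C L)
    (hM : IsBounded C M) (f : K ⟶ L) (g : L ⟶ M) :
    Kb.homOf hK hM (f ≫ g) = Kb.homOf hK hL f ≫ Kb.homOf hL hM g := by
  ext
  exact (HomotopyCategory.quotient C (ComplexShape.up ℤ)).map_comp f g

theorem Kb.homOf_eq_zero {K L : CochainComplex C ℤ} (hK : IsBounded C K) (hL : IsBounded C L)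
    (f : K ⟶ L) (hf : (HomotopyCategory.quotient C (ComplexShape.up ℤ)).map f = 0) :
    Kb.homOf hK hL f = 0 := by
  ext
  exact hf

end Of

section ToDerived

variable {A : Type*} [Category A] [Abelian A]

theorem acyclic_trW_homOf_iff {K L : CochainComplex A ℤ} (hK : IsBounded A K)
    (hL : IsBounded A L) (s : K ⟶ L) : (acyclic A).trW (Kb.homOf hK hL s) ↔ QuasiIso s := by
  refine Iff.trans (ObjectProperty.inverseImage_trW_iff (HomotopyCategory.subcategoryAcyclic A)
    (bounded A).ι (Kb.homOf hK hL s)) ?_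
  rw [← HomotopyCategory.quasiIso_eq_trW_subcategoryAcyclic]
  exact HomotopyCategory.quotient_map_mem_quasiIso_iff s

/-- A bounded complex, as an object of the bounded derived category. -/
noncomputable abbrev Db.of (K : CochainComplex A ℤ) (hK : IsBounded A K) : Db A :=
  (acyclic A).trW.Q.obj (Kb.of K hK)

theorem Db.exists_eq_of (X : Db A) :
    ∃ hK : IsBounded A X.complex, X = Db.of X.complex hK :=
  ⟨((Localization.Construction.objEquiv (acyclic A).trW).symm X).property,
    ((Localization.Construction.objEquiv (acyclic A).trW).apply_symm_apply X).symm⟩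

theorem isZero_acyclic_trW_Q_obj (N : Kb A) (hN : acyclic A N) :
    IsZero ((acyclic A).trW.Q.obj N) := by
  have : IsIso ((acyclic A).trW.Q.map (contractibleTriangle N).mor₂) :=
    Localization.inverts _ (acyclic A).trW _
      (ObjectProperty.trW.mk' _ (contractible_distinguished N) hN)
  exact ((acyclic A).trW.Q.map_isZero (isZero_zero (Kb A))).of_iso (@asIso _ _ _ _ _ this)

variable (A) [HasDerivedCategory A]

open DerivedCategory

variable {A} in
theorem isIso_Qh_map_iff {X Y : HomotopyCategory A (ComplexShape.up ℤ)} (s : X ⟶ Y) :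
    IsIso (Qh.map s) ↔ HomotopyCategory.quasiIso A _ s := by
  obtain ⟨X : CochainComplex A ℤ, rfl⟩ := X.quotient_obj_surjective
  obtain ⟨Y : CochainComplex A ℤ, rfl⟩ := Y.quotient_obj_surjective
  obtain ⟨s, rfl⟩ := (HomotopyCategory.quotient _ _).map_surjective s
  rw [HomotopyCategory.quotient_map_mem_quasiIso_iff, HomologicalComplex.mem_quasiIso_iff,
    ← isIso_Q_map_iff_quasiIso]
  exact (NatIso.isIso_map_iff (quotientCompQhIso A) s)

/-- The comparison functor from the bounded derived category to the derived category. -/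
noncomputable def toDerived : Db A ⥤ DerivedCategory A :=
  Localization.Construction.lift ((bounded A).ι ⋙ Qh) (fun _ _ s hs ↦ by
    refine (isIso_Qh_map_iff s.hom).2 ?_
    rw [HomotopyCategory.quasiIso_eq_trW_subcategoryAcyclic]
    exact (ObjectProperty.inverseImage_trW_iff _ _ s).1 hs)

/-- The comparison functor is the identity on bounded complexes. -/
noncomputable def toDerivedQIso : (acyclic A).trW.Q ⋙ toDerived A ≅ (bounded A).ι ⋙ Qh :=
  eqToIso (Localization.Construction.fac _ _)

instance : (toDerived A).Additive :=
  (Localization.functor_additive_iff (acyclic A).trW.Q (acyclic A).trW (toDerived A)).2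
    (Functor.additive_of_iso (toDerivedQIso A).symm)

variable {A}

/-- The image of a bounded complex in the derived category. -/
noncomputable def toDerivedOfIso (K : CochainComplex A ℤ) (hK : IsBounded A K) :
    (toDerived A).obj (Db.of K hK) ≅ Q.obj K :=
  (toDerivedQIso A).app (Kb.of K hK) ≪≫ (quotientCompQhIso A).app K

theorem toDerived_map_homOf {K L : CochainComplex A ℤ} (hK : IsBounded A K) (hL : IsBounded A L)
    (f : K ⟶ L) : (toDerived A).map ((acyclic A).trW.Q.map (Kb.homOf hK hL f)) =
      (toDerivedOfIso K hK).hom ≫ Q.map f ≫ (toDerivedOfIso L hL).inv := by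
  have h₁ := (toDerivedQIso A).hom.naturality (Kb.homOf hK hL f)
  have h₂ := (quotientCompQhIso A).hom.naturality f
  rw [← Category.assoc, Iso.eq_comp_inv]
  dsimp only [toDerivedOfIso, Iso.trans_hom, Iso.app_hom]
  erw [reassoc_of% h₁]
  erw [h₂]
  exact (Category.assoc _ _ _).symm

theorem acyclic_trW_Q_map_homOf_eq_zero {K L : CochainComplex A ℤ} (hK : IsBounded A K)
    (hL : IsBounded A L) (f : K ⟶ L) (hf : Q.map f = 0) :
    (acyclic A).trW.Q.map (Kb.homOf hK hL f) = 0 := by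
  obtain ⟨-, ⟨c, _⟩⟩ := id hK
  obtain ⟨⟨b, _⟩, -⟩ := id hL
  obtain ⟨N, hN, hN', g, h, e⟩ := exists_factor_bounded_acyclic b c f hf
  let h' : Kb.of N hN ⟶ Kb.of L hL := ObjectProperty.homMk h
  have hfac : Kb.homOf hK hL f = Kb.homOf hK hN g ≫ h' := by
    ext
    exact e
  have hN0 : IsZero ((acyclic A).trW.Q.obj (Kb.of N hN)) :=
    isZero_acyclic_trW_Q_obj _
      ((HomotopyCategory.quotient_obj_mem_subcategoryAcyclic_iff_acyclic N).2 hN')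
  rw [hfac, Functor.map_comp, hN0.eq_of_tgt ((acyclic A).trW.Q.map (Kb.homOf hK hN g)) 0,
    zero_comp]

instance : (toDerived A).Faithful :=
  Functor.faithful_of_comp_cancel_zero_of_hasLeftCalculusOfFractions (acyclic A).trW.Q
    (acyclic A).trW _ (by
      intro X Y f hf
      obtain ⟨K, hK, rfl⟩ := X.exists_eq_of
      obtain ⟨L, hL, rfl⟩ := Y.exists_eq_of
      obtain ⟨f, rfl⟩ := Kb.exists_eq_homOf f
      refine acyclic_trW_Q_map_homOf_eq_zero hK hL f ?_
      rw [toDerived_map_homOf] at hf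
      simpa using hf)

instance : (toDerived A).Full where
  map_surjective {X Y} φ := by
    obtain ⟨hK, hX⟩ := X.exists_eq_of
    obtain ⟨hL, hY⟩ := Y.exists_eq_of
    generalize X.complex = K at hK hX
    generalize Y.complex = L at hL hY
    subst hX hY
    obtain ⟨⟨a, _⟩, ⟨c, _⟩⟩ := id hK
    obtain ⟨⟨b, _⟩, -⟩ := id hL
    have := K.isStrictlyGE_of_ge (min a b) a (by lia)
    have := L.isStrictlyGE_of_ge (min a b) b (by lia)
    obtain ⟨K', hK'₁, hK'₂, s, hs, g, hg⟩ := right_fac_of_isStrictlyLE_of_isStrictlyGE (min a b) c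
      ((toDerivedOfIso K hK).inv ≫ φ ≫ (toDerivedOfIso L hL).hom)
    have hK' : IsBounded A K' := ⟨⟨_, hK'₁⟩, ⟨_, hK'₂⟩⟩
    have : IsIso ((acyclic A).trW.Q.map (Kb.homOf hK' hK s)) :=
      Localization.inverts _ (acyclic A).trW _
        ((acyclic_trW_homOf_iff _ _ _).2 ((DerivedCategory.isIso_Q_map_iff_quasiIso _ s).1 hs))
    refine ⟨(asIso ((acyclic A).trW.Q.map (Kb.homOf hK' hK s))).inv ≫
      (acyclic A).trW.Q.map (Kb.homOf hK' hL g), ?_⟩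
    rw [Functor.map_comp, ← Functor.mapIso_inv, Iso.inv_comp_eq, Functor.mapIso_hom, asIso_hom,
      toDerived_map_homOf, toDerived_map_homOf]
    rw [Iso.inv_comp_eq, ← Category.assoc, ← Iso.eq_comp_inv] at hg
    rw [hg]
    simp

end ToDerived

end BoundedHomotopy

/-! ### Idempotent completeness of the bounded derived category -/

namespace BoundedHomotopy

section Idempotents

/-- An endomorphism splits if it is the projection onto a retract. -/
def Splits {C : Type*} [Category C] {X : C} (e : X ⟶ X) : Prop :=
  ∃ (Y : C) (i : Y ⟶ X) (p : X ⟶ Y), i ≫ p = 𝟙 Y ∧ p ≫ i = e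

/-- An idempotent endomorphism of an object in the essential image of a fully faithful functor
splits, if the source of the functor is idempotent complete. -/
theorem Splits.of_iso {C D : Type*} [Category C] [Category D] (F : C ⥤ D) [F.Full] [F.Faithful]
    (hC : IsIdempotentComplete C) {X : C} {X' : D} (α : X' ≅ F.obj X) (e : X' ⟶ X')
    (he : e ≫ e = e) : Splits e := by
  obtain ⟨f, hf⟩ := F.map_surjective (α.inv ≫ e ≫ α.hom)
  obtain ⟨Y, i, p, h₁, h₂⟩ := hC.idempotents_split X f (F.map_injective (by
    simp [hf, reassoc_of% he]))
  refine ⟨F.obj Y, F.map i ≫ α.inv, α.hom ≫ F.map p, ?_, ?_⟩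
  · rw [Category.assoc, α.inv_hom_id_assoc, ← F.map_comp, h₁, F.map_id]
  · rw [Category.assoc, ← F.map_comp_assoc, h₂, hf]
    simp

/-- In an idempotent endomorphism of a distinguished triangle, the middle component splits if
the two outer components do. -/
theorem Splits.of_triangle {C : Type*} [Category C] [Preadditive C] [HasZeroObject C]
    [HasShift C ℤ] [∀ n : ℤ, (shiftFunctor C n).Additive] [Pretriangulated C]
    {T : Triangle C} (hT : T ∈ distTriang C) (φ : T ⟶ T)
    (h₂ : φ.hom₂ ≫ φ.hom₂ = φ.hom₂) (s₁ : Splits φ.hom₁) (s₃ : Splits φ.hom₃) :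
    Splits φ.hom₂ := by
  obtain ⟨A, i₁, p₁, h₁, e₁⟩ := s₁
  obtain ⟨B, i₃, p₃, h₃, e₃⟩ := s₃
  have c₁ := φ.comm₁
  have c₂ := φ.comm₂
  have c₃ := φ.comm₃
  obtain ⟨Y, f, g, hY⟩ := distinguished_cocone_triangle₂ (i₃ ≫ T.mor₃ ≫ p₁⟦(1 : ℤ)⟧')
  have hp : p₁⟦(1 : ℤ)⟧' ≫ i₁⟦(1 : ℤ)⟧' = φ.hom₁⟦(1 : ℤ)⟧' := by rw [← Functor.map_comp, e₁]
  have hi₃ : i₃ ≫ φ.hom₃ = i₃ := by rw [← e₃, reassoc_of% h₃]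
  have hp₁ : φ.hom₁ ≫ p₁ = p₁ := by rw [← e₁, Category.assoc, h₁, Category.comp_id]
  have hi₁ : i₁ ≫ φ.hom₁ = i₁ := by rw [← e₁, reassoc_of% h₁]
  have hp₃ : φ.hom₃ ≫ p₃ = p₃ := by rw [← e₃, Category.assoc, h₃, Category.comp_id]
  -- completions of the inclusions and projections of the outer retracts
  obtain ⟨β, hβ₁, hβ₂⟩ := complete_distinguished_triangle_morphism₂ _ T hY hT i₁ i₃ (by
    change (i₃ ≫ T.mor₃ ≫ p₁⟦(1 : ℤ)⟧') ≫ i₁⟦(1 : ℤ)⟧' = i₃ ≫ T.mor₃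
    rw [Category.assoc, Category.assoc, hp, c₃, reassoc_of% hi₃])
  obtain ⟨π, hπ₁, hπ₂⟩ := complete_distinguished_triangle_morphism₂ T _ hT hY p₁ p₃ (by
    change T.mor₃ ≫ p₁⟦(1 : ℤ)⟧' = p₃ ≫ i₃ ≫ T.mor₃ ≫ p₁⟦(1 : ℤ)⟧'
    rw [reassoc_of% e₃, ← reassoc_of% c₃, ← Functor.map_comp, hp₁])
  change Y ⟶ T.obj₂ at β
  change T.obj₂ ⟶ Y at π
  change f ≫ β = i₁ ≫ T.mor₁ at hβ₁
  change g ≫ i₃ = β ≫ T.mor₂ at hβ₂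
  change T.mor₁ ≫ π = p₁ ≫ f at hπ₁
  change T.mor₂ ≫ p₃ = π ≫ g at hπ₂
  have hθ₁ : f ≫ β ≫ φ.hom₂ ≫ π = f := by
    rw [reassoc_of% hβ₁, reassoc_of% c₁, hπ₁, reassoc_of% hi₁, reassoc_of% h₁]
  have hθ₂ : (β ≫ φ.hom₂ ≫ π) ≫ g = g := by
    rw [Category.assoc, Category.assoc, ← hπ₂, ← reassoc_of% c₂, ← reassoc_of% hβ₂, hp₃, h₃,
      Category.comp_id]
  let θ : Triangle.mk f g (i₃ ≫ T.mor₃ ≫ p₁⟦(1 : ℤ)⟧') ⟶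
      Triangle.mk f g (i₃ ≫ T.mor₃ ≫ p₁⟦(1 : ℤ)⟧') :=
    { hom₁ := 𝟙 A
      hom₂ := β ≫ φ.hom₂ ≫ π
      hom₃ := 𝟙 B
      comm₁ := hθ₁.trans (Category.id_comp f).symm
      comm₂ := (Category.comp_id g).trans hθ₂.symm
      comm₃ := by
        change (i₃ ≫ T.mor₃ ≫ p₁⟦(1 : ℤ)⟧') ≫ (𝟙 A)⟦(1 : ℤ)⟧' =
          𝟙 B ≫ i₃ ≫ T.mor₃ ≫ p₁⟦(1 : ℤ)⟧'
        simp }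
  have hθ : IsIso (β ≫ φ.hom₂ ≫ π) :=
    isIso₂_of_isIso₁₃ θ hY hY (inferInstanceAs (IsIso (𝟙 A))) (inferInstanceAs (IsIso (𝟙 B)))
  replace hθ₁ : f ≫ inv (β ≫ φ.hom₂ ≫ π) = f := by
    rw [IsIso.comp_inv_eq, hθ₁]
  replace hθ₂ : inv (β ≫ φ.hom₂ ≫ π) ≫ g = g := by
    rw [IsIso.inv_comp_eq, hθ₂]
  have hid : (β ≫ φ.hom₂) ≫ φ.hom₂ ≫ π ≫ inv (β ≫ φ.hom₂ ≫ π) = 𝟙 _ := by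
    have : (β ≫ φ.hom₂) ≫ φ.hom₂ ≫ π ≫ inv (β ≫ φ.hom₂ ≫ π) =
        (β ≫ φ.hom₂ ≫ π) ≫ inv (β ≫ φ.hom₂ ≫ π) := by
      simp only [Category.assoc, reassoc_of% h₂]
    rw [this, IsIso.hom_inv_id]
  refine ⟨Y, β ≫ φ.hom₂, φ.hom₂ ≫ π ≫ inv (β ≫ φ.hom₂ ≫ π), hid, ?_⟩
  set e := (φ.hom₂ ≫ π ≫ inv (β ≫ φ.hom₂ ≫ π)) ≫ β ≫ φ.hom₂ with he
  -- `e` and `φ.hom₂` are commuting idempotents whose difference has square zero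
  have hee : e ≫ e = e := by
    rw [he]
    simp only [Category.assoc] at hid ⊢
    rw [reassoc_of% hid]
  have heb : e ≫ φ.hom₂ = e := by rw [he]; simp only [Category.assoc, h₂]
  have hbe : φ.hom₂ ≫ e = e := by rw [he]; simp only [Category.assoc, reassoc_of% h₂]
  have hz₁ : T.mor₁ ≫ (φ.hom₂ - e) = 0 := by
    rw [Preadditive.comp_sub, he]
    simp only [Category.assoc]
    rw [reassoc_of% c₁, reassoc_of% hπ₁, reassoc_of% hθ₁, reassoc_of% hβ₁, c₁, reassoc_of% hp₁,
      reassoc_of% e₁, ← e₁]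
    simp [reassoc_of% h₁]
  have hz₂ : (φ.hom₂ - e) ≫ T.mor₂ = 0 := by
    rw [Preadditive.sub_comp, he]
    simp only [Category.assoc]
    rw [← c₂, ← reassoc_of% hβ₂, hi₃, reassoc_of% hθ₂, ← reassoc_of% hπ₂, ← reassoc_of% c₂,
      ← e₃]
    simp [reassoc_of% h₃]
  obtain ⟨r, hr⟩ := Triangle.coyoneda_exact₂ _ hT _ hz₂
  have hsq : (φ.hom₂ - e) ≫ (φ.hom₂ - e) = 0 := by
    conv_lhs => lhs; rw [hr]
    rw [Category.assoc, hz₁, comp_zero]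
  rw [Preadditive.sub_comp, Preadditive.comp_sub, Preadditive.comp_sub, h₂, hbe, heb, hee,
    sub_self, sub_zero] at hsq
  exact (sub_eq_zero.1 hsq).symm

variable {A : Type*} [Category A] [Abelian A] [HasDerivedCategory A]

open DerivedCategory DerivedCategory.TStructure

/-- Idempotents of bounded objects of the derived category split, by induction on the
cohomological amplitude. -/
theorem splits_of_isGE_of_isLE (n : ℕ) : ∀ (a : ℤ) (X : DerivedCategory A) (_ : t.IsGE X a)
    (_ : t.IsLE X (a + n)) (e : X ⟶ X) (_ : e ≫ e = e), Splits e := by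
  induction n with
  | zero =>
    intro a X _ _ e he
    have : t.IsLE X a := by simpa using ‹t.IsLE X (a + (0 : ℕ))›
    obtain ⟨Y, ⟨α⟩⟩ := exists_iso_singleFunctor_obj_of_isGE_of_isLE X a
    exact Splits.of_iso (singleFunctor A a) inferInstance α e he
  | succ n ih =>
    intro a X _ _ e he
    have := t.isLE_truncLE_obj X a a
    have := t.isGE_truncGT_obj X a (a + 1)
    have : t.IsLE X (a + 1 + n) := by
      have : a + ((n + 1 : ℕ) : ℤ) = a + 1 + n := by push_cast; ring
      rwa [← this]
    refine Splits.of_triangle (t.triangleLEGT_distinguished a X)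
      ((t.triangleLEGT a).map e) he ?_ ?_
    · exact ih a ((t.truncLE a).obj X) inferInstance
        (t.isLE_of_le ((t.truncLE a).obj X) a _ (by lia)) _
        (((t.truncLE a).map_comp e e).symm.trans (by rw [he]; rfl))
    · exact ih (a + 1) ((t.truncGT a).obj X) inferInstance inferInstance _
        (((t.truncGT a).map_comp e e).symm.trans (by rw [he]; rfl))

theorem isGE_of_retract {X Y : DerivedCategory A} (i : Y ⟶ X) (p : X ⟶ Y) (h : i ≫ p = 𝟙 Y)
    (a : ℤ) [X.IsGE a] : Y.IsGE a := by
  rw [isGE_iff]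
  intro j hj
  rw [IsZero.iff_id_eq_zero, ← CategoryTheory.Functor.map_id, ← h, Functor.map_comp,
    (X.isZero_of_isGE a j hj).eq_of_tgt ((homologyFunctor A j).map i) 0, zero_comp]

theorem isLE_of_retract {X Y : DerivedCategory A} (i : Y ⟶ X) (p : X ⟶ Y) (h : i ≫ p = 𝟙 Y)
    (b : ℤ) [X.IsLE b] : Y.IsLE b := by
  rw [isLE_iff]
  intro j hj
  rw [IsZero.iff_id_eq_zero, ← CategoryTheory.Functor.map_id, ← h, Functor.map_comp,
    (X.isZero_of_isLE b j hj).eq_of_tgt ((homologyFunctor A j).map i) 0, zero_comp]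

theorem exists_toDerived_iso (Y : DerivedCategory A) (a b : ℤ) [Y.IsGE a] [Y.IsLE b] :
    ∃ X : Db A, Nonempty (Y ≅ (toDerived A).obj X) := by
  obtain ⟨K, hK₁, hK₂, ⟨e⟩⟩ := exists_iso_Q_obj_of_isGE_of_isLE Y a b
  exact ⟨Db.of K ⟨⟨a, hK₁⟩, ⟨b, hK₂⟩⟩, ⟨e ≪≫ (toDerivedOfIso K _).symm⟩⟩

theorem toDerived_isGE_isLE (X : Db A) :
    ∃ (a : ℤ) (n : ℕ), ((toDerived A).obj X).IsGE a ∧ ((toDerived A).obj X).IsLE (a + n) := by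
  obtain ⟨hK, hX⟩ := X.exists_eq_of
  obtain ⟨⟨a, _⟩, ⟨b, _⟩⟩ := id hK
  have e : Q.obj X.complex ≅ (toDerived A).obj X :=
    (toDerivedOfIso X.complex hK).symm ≪≫ (toDerived A).mapIso (eqToIso hX.symm)
  refine ⟨a, (b - a).toNat, t.isGE_of_iso e a, ?_⟩
  have := t.isLE_of_iso e b
  exact t.isLE_of_le _ b _ (by lia)

/-- The bounded derived category of an abelian category is idempotent complete. -/
theorem isIdempotentComplete_Db : IsIdempotentComplete (Db A) where
  idempotents_split X e he := by
    obtain ⟨a, n, _, _⟩ := toDerived_isGE_isLE X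
    obtain ⟨Y, i, p, h₁, h₂⟩ := splits_of_isGE_of_isLE n a _ inferInstance inferInstance
      ((toDerived A).map e) (by rw [← Functor.map_comp, he])
    have := isGE_of_retract i p h₁ a
    have := isLE_of_retract i p h₁ (a + n)
    obtain ⟨Y', ⟨α⟩⟩ := exists_toDerived_iso Y a (a + n)
    refine ⟨Y', (toDerived A).preimage (α.inv ≫ i), (toDerived A).preimage (p ≫ α.hom),
      (toDerived A).map_injective ?_, (toDerived A).map_injective ?_⟩
    · simp [reassoc_of% h₁]
    · simp [h₂]

end Idempotents

end BoundedHomotopy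

/-! ### Resolutions and the triangulated subcategory of resolved objects -/

namespace BoundedHomotopy

section Triangulated

variable {C : Type*} [Category C] [Preadditive C] [HasZeroObject C] [HasShift C ℤ]
  [∀ n : ℤ, (shiftFunctor C n).Additive] [Pretriangulated C] [IsTriangulated C]
  (P : ObjectProperty C) [P.IsTriangulated] [P.IsClosedUnderIsomorphisms]

/-- The cone of the morphism `X ⊞ Y ⟶ Y ⊞ Z` which is the identity on `Y` and zero elsewhere
is `X⟦1⟧ ⊞ Z`. -/
theorem prop_shift_biprod {X Y Z : C} (h₁ : P (X ⊞ Y)) (h₂ : P (Y ⊞ Z)) :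
    P (X⟦(1 : ℤ)⟧ ⊞ Z) := by
  obtain ⟨U, v, w, hU⟩ := distinguished_cocone_triangle
    ((biprod.snd : X ⊞ Y ⟶ Y) ≫ (biprod.inl : Y ⟶ Y ⊞ Z))
  have oct := Triangulated.someOctahedron rfl
    (rot_of_distTriang _ (binaryBiproductTriangle_distinguished X Y))
    (binaryBiproductTriangle_distinguished Y Z) hU
  obtain ⟨e, -⟩ := exists_iso_binaryBiproduct_of_distTriang _ oct.mem zero_comp
  exact P.prop_of_iso e (P.ext_of_isTriangulatedClosed₃ _ hU h₁ h₂)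

/-- If `Z` is a retract of an object of a triangulated subcategory, then `Z⟦1⟧ ⊞ Z` belongs to the
subcategory, although `Z` itself need not. -/
theorem prop_biprod_shift_of_retract {W Z : C} (hW : P W) (i : Z ⟶ W) (p : W ⟶ Z)
    (h : i ≫ p = 𝟙 Z) : P (Z⟦(1 : ℤ)⟧ ⊞ Z) := by
  obtain ⟨Z', v, w, hZ'⟩ := distinguished_cocone_triangle i
  have : Mono i := mono_of_mono_fac h
  obtain ⟨e, -⟩ := exists_iso_binaryBiproduct_of_distTriang _ hZ'
    ((Triangle.mor₃_eq_zero_iff_mono₁ _ hZ').2 this)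
  exact prop_shift_biprod P (P.prop_of_iso e hW) (P.prop_of_iso (e ≪≫ biprod.braiding _ _) hW)

/-- The decompositions `Z⟦2⟧ ⊞ Z⟦1⟧` and `Z⟦1⟧ ⊞ Z` have the summand `Z⟦1⟧` in common. -/
theorem prop_shift_three_biprod {Z : C} (hZ : P (Z⟦(1 : ℤ)⟧ ⊞ Z)) :
    P (Z⟦(1 : ℤ)⟧⟦(1 : ℤ)⟧⟦(1 : ℤ)⟧ ⊞ Z) := by
  refine prop_shift_biprod P (Y := Z⟦(1 : ℤ)⟧) ?_ hZ
  have := preservesBinaryBiproducts_of_preservesBiproducts (shiftFunctor C (1 : ℤ))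
  exact P.prop_of_iso ((shiftFunctor C (1 : ℤ)).mapBiprod _ _) (P.le_shift (1 : ℤ) _ hZ)

end Triangulated

section Resolutions

variable {A : Type*} [Category A] [Abelian A] (𝔓 𝔉 : ObjectProperty A)

/-- A bounded complex with terms in `𝔓`, whose terms in homological degrees `i ≤ m`, that is in
cohomological degrees `≥ -m`, belong to `𝔉`. -/
structure IsResolving (m : ℤ) (P : CochainComplex A ℤ) : Prop where
  bounded : IsBounded A P
  prop : ∀ i, 𝔓 (P.X i)
  free : ∀ i, -m ≤ i → 𝔉 (P.X i)

variable {𝔓 𝔉} in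
theorem IsResolving.mono {m m' : ℤ} {P : CochainComplex A ℤ} (h : IsResolving 𝔓 𝔉 m P)
    (hm : m' ≤ m) : IsResolving 𝔓 𝔉 m' P :=
  ⟨h.bounded, h.prop, fun i hi ↦ h.free i (by lia)⟩

variable {𝔓 𝔉} in
theorem IsResolving.shift {m : ℤ} {P : CochainComplex A ℤ} (h : IsResolving 𝔓 𝔉 m P) (n : ℤ) :
    IsResolving 𝔓 𝔉 (m + n) (P⟦n⟧) := by
  obtain ⟨⟨a, _⟩, ⟨b, _⟩⟩ := h.bounded
  exact ⟨⟨⟨a - n, P.isStrictlyGE_shift a n (a - n) (by lia)⟩,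
    ⟨b - n, P.isStrictlyLE_shift b n (b - n) (by lia)⟩⟩,
    fun i ↦ h.prop (i + n), fun i hi ↦ h.free (i + n) (by lia)⟩

section

variable [𝔓.IsClosedUnderIsomorphisms] [𝔓.IsClosedUnderBinaryProducts]
  [𝔉.IsClosedUnderIsomorphisms] [𝔉.IsClosedUnderBinaryProducts]

theorem prop_mappingCone_X {K L : CochainComplex A ℤ} (f : K ⟶ L) (i : ℤ)
    (hK : 𝔓 (K.X (i + 1))) (hL : 𝔓 (L.X i)) : 𝔓 ((CochainComplex.mappingCone f).X i) :=
  𝔓.prop_of_iso ((HomologicalComplex.homotopyCofiber.XIsoBiprod f i (i + 1) rfl) ≪≫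
    biprod.isoProd _ _).symm (𝔓.prop_prod _ _ hK hL)

variable {𝔓 𝔉} in
theorem IsResolving.mappingCone {m : ℤ} {P L : CochainComplex A ℤ} (f : P ⟶ L)
    (hP : IsResolving 𝔓 𝔉 (m - 1) P) (hL : IsResolving 𝔓 𝔉 m L) :
    IsResolving 𝔓 𝔉 m (CochainComplex.mappingCone f) :=
  ⟨isBounded_mappingCone A f hP.bounded hL.bounded,
    fun i ↦ prop_mappingCone_X 𝔓 f i (hP.prop _) (hL.prop _),
    fun i hi ↦ prop_mappingCone_X 𝔉 f i (hP.free _ (by lia)) (hL.free _ hi)⟩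

end

/-- A complex which admits a resolution, by an honest quasi-isomorphism of complexes, that is
free in homological degrees `≤ m`. -/
def HasResolution (m : ℤ) (K : CochainComplex A ℤ) : Prop :=
  ∃ (P : CochainComplex A ℤ) (s : P ⟶ K), IsResolving 𝔓 𝔉 m P ∧ QuasiIso s

variable [HasDerivedCategory A]

open DerivedCategory

/-- The objects of the derived category which are represented by a complex that is resolving
up to degree `m`. -/
def Res (m : ℤ) : ObjectProperty (DerivedCategory A) :=
  fun X ↦ ∃ P, IsResolving 𝔓 𝔉 m P ∧ Nonempty (Q.obj P ≅ X)

/-- The objects of the derived category which are represented by complexes that are resolving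
up to arbitrarily large degrees. -/
def ResAll : ObjectProperty (DerivedCategory A) :=
  fun X ↦ ∀ m, Res 𝔓 𝔉 m X

instance (m : ℤ) : (Res 𝔓 𝔉 m).IsClosedUnderIsomorphisms where
  of_iso e := by
    rintro ⟨P, hP, ⟨e'⟩⟩
    exact ⟨P, hP, ⟨e' ≪≫ e⟩⟩

instance : (ResAll 𝔓 𝔉).IsClosedUnderIsomorphisms where
  of_iso e h m := (Res 𝔓 𝔉 m).prop_of_iso e (h m)

variable {𝔓 𝔉} in
theorem Res.shift {m : ℤ} {X : DerivedCategory A} (h : Res 𝔓 𝔉 m X) (n : ℤ) :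
    Res 𝔓 𝔉 (m + n) (X⟦n⟧) := by
  obtain ⟨P, hP, ⟨e⟩⟩ := h
  exact ⟨P⟦n⟧, hP.shift n, ⟨(Q.commShiftIso n).app P ≪≫ (shiftFunctor _ n).mapIso e⟩⟩

variable {𝔓 𝔉} in
theorem Res.of_shift {m : ℤ} {X : DerivedCategory A} (n : ℤ) (h : Res 𝔓 𝔉 (m + n) (X⟦n⟧)) :
    Res 𝔓 𝔉 m X := by
  have := h.shift (-n)
  rw [add_neg_cancel_right] at this
  exact (Res 𝔓 𝔉 m).prop_of_iso ((shiftEquiv _ n).unitIso.symm.app X) this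

instance : (ResAll 𝔓 𝔉).IsStableUnderShift ℤ where
  isStableUnderShiftBy n := ⟨fun X hX m ↦ by
    have := (hX (m - n)).shift n
    rwa [sub_add_cancel] at this⟩

variable {𝔓 𝔉}

/-- A morphism from a complex with sufficiently many projective terms lifts to a given complex
which is bounded below. -/
theorem exists_lift (h𝔉 : ∀ X, 𝔉 X → Projective X) {P X : CochainComplex A ℤ} {m a : ℤ}
    (hP : IsResolving 𝔓 𝔉 m P) [X.IsStrictlyGE a] (hm : 1 ≤ m + a) (φ : Q.obj P ⟶ Q.obj X) :
    ∃ f : P ⟶ X, Q.map f = φ := by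
  obtain ⟨-, c, _⟩ := hP.bounded
  have : X.IsStrictlyGE (a - 1 + 1) := by rwa [sub_add_cancel]
  exact exists_Q_map_eq (a - 1) c (fun i hi ↦ h𝔉 _ (hP.free i (by lia))) φ

/-- An isomorphism with a sufficiently free complex in the derived category is represented by a
quasi-isomorphism of complexes. -/
theorem ResAll.hasResolution (h𝔉 : ∀ X, 𝔉 X → Projective X) {K : CochainComplex A ℤ}
    (hK : IsBounded A K) (h : ResAll 𝔓 𝔉 (Q.obj K)) (m : ℤ) : HasResolution 𝔓 𝔉 m K := by
  obtain ⟨⟨a, _⟩, -⟩ := id hK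
  obtain ⟨P, hP, ⟨e⟩⟩ := h (max m (1 - a))
  obtain ⟨s, hs⟩ := exists_lift h𝔉 (a := a) hP (by lia) e.hom
  refine ⟨P, s, hP.mono (le_max_left _ _), ?_⟩
  rw [← isIso_Q_map_iff_quasiIso, hs]
  infer_instance

theorem HasResolution.res {m : ℤ} {K : CochainComplex A ℤ} (h : HasResolution 𝔓 𝔉 m K) :
    Res 𝔓 𝔉 m (Q.obj K) := by
  obtain ⟨P, s, hP, _⟩ := h
  exact ⟨P, hP, ⟨asIso (Q.map s)⟩⟩

variable [𝔓.IsClosedUnderIsomorphisms] [𝔓.IsClosedUnderBinaryProducts]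
  [𝔉.IsClosedUnderIsomorphisms] [𝔉.IsClosedUnderBinaryProducts]

/-- The cone of a morphism with very free source is as free as its target. -/
theorem Res.cone (h𝔉 : ∀ X, 𝔉 X → Projective X) {T : Triangle (DerivedCategory A)}
    (hT : T ∈ distTriang _) (h₁ : ResAll 𝔓 𝔉 T.obj₁) {m : ℤ} (h₂ : Res 𝔓 𝔉 m T.obj₂) :
    Res 𝔓 𝔉 m T.obj₃ := by
  obtain ⟨L, hL, ⟨eL⟩⟩ := h₂
  obtain ⟨⟨a, _⟩, -⟩ := hL.bounded
  obtain ⟨P, hP, ⟨eP⟩⟩ := h₁ (max (m - 1) (1 - a))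
  obtain ⟨f, hf⟩ := exists_lift h𝔉 (a := a) hP (by lia) (eP.hom ≫ T.mor₁ ≫ eL.inv)
  refine ⟨_, IsResolving.mappingCone f (hP.mono (le_max_left _ _)) hL,
    ⟨Triangle.π₃.mapIso (isoTriangleOfIso₁₂ _ T (mappingCone_triangle_distinguished f) hT
      eP eL ?_)⟩⟩
  change Q.map f ≫ eL.hom = _
  rw [hf, Category.assoc, Category.assoc, eL.inv_hom_id, Category.comp_id]
  rfl

/-- The objects with arbitrarily free resolutions form a triangulated subcategory: a morphism
between two of them lifts to a chain map between resolutions, whose cone is a resolution of the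
third object of the triangle. -/
theorem isTriangulated_resAll (h𝔉 : ∀ X, 𝔉 X → Projective X) [𝔓.ContainsZero]
    [𝔉.ContainsZero] : (ResAll (A := A) 𝔓 𝔉).IsTriangulated := by
  have h0 (𝔔 : ObjectProperty A) [𝔔.IsClosedUnderIsomorphisms] [𝔔.ContainsZero] (X : A)
      (hX : IsZero X) : 𝔔 X := by
    obtain ⟨Z, hZ, h⟩ := 𝔔.exists_prop_of_containsZero
    exact 𝔔.prop_of_iso (hZ.iso hX) h
  have : (ResAll (A := A) 𝔓 𝔉).ContainsZero := ⟨⟨Q.obj (HomologicalComplex.zero),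
    Q.map_isZero HomologicalComplex.isZero_zero, fun m ↦ ⟨_,
      ⟨⟨⟨0, ⟨fun _ _ ↦ isZero_zero A⟩⟩, ⟨0, ⟨fun _ _ ↦ isZero_zero A⟩⟩⟩,
        fun _ ↦ h0 𝔓 _ (isZero_zero A), fun _ _ ↦ h0 𝔉 _ (isZero_zero A)⟩, ⟨Iso.refl _⟩⟩⟩⟩
  have : (ResAll (A := A) 𝔓 𝔉).IsTriangulatedClosed₃ := .mk' fun T hT h₁ h₂ m ↦
    Res.cone h𝔉 hT h₁ (h₂ m)
  exact { toIsTriangulatedClosed₂ := .of_isTriangulatedClosed₃ }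

/-- If `Z⟦3⟧ ⊞ Z` admits arbitrarily free resolutions and `Z` admits at least one resolution, then
the freeness of the resolutions of `Z` can be improved step by step. -/
theorem resAll_of_shift_three_biprod (h𝔉 : ∀ X, 𝔉 X → Projective X) {Z : DerivedCategory A}
    (h : ResAll 𝔓 𝔉 (Z⟦(1 : ℤ)⟧⟦(1 : ℤ)⟧⟦(1 : ℤ)⟧ ⊞ Z)) {r : ℤ} (hr : Res 𝔓 𝔉 r Z) :
    ResAll 𝔓 𝔉 Z := by
  have step (n : ℕ) : Res 𝔓 𝔉 (r + n * 2) Z := by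
    induction n with
    | zero => simpa using hr
    | succ n ih =>
      have h' := (ResAll 𝔓 𝔉).prop_of_iso (biprod.braiding _ _) h
      -- `Z⟦1⟧` is the cone of the projection `Z ⊞ Z⟦3⟧ ⟶ Z⟦3⟧`, so it is resolved as freely as
      -- `Z⟦3⟧`: the shift by three against the shift by one gains two degrees.
      have := Res.cone h𝔉 (rot_of_distTriang _ (binaryBiproductTriangle_distinguished Z
        (Z⟦(1 : ℤ)⟧⟦(1 : ℤ)⟧⟦(1 : ℤ)⟧))) h' (((ih.shift 1).shift 1).shift 1)
      refine Res.of_shift 1 ?_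
      have e : r + ((n + 1 : ℕ) : ℤ) * 2 + 1 = r + n * 2 + 1 + 1 + 1 := by push_cast; ring
      rw [e]
      exact this
  intro m
  obtain ⟨P, hP, e⟩ := step (m - r).toNat
  exact ⟨P, hP.mono (by lia), e⟩

/-- A complex in `𝔓` which is a retract of an object with arbitrarily free resolutions admits
arbitrarily free resolutions. -/
theorem resAll_of_retract (h𝔉 : ∀ X, 𝔉 X → Projective X) [𝔓.ContainsZero] [𝔉.ContainsZero]
    {W Z : DerivedCategory A} (hW : ResAll 𝔓 𝔉 W) (i : Z ⟶ W) (p : W ⟶ Z)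
    (h : i ≫ p = 𝟙 Z) {r : ℤ} (hr : Res 𝔓 𝔉 r Z) : ResAll 𝔓 𝔉 Z := by
  have := isTriangulated_resAll (𝔓 := 𝔓) h𝔉
  exact resAll_of_shift_three_biprod h𝔉 (prop_shift_three_biprod _
    (prop_biprod_shift_of_retract _ hW i p h)) hr

/-- In a short exact sequence of complexes whose middle term is resolving, the cokernel has
resolutions which are free in one more degree than those of the kernel. -/
theorem HasResolution.of_shortExact {S : ShortComplex (CochainComplex A ℤ)} (hS : S.ShortExact)
    {m : ℤ} (h₁ : HasResolution 𝔓 𝔉 m S.X₁) (h₂ : IsResolving 𝔓 𝔉 (m + 1) S.X₂) :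
    HasResolution 𝔓 𝔉 (m + 1) S.X₃ := by
  obtain ⟨P, s, hP, _⟩ := h₁
  have := CochainComplex.mappingCone.quasiIso_descShortComplex hS
  let φ := CochainComplex.mappingCone.triangleMap (s ≫ S.f) S.f s (𝟙 _) (by simp)
  have : IsIso (Q.map φ.hom₃) := isIso₃_of_isIso₁₂ (Q.mapTriangle.map φ)
    (mappingCone_triangle_distinguished _) (mappingCone_triangle_distinguished _)
    (inferInstanceAs (IsIso (Q.map s))) (inferInstanceAs (IsIso (Q.map (𝟙 S.X₂))))
  let ψ : CochainComplex.mappingCone (s ≫ S.f) ⟶ CochainComplex.mappingCone S.f := φ.hom₃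
  have : QuasiIso ψ := (isIso_Q_map_iff_quasiIso _ ψ).1 this
  exact ⟨_, ψ ≫ CochainComplex.mappingCone.descShortComplex S,
    IsResolving.mappingCone _ (by simpa using hP) h₂, quasiIso_comp _ _⟩

end Resolutions

/-! ### Filtration of a bounded complex by its terms -/

section Filtration

variable {A : Type*} [Category A] [Abelian A] [HasDerivedCategory A]

open DerivedCategory

theorem prop_single_of_prop_single_zero (T : ObjectProperty (DerivedCategory A))
    [T.IsTriangulated] [T.IsClosedUnderIsomorphisms] (X : A)
    (h : T ((singleFunctor A 0).obj X)) (b : ℤ) :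
    T (Q.obj ((HomologicalComplex.single A (ComplexShape.up ℤ) b).obj X)) := by
  refine T.prop_of_iso ?_ (T.le_shift (-b) _ h)
  exact ((singleFunctors A).shiftIso (-b) b 0 (by lia)).app X ≪≫ (singleFunctorIsoCompQ A b).app X

/-- A bounded complex belongs to a triangulated subcategory as soon as its terms do: the terms
are split off one at a time, starting with the top degree. -/
theorem prop_Q_of_prop_terms (T : ObjectProperty (DerivedCategory A)) [T.IsTriangulated]
    [T.IsClosedUnderIsomorphisms] (a : ℤ) (n : ℕ) : ∀ (K : CochainComplex A ℤ)
    (_ : K.IsStrictlyGE a) (_ : K.IsStrictlyLE (a + n - 1))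
    (_ : ∀ i, T ((singleFunctor A 0).obj (K.X i))), T (Q.obj K) := by
  induction n with
  | zero =>
    intro K _ _ h
    have hK : IsZero K := by
      rw [IsZero.iff_id_eq_zero]
      ext i
      by_cases hi : i < a
      · exact (K.isZero_of_isStrictlyGE a i (by lia)).eq_of_src _ _
      · exact (K.isZero_of_isStrictlyLE (a + (0 : ℕ) - 1) i (by lia)).eq_of_src _ _
    exact T.prop_of_isZero (Q.map_isZero hK)
  | succ n ih =>
    intro K _ _ h
    set b : ℤ := a + n with hb
    have hKb : K.IsStrictlyLE b := by
      have : a + ((n + 1 : ℕ) : ℤ) - 1 = b := by push_cast; lia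
      rwa [← this]
    let ι : (HomologicalComplex.single A (ComplexShape.up ℤ) b).obj (K.X b) ⟶ K :=
      HomologicalComplex.mkHomFromSingle (𝟙 _) (fun k hk ↦
        (K.isZero_of_isStrictlyLE b k (by simp at hk; lia)).eq_of_tgt _ _)
    have hι : IsIso (ι.f b) := by
      dsimp [ι]
      rw [HomologicalComplex.mkHomFromSingle_f]
      infer_instance
    have hz (i : ℤ) (hi : i ≠ b) :
        IsZero (((HomologicalComplex.single A (ComplexShape.up ℤ) b).obj (K.X b)).X i) :=
      HomologicalComplex.isZero_single_obj_X _ _ _ _ hi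
    have : Mono ι := by
      have (i : ℤ) : Mono (ι.f i) := by
        by_cases hi : i = b
        · subst hi; infer_instance
        · exact ⟨fun _ _ _ ↦ (hz i hi).eq_of_tgt _ _⟩
      exact HomologicalComplex.mono_of_mono_f ι this
    let S : ShortComplex (CochainComplex A ℤ) := ShortComplex.mk ι (cokernel.π ι) (by simp)
    have hS : S.ShortExact := { exact := ShortComplex.exact_cokernel ι }
    have hSi (i : ℤ) : (S.map (HomologicalComplex.eval A (ComplexShape.up ℤ) i)).ShortExact :=
      hS.map_of_exact _
    have hcb : IsZero (S.X₃.X b) := by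
      have := (hSi b).epi_g
      have h0 : (cokernel.π ι).f b = 0 := by
        rw [← cancel_epi (ι.f b), ← HomologicalComplex.comp_f]
        simp
      exact IsZero.of_epi_eq_zero ((cokernel.π ι).f b) h0
    have hci (i : ℤ) (hi : i ≠ b) : Nonempty (K.X i ≅ S.X₃.X i) := by
      have := (hSi i).isIso_g_iff.2 (hz i hi)
      exact ⟨@asIso _ _ _ _ _ this⟩
    have h₃ : T (Q.obj S.X₃) := by
      refine ih S.X₃ ?_ ?_ ?_
      · rw [CochainComplex.isStrictlyGE_iff]
        intro i hi
        obtain ⟨e⟩ := hci i (by lia)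
        exact (K.isZero_of_isStrictlyGE a i hi).of_iso e.symm
      · rw [CochainComplex.isStrictlyLE_iff]
        intro i hi
        by_cases hib : i = b
        · rwa [hib]
        · obtain ⟨e⟩ := hci i hib
          exact (K.isZero_of_isStrictlyLE b i (by lia)).of_iso e.symm
      · intro i
        by_cases hib : i = b
        · rw [hib]
          exact T.prop_of_isZero ((singleFunctor A 0).map_isZero hcb)
        · obtain ⟨e⟩ := hci i hib
          exact T.prop_of_iso ((singleFunctor A 0).mapIso e) (h i)
    exact T.ext_of_isTriangulatedClosed₂ _ (triangleOfSES_distinguished hS)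
      (prop_single_of_prop_single_zero T _ (h b) b) h₃

end Filtration

end BoundedHomotopy

/-! ### Modules over the group algebra, restriction and coinduction -/

namespace PermutationModules

open BoundedHomotopy

section Modules

variable {k : Type u} [Field k] {G : Type v} [Group G]

/-- The vector space structure on a module over the group algebra. -/
@[reducible] noncomputable def moduleK (M : ModG k G) : Module k M :=
  Module.compHom M (algebraMap k (MonoidAlgebra k G))

attribute [local instance] moduleK

theorem moduleK_smul (M : ModG k G) (c : k) (m : M) :
    c • m = algebraMap k (MonoidAlgebra k G) c • m := rfl

instance (M : ModG k G) : IsScalarTower k (MonoidAlgebra k G) M where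
  smul_assoc c x m := by
    rw [moduleK_smul, smul_smul, Algebra.smul_def]

instance [Finite G] : Module.Finite k (MonoidAlgebra k G) :=
  Module.Finite.equiv (MonoidAlgebra.coeffLinearEquiv (M := G) k (S := k)).symm

instance [Finite G] (M : ModG k G) : Module.Finite k M :=
  Module.Finite.trans (MonoidAlgebra k G) M

/-- The representation underlying a module over the group algebra. -/
noncomputable def rep (M : ModG k G) : Representation k G M := Representation.ofModule' M

theorem rep_apply (M : ModG k G) (g : G) (m : M) :
    rep M g m = (MonoidAlgebra.single g 1 : MonoidAlgebra k G) • m := rfl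

theorem map_rep {M N : ModG k G} (f : M ⟶ N) (g : G) (m : M) :
    f.hom.hom (rep M g m) = rep N g (f.hom.hom m) := by
  rw [rep_apply, rep_apply, map_smul]

instance {V : Type*} [AddCommGroup V] [Module k V] [Module.Finite k V]
    (ρ : Representation k G V) : Module.Finite (MonoidAlgebra k G) ρ.asModule :=
  have : Module.Finite k ρ.asModule := inferInstanceAs (Module.Finite k V)
  Module.Finite.of_restrictScalars_finite k _ _

/-- A finite dimensional representation, as a module over the group algebra. -/
noncomputable abbrev ofRep {V : Type (max u v)} [AddCommGroup V] [Module k V]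
    [Module.Finite k V] (ρ : Representation k G V) : ModG k G :=
  FGModuleCat.of (MonoidAlgebra k G) ρ.asModule

variable {V W : Type (max u v)} [AddCommGroup V] [Module k V] [Module.Finite k V]
  [AddCommGroup W] [Module k W] [Module.Finite k W]

theorem rep_ofRep (ρ : Representation k G V) (g : G) (v : V) : rep (ofRep ρ) g v = ρ g v :=
  (Representation.single_smul ρ 1 g v).trans (one_smul _ _)

theorem smul_ofRep (ρ : Representation k G V) (c : k) (v : V) :
    (moduleK (ofRep ρ)).toSMul.smul c v = c • v :=
  (Representation.single_smul ρ c 1 v).trans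
    (congr_arg (c • ·) (congr_arg (fun f : V →ₗ[k] V ↦ f v) (map_one ρ)))

/-- An additive map which commutes with scalars and with the group, as a morphism of modules. -/
noncomputable def homMk {M N : ModG k G} (f : M →ₗ[k] N)
    (hf : ∀ g m, f (rep M g m) = rep N g (f m)) : M ⟶ N :=
  FGModuleCat.ofHom (MonoidAlgebra.equivariantOfLinearOfComm f hf)

/-- A morphism of modules, as a linear map over the field. -/
noncomputable def linK {M N : ModG k G} (f : M ⟶ N) : M →ₗ[k] N := f.hom.hom.restrictScalars k

end Modules

section Exactness

variable {R : Type*} [Ring R] [IsNoetherianRing R]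

theorem FGModuleCat.exact_iff (S : ShortComplex (FGModuleCat.{v} R)) :
    S.Exact ↔ ∀ y, S.g.hom.hom y = 0 → ∃ x, S.f.hom.hom x = y := by
  rw [← ShortComplex.exact_map_iff_of_faithful S (forget₂ (FGModuleCat R) (ModuleCat.{v} R)),
    ShortComplex.moduleCat_exact_iff]
  rfl

theorem FGModuleCat.mono_iff {M N : FGModuleCat.{v} R} (f : M ⟶ N) :
    Mono f ↔ Function.Injective f.hom.hom := by
  rw [← (forget₂ (FGModuleCat R) (ModuleCat.{v} R)).mono_map_iff_mono,
    ModuleCat.mono_iff_injective]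
  rfl

theorem FGModuleCat.epi_iff {M N : FGModuleCat.{v} R} (f : M ⟶ N) :
    Epi f ↔ Function.Surjective f.hom.hom := by
  rw [← (forget₂ (FGModuleCat R) (ModuleCat.{v} R)).epi_map_iff_epi,
    ModuleCat.epi_iff_surjective]
  rfl

end Exactness

section Coind

variable {k : Type u} [Field k] {G N : Type v} [Group G] [Finite G] [Group N] [Finite N]

attribute [local instance] moduleK

/-- Restriction of modules along a group homomorphism. -/
noncomputable def resAlong (k : Type u) [Field k] (π : G →* N) : ModG k N ⥤ ModG k G where
  obj M := ofRep ((rep M).comp π)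
  map {M M'} f := FGModuleCat.ofHom (Representation.IntertwiningMap.equivLinearMapAsModule _ _
    { toLinearMap := linK f
      isIntertwining' := fun g ↦ by
        ext m
        exact map_rep f (π g) m })

variable (H : Subgroup G)

/-- The functions `φ : G → M` with `φ (g * h) = h⁻¹ • φ g` for `h ∈ H`. -/
noncomputable def coindSub (M : ModG k H) : Submodule k (G → M) where
  carrier := {φ | ∀ (g : G) (h : H), φ (g * h) = rep M h⁻¹ (φ g)}
  add_mem' {φ ψ} hφ hψ g h := by simp [hφ g h, hψ g h]
  zero_mem' g h := by simp
  smul_mem' c φ hφ g h := by simp [hφ g h]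

/-- The action of `G` on a coinduced module by left translation. -/
noncomputable def coindRep (M : ModG k H) : Representation k G (coindSub H M) where
  toFun x :=
    { toFun := fun φ ↦ ⟨fun g ↦ φ.1 (x⁻¹ * g), fun g h ↦ by
        change φ.1 (x⁻¹ * (g * h)) = _
        rw [← mul_assoc]
        exact φ.2 _ h⟩
      map_add' := fun _ _ ↦ rfl
      map_smul' := fun _ _ ↦ rfl }
  map_one' := by ext φ g; simp
  map_mul' x y := by ext φ g; simp [mul_assoc]

/-- Coinduction of modules from a subgroup. -/
noncomputable def coind (k : Type u) [Field k] (H : Subgroup G) : ModG k H ⥤ ModG k G where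
  obj M := ofRep (coindRep H M)
  map {M M'} f := FGModuleCat.ofHom (Representation.IntertwiningMap.equivLinearMapAsModule _ _
    { toLinearMap :=
        { toFun := fun φ ↦ ⟨fun g ↦ f.hom.hom (φ.1 g), fun g h ↦ by
            change f.hom.hom (φ.1 (g * h)) = _
            rw [φ.2 g h, map_rep]⟩
          map_add' := fun φ ψ ↦ by ext g; exact map_add _ _ _
          map_smul' := fun c φ ↦ by ext g; exact map_smul (linK f) c (φ.1 g) }
      isIntertwining' := fun g ↦ rfl })

instance : (coind k H).Additive where
  map_add := rfl

instance (π : G →* N) : (resAlong k π).Additive where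
  map_add := rfl

theorem exact_map_coind (S : ShortComplex (ModG k H)) (hS : S.Exact) :
    (S.map (coind k H)).Exact := by
  rw [FGModuleCat.exact_iff] at hS ⊢
  intro φ hφ
  change coindSub H S.X₂ at φ
  have h (g : G) : ∃ x, S.f.hom.hom x = φ.1 g :=
    hS _ (congr_fun (congr_arg Subtype.val hφ : _ = (0 : G → S.X₃)) g)
  choose c hc using h
  -- A lift is chosen at one point of each coset `g * H`; its values at the other points are then
  -- determined by equivariance.
  let s (g : G) : H := ⟨(Quotient.out (g : G ⧸ H))⁻¹ * g, by
    rw [← QuotientGroup.eq]; exact QuotientGroup.out_eq' _⟩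
  refine ⟨(⟨fun g ↦ rep S.X₁ (s g)⁻¹ (c (Quotient.out (g : G ⧸ H))), fun g h ↦ ?_⟩ :
    coindSub H S.X₁), Subtype.ext (funext fun g ↦ ?_)⟩
  · have e : ((g * h : G) : G ⧸ H) = g := QuotientGroup.mk_mul_of_mem g h.2
    have : (s (g * h))⁻¹ = h⁻¹ * (s g)⁻¹ := by
      rw [← mul_inv_rev]
      congr 1
      ext
      simp [s, e, mul_assoc]
    change rep S.X₁ (s (g * h))⁻¹ (c (Quotient.out ((g * h : G) : G ⧸ H))) = _
    rw [this, e, map_mul]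
    rfl
  · change S.f.hom.hom (rep S.X₁ (s g)⁻¹ (c (Quotient.out (g : G ⧸ H)))) = φ.1 g
    rw [map_rep, hc, ← φ.2]
    simp [s]

theorem exact_map_resAlong (π : G →* N) (S : ShortComplex (ModG k N)) (hS : S.Exact) :
    (S.map (resAlong k π)).Exact := by
  rw [FGModuleCat.exact_iff] at hS ⊢
  exact hS

instance : (coind k H).PreservesHomology :=
  Functor.preservesHomology_of_map_exact _ (exact_map_coind H)

instance (π : G →* N) : (resAlong k π).PreservesHomology :=
  Functor.preservesHomology_of_map_exact _ (exact_map_resAlong π)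

end Coind

end PermutationModules

/-! ### Permutation modules as modules of functions -/

namespace PermutationModules

open BoundedHomotopy

section PermOn

variable {k : Type u} [Field k] {G : Type v} [Group G]

attribute [local instance] moduleK

/-- `PermOn Ω M`: the module `M` is isomorphic to the module of `k`-valued functions on the
`G`-set `Ω`, where `g` takes the function `f` to `ω ↦ f (g⁻¹ • ω)`. For finite `Ω` this is the
permutation module on `Ω`, a point corresponding to its indicator function. -/
def PermOn (Ω : Type*) [MulAction G Ω] (M : ModG k G) : Prop :=
  ∃ e : M ≃ₗ[k] (Ω → k), ∀ g m ω, e (rep M g m) ω = e m (g⁻¹ • ω)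

/-- An equivariant linear equivalence, as an isomorphism of modules. -/
noncomputable def isoMk {M N : ModG k G} (e : M ≃ₗ[k] N)
    (he : ∀ g m, e (rep M g m) = rep N g (e m)) : M ≅ N where
  hom := homMk e.toLinearMap he
  inv := homMk e.symm.toLinearMap fun g m ↦ by
    rw [LinearEquiv.coe_coe, LinearEquiv.symm_apply_eq, he, LinearEquiv.apply_symm_apply]
  hom_inv_id := by
    ext m
    exact e.symm_apply_apply m
  inv_hom_id := by
    ext m
    exact e.apply_symm_apply m

variable {Ω Ω' : Type*} [MulAction G Ω] [MulAction G Ω'] {M N : ModG k G}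

theorem PermOn.congr (h : PermOn Ω M) (σ : Ω ≃ Ω') (hσ : ∀ (g : G) ω, σ (g • ω) = g • σ ω) :
    PermOn Ω' M := by
  obtain ⟨e, he⟩ := h
  refine ⟨e.trans (LinearEquiv.funCongrLeft k k σ.symm), fun g m ω ↦ ?_⟩
  have : g⁻¹ • σ.symm ω = σ.symm (g⁻¹ • ω) := by
    rw [Equiv.eq_symm_apply, hσ, Equiv.apply_symm_apply]
  simp only [LinearEquiv.trans_apply, LinearEquiv.funCongrLeft_apply, LinearMap.funLeft_apply]
  rw [he, this]

theorem PermOn.nonempty_iso (h : PermOn Ω M) (h' : PermOn Ω N) : Nonempty (M ≅ N) := by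
  obtain ⟨e, he⟩ := h
  obtain ⟨f, hf⟩ := h'
  refine ⟨isoMk (e.trans f.symm) fun g m ↦ ?_⟩
  rw [LinearEquiv.trans_apply, LinearEquiv.symm_apply_eq]
  ext ω
  rw [he, hf, LinearEquiv.trans_apply, LinearEquiv.apply_symm_apply]

theorem permOn_of_isPerm (h : isPerm k G M) :
    ∃ (A : Type) (_ : Finite A) (_ : MulAction G A), PermOn A M := by
  obtain ⟨A, _, _, ⟨f⟩⟩ := h
  refine ⟨A, inferInstance, inferInstance, (((f.restrictScalars k).trans
    (Representation.asModuleEquiv _)).trans (MonoidAlgebra.coeffLinearEquiv k)).trans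
    (Finsupp.linearEquivFunOnFinite k k A), fun g m ω ↦ ?_⟩
  have h1 : f (rep M g m) = Representation.ofMulAction k G A g (f m) := by
    rw [rep_apply, map_smul]
    exact (Representation.single_smul _ 1 g _).trans (one_smul _ _)
  have h2 := Representation.coeff_ofMulAction g (show MonoidAlgebra k A from f m) ω
  rw [← h1] at h2
  exact h2

theorem PermOn.isPerm [Finite Ω] (h : PermOn Ω M) : isPerm k G M := by
  let σ := Finite.equivFin Ω
  let _ : MulAction G (Fin (Nat.card Ω)) := Equiv.mulAction G σ.symm
  obtain ⟨e, he⟩ := h.congr σ (fun g ω ↦ by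
    change _ = σ (g • σ.symm (σ ω))
    rw [Equiv.symm_apply_apply])
  let A := Fin (Nat.card Ω)
  let ρ := Representation.ofMulAction k G A
  let ε : ρ.asModule ≃ₗ[k] (A → k) := ((Representation.asModuleEquiv ρ).trans
    (MonoidAlgebra.coeffLinearEquiv k)).trans (Finsupp.linearEquivFunOnFinite k k A)
  have hε (g : G) (x : ρ.asModule) (a : A) :
      ε ((MonoidAlgebra.single g 1 : MonoidAlgebra k G) • x) a = ε x (g⁻¹ • a) := by
    have h1 : (MonoidAlgebra.single g 1 : MonoidAlgebra k G) • x = ρ g x :=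
      (Representation.single_smul ρ 1 g x).trans (one_smul _ _)
    rw [h1]
    exact Representation.coeff_ofMulAction g (show MonoidAlgebra k A from x) a
  let f := e.trans ε.symm
  refine ⟨A, inferInstance, inferInstance, ⟨LinearEquiv.ofBijective
    (MonoidAlgebra.equivariantOfLinearOfComm f.toLinearMap fun g m ↦ ?_) f.bijective⟩⟩
  apply ε.injective
  ext a
  rw [hε]
  simp only [f, LinearEquiv.coe_coe, LinearEquiv.trans_apply, LinearEquiv.apply_symm_apply]
  exact he g m a

/-- A free module is a permutation module on a set with a free action. -/
theorem permOn_of_free [Finite G] (h : Module.Free (MonoidAlgebra k G) M) :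
    ∃ (A : Type v) (_ : Finite A) (_ : MulAction G A),
      (∀ (g : G) (a : A), g • a = a → g = 1) ∧ PermOn A M := by
  let I := Module.Free.ChooseBasisIndex (MonoidAlgebra k G) M
  obtain ⟨n, ⟨σ⟩⟩ : ∃ n, Nonempty (I ≃ Fin n) := ⟨_, ⟨Finite.equivFin I⟩⟩
  let b := (Module.Free.chooseBasis (MonoidAlgebra k G) M).reindex σ
  let _ : MulAction G (G × Fin n) :=
    { smul := fun g a ↦ (g * a.1, a.2)
      one_smul := fun a ↦ Prod.ext (one_mul _) rfl
      mul_smul := fun g h a ↦ Prod.ext (mul_assoc _ _ _) rfl }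
  refine ⟨G × Fin n, inferInstance, inferInstance, fun g a h ↦ ?_, ?_⟩
  · exact mul_eq_right.1 (congr_arg Prod.fst h)
  · refine ⟨((b.equivFun.restrictScalars k).trans (LinearEquiv.piCongrRight fun _ ↦
      (MonoidAlgebra.coeffLinearEquiv k).trans (Finsupp.linearEquivFunOnFinite k k G))).trans
        { toFun := fun f a ↦ f a.2 a.1
          invFun := fun f i g ↦ f (g, i)
          map_add' := fun _ _ ↦ rfl
          map_smul' := fun _ _ ↦ rfl
          left_inv := fun _ ↦ rfl
          right_inv := fun _ ↦ rfl }, fun g m a ↦ ?_⟩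
    change (b.equivFun (rep M g m) a.2).coeff a.1 = (b.equivFun m a.2).coeff (g⁻¹ * a.1)
    rw [rep_apply, map_smul, Pi.smul_apply, smul_eq_mul, MonoidAlgebra.coeff_single_mul_apply,
      one_mul]

/-- The functions on a set with a free action form a free module, a basis being given by the
orbits. -/
theorem PermOn.free [Finite G] [Finite Ω] (h : PermOn Ω M)
    (hΩ : ∀ (g : G) (ω : Ω), g • ω = ω → g = 1) : Module.Free (MonoidAlgebra k G) M := by
  obtain ⟨e, he⟩ := h
  let I := MulAction.orbitRel.Quotient G Ω
  have hI : Finite I := inferInstanceAs (Finite (Quotient _))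
  let σ : G × I → Ω := fun a ↦ a.1 • Quotient.out a.2
  have hσ : Function.Bijective σ := by
    constructor
    · rintro ⟨g, i⟩ ⟨g', i'⟩ hg
      change g • Quotient.out i = g' • Quotient.out i' at hg
      have hi : i = i' := by
        rw [← Quotient.out_eq i, ← Quotient.out_eq i']
        refine Quotient.sound ⟨g⁻¹ * g', ?_⟩
        change (g⁻¹ * g') • Quotient.out i' = _
        rw [mul_smul, ← hg, inv_smul_smul]
      subst hi
      have := hΩ (g'⁻¹ * g) _ (by rw [mul_smul, hg, inv_smul_smul])
      rw [inv_mul_eq_one] at this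
      rw [this]
    · intro ω
      obtain ⟨g, hg⟩ := Quotient.exact (Quotient.out_eq (Quotient.mk (MulAction.orbitRel G Ω) ω))
      refine ⟨(g⁻¹, Quotient.mk _ ω), ?_⟩
      change g⁻¹ • Quotient.out _ = ω
      rw [← hg]
      exact inv_smul_smul _ _
  let ε : (I → MonoidAlgebra k G) ≃ₗ[k] (G × I → k) :=
    (LinearEquiv.piCongrRight fun _ ↦
      (MonoidAlgebra.coeffLinearEquiv k).trans (Finsupp.linearEquivFunOnFinite k k G)).trans
        { toFun := fun f a ↦ f a.2 a.1
          invFun := fun f i g ↦ f (g, i)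
          map_add' := fun _ _ ↦ rfl
          map_smul' := fun _ _ ↦ rfl
          left_inv := fun _ ↦ rfl
          right_inv := fun _ ↦ rfl }
  have hε (x : I → MonoidAlgebra k G) (a : G × I) : ε x a = (x a.2).coeff a.1 := rfl
  let f := (e.trans (LinearEquiv.funCongrLeft k k (Equiv.ofBijective σ hσ))).trans ε.symm
  refine Module.Free.of_equiv (LinearEquiv.ofBijective
    (MonoidAlgebra.equivariantOfLinearOfComm f.toLinearMap fun g m ↦ ?_) f.bijective).symm
  apply ε.injective
  ext a
  rw [hε, hε, Pi.smul_apply, smul_eq_mul, MonoidAlgebra.coeff_single_mul_apply, one_mul]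
  have h1 (m : M) (i : I) (g : G) : (f m i).coeff g = e m (g • Quotient.out i) := by
    rw [← hε (f m) (g, i)]
    exact congr_fun (ε.apply_symm_apply _) (g, i)
  refine (h1 _ _ _).trans (Eq.trans ?_ (h1 m a.2 (g⁻¹ * a.1)).symm)
  rw [mul_smul]
  exact he g m _

/-- The action on the quotient by an invariant equivalence relation. -/
@[reducible] def quotientAction (r : Setoid Ω) (hr : ∀ (g : G) a b, r a b → r (g • a) (g • b)) :
    MulAction G (Quotient r) where
  smul g := Quotient.map (g • ·) (hr g)
  one_smul := by
    rintro ⟨a⟩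
    exact congr_arg (Quotient.mk r) (one_smul G a)
  mul_smul g g' := by
    rintro ⟨a⟩
    exact congr_arg (Quotient.mk r) (mul_smul g g' a)

/-- A module that is identified with the functions on a `G`-set which are constant along the
classes of an invariant equivalence relation is a permutation module on the set of classes. -/
theorem permOn_quotient (r : Setoid Ω) (hr : ∀ (g : G) a b, r a b → r (g • a) (g • b))
    (e : M →ₗ[k] (Ω → k)) (he : ∀ g m ω, e (rep M g m) ω = e m (g⁻¹ • ω))
    (he₁ : Function.Injective e) (he₂ : ∀ m a b, r a b → e m a = e m b)
    (he₃ : ∀ f : Ω → k, (∀ a b, r a b → f a = f b) → ∃ m, e m = f) :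
    letI := quotientAction r hr
    PermOn (Quotient r) M := by
  let F : M →ₗ[k] (Quotient r → k) :=
    { toFun := fun m ↦ Quotient.lift (e m) (he₂ m)
      map_add' := fun m m' ↦ by
        ext ⟨a⟩
        exact congr_fun (map_add e m m') a
      map_smul' := fun c m ↦ by
        ext ⟨a⟩
        exact congr_fun (map_smul e c m) a }
  have hF : Function.Bijective F := by
    constructor
    · intro m m' h
      apply he₁
      ext a
      exact congr_fun h (Quotient.mk r a)
    · intro f
      obtain ⟨m, hm⟩ := he₃ (fun a ↦ f (Quotient.mk r a))
        (fun a b h ↦ congr_arg f (Quotient.sound h))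
      refine ⟨m, ?_⟩
      ext ⟨a⟩
      exact congr_fun hm a
  refine ⟨LinearEquiv.ofBijective F hF, ?_⟩
  rintro g m ⟨a⟩
  exact he g m a

end PermOn

section Coind

variable {k : Type u} [Field k] {G : Type v} [Group G]

attribute [local instance] moduleK

theorem permOn_resAlong [Finite G] {N : Type v} [Group N] [Finite N] (π : G →* N) {Ω : Type*}
    [MulAction N Ω] {M : ModG k N} (h : PermOn Ω M) :
    letI := MulAction.compHom Ω π
    PermOn Ω ((resAlong k π).obj M) := by
  obtain ⟨e, he⟩ := h
  refine ⟨{ toFun := fun m ↦ e m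
            map_add' := map_add e
            map_smul' := fun c (m : M) ↦ ?_
            invFun := fun f ↦ e.symm f
            left_inv := e.symm_apply_apply
            right_inv := e.apply_symm_apply }, fun g (m : M) ω ↦ ?_⟩
  · have := smul_ofRep ((rep M).comp π) c m
    exact (congr_arg e this).trans (map_smul e c m)
  · have := rep_ofRep ((rep M).comp π) g m
    refine (congr_fun (congr_arg e this) ω).trans ?_
    refine (he (π g) m ω).trans ?_
    rw [← map_inv]
    rfl

variable (H : Subgroup G)

/-- The `H`-orbit relation on `G × A`, where `H` acts on `G` from the right. -/
def coindSetoid (A : Type*) [MulAction H A] : Setoid (G × A) where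
  r a b := ∃ h : H, b = (a.1 * h⁻¹, h • a.2)
  iseqv :=
    { refl := fun a ↦ ⟨1, by simp⟩
      symm := by
        rintro a _ ⟨h, rfl⟩
        exact ⟨h⁻¹, by simp⟩
      trans := by
        rintro a _ _ ⟨h, rfl⟩ ⟨h', rfl⟩
        exact ⟨h' * h, by simp [mul_assoc, mul_smul]⟩ }

/-- The action of `G` on `G × A` through the first factor. -/
@[reducible] def leftAction (G : Type*) [Group G] (A : Type*) : MulAction G (G × A) where
  smul g a := (g * a.1, a.2)
  one_smul _ := Prod.ext (one_mul _) rfl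
  mul_smul _ _ _ := Prod.ext (mul_assoc _ _ _) rfl

theorem coindSetoid_smul (A : Type*) [MulAction H A] :
    letI := leftAction G A
    ∀ (g : G) (a b : G × A), coindSetoid H A a b → coindSetoid H A (g • a) (g • b) := by
  rintro g a _ ⟨h, rfl⟩
  exact ⟨h, Prod.ext (mul_assoc _ _ _).symm rfl⟩

variable [Finite G]

/-- The module coinduced from the functions on an `H`-set `A` is that of the functions on the
`G`-set `G ×_H A`. -/
theorem permOn_coind {A : Type*} [MulAction H A] {M : ModG k H} (hM : PermOn A M) :
    letI := leftAction G A
    letI := quotientAction (coindSetoid H A) (coindSetoid_smul H A)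
    PermOn (Quotient (coindSetoid H A)) ((coind k H).obj M) := by
  let _ := leftAction G A
  obtain ⟨e, he⟩ := hM
  refine permOn_quotient (coindSetoid H A) (coindSetoid_smul H A)
    { toFun := fun (φ : coindSub H M) a ↦ e (φ.1 a.1) a.2
      map_add' := fun (φ ψ : coindSub H M) ↦ by
        ext a
        exact congr_fun (map_add e _ _) a.2
      map_smul' := fun c (φ : coindSub H M) ↦ by
        ext a
        have h1 := smul_ofRep (coindRep H M) c φ
        refine (congr_arg (fun ψ : coindSub H M ↦ e (ψ.1 a.1) a.2) h1).trans ?_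
        exact congr_fun (map_smul e _ _) a.2 } ?_ ?_ ?_ ?_
  · intro g φ ω
    have h1 := rep_ofRep (coindRep H M) g φ
    exact congr_arg (fun ψ : coindSub H M ↦ e (ψ.1 ω.1) ω.2) h1
  · intro φ ψ h
    refine Subtype.ext (funext fun g ↦ e.injective (funext fun a ↦ ?_))
    exact congr_fun h (g, a)
  · rintro (φ : coindSub H M) a _ ⟨h, rfl⟩
    change e (φ.1 a.1) a.2 = e (φ.1 (a.1 * h⁻¹)) (h • a.2)
    have := φ.2 a.1 h⁻¹
    rw [this, he, inv_inv, inv_smul_smul]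
  · intro f hf
    refine ⟨(⟨fun g ↦ e.symm fun a ↦ f (g, a), fun g h ↦ ?_⟩ : coindSub H M), ?_⟩
    · apply e.injective
      ext a
      rw [he]
      change e (e.symm _) a = e (e.symm _) _
      rw [LinearEquiv.apply_symm_apply, LinearEquiv.apply_symm_apply]
      exact hf _ _ ⟨h, by simp⟩
    · ext a
      change e (e.symm _) a.2 = _
      rw [LinearEquiv.apply_symm_apply]

theorem isPerm_coind {M : ModG k H} (hM : isPerm k H M) : isPerm k G ((coind k H).obj M) := by
  obtain ⟨A, _, _, h⟩ := permOn_of_isPerm hM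
  let _ := leftAction G A
  let _ := quotientAction (coindSetoid H A) (coindSetoid_smul H A)
  have : Finite (Quotient (coindSetoid H A)) := inferInstance
  exact (permOn_coind H h).isPerm

theorem free_coind {M : ModG k H} (hM : Module.Free (MonoidAlgebra k H) M) :
    Module.Free (MonoidAlgebra k G) ((coind k H).obj M) := by
  obtain ⟨A, _, _, hA, h⟩ := permOn_of_free hM
  let _ := leftAction G A
  let _ := quotientAction (coindSetoid H A) (coindSetoid_smul H A)
  have : Finite (Quotient (coindSetoid H A)) := inferInstance
  refine (permOn_coind H h).free ?_
  rintro g ⟨a⟩ hg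
  obtain ⟨h, hh⟩ := Quotient.exact hg
  have h1 : a.1 = g * a.1 * (h : G)⁻¹ := congr_arg Prod.fst hh
  have h2 := hA h a.2 (congr_arg Prod.snd hh).symm
  rw [h2, Subgroup.coe_one, inv_one, mul_one] at h1
  exact right_eq_mul.1 h1

theorem isPerm_resAlong {N : Type v} [Group N] [Finite N] (π : G →* N) {M : ModG k N}
    (hM : isPerm k N M) : isPerm k G ((resAlong k π).obj M) := by
  obtain ⟨A, _, _, h⟩ := permOn_of_isPerm hM
  let _ := MulAction.compHom A π
  exact (permOn_resAlong π h).isPerm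

/-- Over the trivial group, all modules are free. -/
theorem free_of_subsingleton [Subsingleton G] (M : ModG k G) :
    Module.Free (MonoidAlgebra k G) M := by
  let b := Module.finBasis k M
  let _ : MulAction G (Fin (Module.finrank k M)) :=
    { smul := fun _ a ↦ a
      one_smul := fun _ ↦ rfl
      mul_smul := fun _ _ _ ↦ rfl }
  have h : PermOn (Fin (Module.finrank k M)) M := by
    refine ⟨b.equivFun, fun g m ω ↦ ?_⟩
    rw [Subsingleton.elim g 1, map_one, inv_one, one_smul]
    rfl
  exact h.free fun g ω _ ↦ Subsingleton.elim _ _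

end Coind

end PermutationModules

/-! ### The modules with arbitrarily free resolutions -/

namespace BoundedHomotopy

variable {A B : Type*} [Category A] [Category B] [Abelian A] [Abelian B]
  {𝔓 𝔉 : ObjectProperty A} {𝔓' 𝔉' : ObjectProperty B}

theorem IsResolving.map {m : ℤ} {K : CochainComplex A ℤ} (hK : IsResolving 𝔓 𝔉 m K) (F : A ⥤ B)
    [F.Additive] (h𝔓 : ∀ X, 𝔓 X → 𝔓' (F.obj X)) (h𝔉 : ∀ X, 𝔉 X → 𝔉' (F.obj X)) :
    IsResolving 𝔓' 𝔉' m ((F.mapHomologicalComplex _).obj K) := by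
  obtain ⟨⟨a, _⟩, ⟨b, _⟩⟩ := hK.bounded
  exact ⟨⟨⟨a, inferInstanceAs (CochainComplex.IsStrictlyGE
      ((F.mapHomologicalComplex _).obj K) a)⟩,
    ⟨b, inferInstanceAs (CochainComplex.IsStrictlyLE
      ((F.mapHomologicalComplex _).obj K) b)⟩⟩,
    fun i ↦ h𝔓 _ (hK.prop i), fun i hi ↦ h𝔉 _ (hK.free i hi)⟩

theorem HasResolution.map {m : ℤ} {K : CochainComplex A ℤ} (hK : HasResolution 𝔓 𝔉 m K)
    (F : A ⥤ B) [F.Additive] [F.PreservesHomology]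
    (h𝔓 : ∀ X, 𝔓 X → 𝔓' (F.obj X)) (h𝔉 : ∀ X, 𝔉 X → 𝔉' (F.obj X)) :
    HasResolution 𝔓' 𝔉' m ((F.mapHomologicalComplex _).obj K) := by
  obtain ⟨P, s, hP, hs⟩ := hK
  exact ⟨_, (F.mapHomologicalComplex _).map s, hP.map F h𝔓 h𝔉, inferInstance⟩

end BoundedHomotopy

namespace PermutationModules

open BoundedHomotopy

section

variable (k : Type u) [Field k] (G : Type v) [Group G]

/-- The free modules over the group algebra. -/
def freeG : ObjectProperty (ModG k G) := fun M ↦ Module.Free (MonoidAlgebra k G) M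

variable [Finite G]

noncomputable instance : HasDerivedCategory (ModG k G) := HasDerivedCategory.standard _

instance : (freeG k G).IsClosedUnderIsomorphisms where
  of_iso e h :=
    have : Module.Free _ _ := h
    Module.Free.of_equiv (FGModuleCat.isoToLinearEquiv e)

instance : (freeG k G).ContainsZero where
  exists_zero := by
    refine ⟨FGModuleCat.of (MonoidAlgebra k G) PUnit, ?_, ?_⟩
    · rw [IsZero.iff_id_eq_zero]
      rfl
    · exact Module.Free.of_subsingleton (MonoidAlgebra k G) PUnit.{max u v + 1}

instance : (freeG k G).IsClosedUnderBinaryProducts where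
  limitsOfShape_le := by
    rintro X ⟨p⟩
    have h₁ : Module.Free (MonoidAlgebra k G) (p.diag.obj (.mk .left)) :=
      p.prop_diag_obj (.mk .left)
    have h₂ : Module.Free (MonoidAlgebra k G) (p.diag.obj (.mk .right)) :=
      p.prop_diag_obj (.mk .right)
    have h₃ : freeG k G (FGModuleCat.of (MonoidAlgebra k G)
        (p.diag.obj (.mk .left) × p.diag.obj (.mk .right))) :=
      Module.Free.prod (MonoidAlgebra k G) _ _
    refine (freeG k G).prop_of_iso ?_ h₃
    exact IsLimit.conePointUniqueUpToIso (prodIsLimit k G _ _)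
      ((IsLimit.postcomposeHomEquiv (diagramIsoPair p.diag) _).2 p.isLimit)

theorem projective_of_freeG (M : ModG k G) (h : freeG k G M) : Projective M where
  factors {E X} f e he := by
    have : Module.Free (MonoidAlgebra k G) M := h
    rw [FGModuleCat.epi_iff] at he
    obtain ⟨h, hh⟩ := Module.projective_lifting_property e.hom.hom f.hom.hom he
    refine ⟨FGModuleCat.ofHom h, ?_⟩
    ext x
    exact LinearMap.congr_fun hh x

/-- The subcategory `𝒜(G;k)`, as a subcategory of the derived category: the objects which are
represented by complexes of permutation modules that are free in arbitrarily many degrees. -/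
abbrev resG : ObjectProperty (DerivedCategory (ModG k G)) := ResAll (isPerm k G) (freeG k G)

instance : (resG k G).IsTriangulated := isTriangulated_resAll (projective_of_freeG k G)

/-- The modules which, as complexes in degree zero, are in `𝒜(G;k)`. -/
def resMod : ObjectProperty (ModG k G) :=
  (resG k G).inverseImage (DerivedCategory.singleFunctor (ModG k G) 0)

instance : (resMod k G).IsClosedUnderIsomorphisms := by
  dsimp only [resMod]
  infer_instance

variable {k G}

theorem resMod_iff (M : ModG k G) :
    resMod k G M ↔ ∀ m, HasResolution (isPerm k G) (freeG k G) m
      ((CochainComplex.singleFunctor (ModG k G) 0).obj M) := by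
  have e := (DerivedCategory.singleFunctorIsoCompQ (ModG k G) 0).app M
  constructor
  · intro h
    exact ResAll.hasResolution (projective_of_freeG k G) ⟨⟨0, inferInstance⟩, ⟨0, inferInstance⟩⟩
      ((resG k G).prop_of_iso e h)
  · intro h m
    exact (Res (isPerm k G) (freeG k G) m).prop_of_iso e.symm (h m).res

theorem resMod_of_shortExact {S : ShortComplex (ModG k G)} (hS : S.ShortExact)
    (h₁ : resMod k G S.X₁) (h₃ : resMod k G S.X₃) : resMod k G S.X₂ :=
  (resG k G).ext_of_isTriangulatedClosed₂ _ hS.singleTriangle_distinguished h₁ h₃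

theorem resMod_of_subsingleton (M : ModG k G) [Subsingleton M] : resMod k G M := by
  refine ObjectProperty.prop_of_isZero (resG k G) (Functor.map_isZero _ ?_)
  rw [IsZero.iff_id_eq_zero]
  ext x
  exact Subsingleton.elim _ _

theorem resMod_of_prod {M N : ModG k G} (hM : resMod k G M) (hN : resMod k G N) :
    resMod k G (FGModuleCat.of (MonoidAlgebra k G) (M × N)) := by
  let S : ShortComplex (ModG k G) :=
    { X₁ := M
      X₂ := FGModuleCat.of (MonoidAlgebra k G) (M × N)
      X₃ := N
      f := FGModuleCat.ofHom (LinearMap.inl _ M N)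
      g := FGModuleCat.ofHom (LinearMap.snd _ M N)
      zero := rfl }
  have hS : S.ShortExact :=
    { exact := by
        rw [FGModuleCat.exact_iff]
        rintro ⟨x, y⟩ (hy : y = 0)
        exact ⟨x, Prod.ext rfl hy.symm⟩
      mono_f := by
        rw [FGModuleCat.mono_iff]
        exact LinearMap.inl_injective
      epi_g := by
        rw [FGModuleCat.epi_iff]
        exact LinearMap.snd_surjective }
  exact resMod_of_shortExact hS hM hN

end

section Fn

variable (k : Type u) [Field k] {G : Type v} [Group G]

attribute [local instance] moduleK

/-- The functions on a `G`-set, with the action by translation. -/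
def fnRep (Ω : Type*) [MulAction G Ω] : Representation k G (Ω → k) where
  toFun g := LinearMap.funLeft k k (g⁻¹ • ·)
  map_one' := by
    ext f ω
    simp
  map_mul' g h := by
    ext f ω
    simp [LinearMap.funLeft, mul_smul]

/-- The functions on a finite `G`-set, as a module over the group algebra. -/
noncomputable def fnMod (Ω : Type v) [Finite Ω] [MulAction G Ω] : ModG k G := ofRep (fnRep k Ω)

theorem permOn_fnMod (Ω : Type v) [Finite Ω] [MulAction G Ω] : PermOn Ω (fnMod k (G := G) Ω) := by
  refine ⟨{ toFun := fun f ↦ f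
            map_add' := fun _ _ ↦ rfl
            map_smul' := fun c f ↦ smul_ofRep (fnRep k Ω) c f
            invFun := fun f ↦ f
            left_inv := fun _ ↦ rfl
            right_inv := fun _ ↦ rfl }, fun g f ω ↦ ?_⟩
  exact congr_fun (rep_ofRep (fnRep k Ω) g f) ω

/-- The trivial module of dimension one. -/
noncomputable abbrev triv (G : Type v) [Group G] : ModG k G := fnMod k PUnit.{v + 1}

end Fn

section Trivial

variable {k : Type u} [Field k] {G : Type v} [Group G]

attribute [local instance] moduleK

theorem PermOn.prod {Ω Ω' : Type*} [MulAction G Ω] [MulAction G Ω'] {M N : ModG k G}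
    (hM : PermOn Ω M) (hN : PermOn Ω' N) :
    PermOn (Ω ⊕ Ω') (FGModuleCat.of (MonoidAlgebra k G) (M × N)) := by
  obtain ⟨e, he⟩ := hM
  obtain ⟨f, hf⟩ := hN
  refine ⟨{ toFun := fun x ↦ Sum.elim (e x.1) (f x.2)
            map_add' := fun x y ↦ ?_
            map_smul' := fun c x ↦ ?_
            invFun := fun φ ↦ (e.symm (φ ∘ Sum.inl), f.symm (φ ∘ Sum.inr))
            left_inv := fun x ↦ ?_
            right_inv := fun φ ↦ ?_ }, ?_⟩
  · ext (ω | ω)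
    · exact congr_fun (map_add e x.1 y.1) ω
    · exact congr_fun (map_add f x.2 y.2) ω
  · ext (ω | ω)
    · exact congr_fun (map_smul e c x.1) ω
    · exact congr_fun (map_smul f c x.2) ω
  · exact Prod.ext (e.symm_apply_apply _) (f.symm_apply_apply _)
  · ext (ω | ω)
    · exact congr_fun (e.apply_symm_apply _) ω
    · exact congr_fun (f.apply_symm_apply _) ω
  · rintro g x (ω | ω)
    · exact he g x.1 ω
    · exact hf g x.2 ω

variable [Finite G]

/-- The functions on an orbit are coinduced from the stabilizer of a point. -/
theorem resMod_of_isPretransitive {Ω : Type*} [MulAction G Ω] [MulAction.IsPretransitive G Ω]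
    (ω : Ω) {M : ModG k G} (hM : PermOn Ω M)
    (h : resMod k _ (triv k (MulAction.stabilizer G ω))) : resMod k G M := by
  let H := MulAction.stabilizer G ω
  let _ := leftAction G PUnit.{v + 1}
  let _ := quotientAction (coindSetoid H PUnit.{v + 1}) (coindSetoid_smul H PUnit.{v + 1})
  have h1 := permOn_coind H (permOn_fnMod k (G := H) PUnit.{v + 1})
  let σ : Quotient (coindSetoid H PUnit.{v + 1}) → Ω := Quotient.lift (fun a ↦ a.1 • ω) (by
    rintro a _ ⟨h, rfl⟩
    change a.1 • ω = (a.1 * (h : G)⁻¹) • ω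
    rw [mul_smul]
    congr 1
    exact (MulAction.mem_stabilizer_iff.1 (H.inv_mem h.2)).symm)
  have hσ : Function.Bijective σ := by
    constructor
    · rintro ⟨g, _⟩ ⟨g', _⟩ (h : g • ω = g' • ω)
      refine Quotient.sound ⟨⟨g'⁻¹ * g, ?_⟩, Prod.ext ?_ rfl⟩
      · rw [MulAction.mem_stabilizer_iff, mul_smul, h, inv_smul_smul]
      · simp
    · intro ω'
      obtain ⟨g, rfl⟩ := MulAction.exists_smul_eq G ω ω'
      exact ⟨Quotient.mk _ (g, PUnit.unit), rfl⟩
  obtain ⟨e⟩ := (h1.congr (Equiv.ofBijective σ hσ) (by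
    rintro g ⟨a⟩
    exact mul_smul _ _ _)).nonempty_iso hM
  refine (resMod k G).prop_of_iso e ?_
  rw [resMod_iff] at h ⊢
  intro m
  obtain ⟨P, s, hP, hs⟩ := (h m).map (coind k H) (fun X hX ↦ isPerm_coind H hX)
    (𝔉' := freeG k G)
    (fun X hX ↦ free_coind H hX)
  let e' : ((coind k H).mapHomologicalComplex _).obj
      ((CochainComplex.singleFunctor (ModG k H) 0).obj (triv k H)) ≅
      (CochainComplex.singleFunctor (ModG k G) 0).obj ((coind k H).obj (triv k H)) :=
    (HomologicalComplex.singleMapHomologicalComplex (coind k H) (ComplexShape.up ℤ)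
    0).app (triv k H)
  have : QuasiIso e'.hom := inferInstance
  exact ⟨P, s ≫ e'.hom, hP, quasiIso_comp s e'.hom⟩

/-- A permutation module has arbitrarily free resolutions if the trivial modules of the stabilizers
do, since it is the sum of the modules of functions on its orbits. The induction is on the number
of points. -/
theorem resMod_of_permOn : ∀ (n : ℕ) {Ω : Type v} [Finite Ω] [MulAction G Ω], Nat.card Ω ≤ n →
    (∀ ω : Ω, resMod k _ (triv k (MulAction.stabilizer G ω))) → ∀ {M : ModG k G}, PermOn Ω M →
    resMod k G M
  | 0, Ω, _, _, hn, h, M, ⟨e, he⟩ => by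
    have : IsEmpty Ω := (Nat.card_eq_zero.1 (Nat.le_zero.1 hn)).resolve_right (by simpa)
    have : Subsingleton M := e.toEquiv.subsingleton
    exact resMod_of_subsingleton M
  | n + 1, Ω, _, _, hn, h, M, hM => by
    by_cases hΩ : IsEmpty Ω
    · exact resMod_of_permOn n (by rw [Nat.card_of_isEmpty]; lia) h hM
    obtain ⟨ω⟩ := not_isEmpty_iff.1 hΩ
    let O : SubMulAction G Ω :=
      { carrier := MulAction.orbit G ω
        smul_mem' := fun g x hx ↦ MulAction.mem_orbit_of_mem_orbit g hx }
    have hstab (S : SubMulAction G Ω) (x : S) :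
        MulAction.stabilizer G x = MulAction.stabilizer G (x : Ω) := by
      ext g
      simp only [MulAction.mem_stabilizer_iff, Subtype.ext_iff, SubMulAction.val_smul]
    have hO : MulAction.IsPretransitive G O := by
      refine ⟨?_⟩
      rintro ⟨_, a, rfl⟩ ⟨_, b, rfl⟩
      refine ⟨b * a⁻¹, Subtype.ext ?_⟩
      change (b * a⁻¹) • a • ω = b • ω
      rw [smul_smul, inv_mul_cancel_right]
    have h1 : resMod k G (fnMod k O) := by
      refine resMod_of_isPretransitive (⟨ω, MulAction.mem_orbit_self ω⟩ : O) (permOn_fnMod k O) ?_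
      rw [hstab]
      exact h ω
    have h2 : resMod k G (fnMod k (Oᶜ : SubMulAction G Ω)) := by
      refine resMod_of_permOn n ?_ (fun x ↦ ?_) (permOn_fnMod k _)
      · have : Nat.card (Oᶜ : SubMulAction G Ω) < Nat.card Ω :=
          Finite.card_subtype_lt (x := ω) (fun h ↦ h (MulAction.mem_orbit_self ω))
        lia
      · rw [hstab]
        exact h _
    classical
    let σ : O ⊕ (Oᶜ : SubMulAction G Ω) ≃ Ω := Equiv.sumCompl (fun x ↦ x ∈ O)
    obtain ⟨e⟩ := (((permOn_fnMod k O).prod (permOn_fnMod k (Oᶜ : SubMulAction G Ω))).congr σ (by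
      rintro g (x | x) <;> rfl)).nonempty_iso hM
    exact (resMod k G).prop_of_iso e (resMod_of_prod h1 h2)

end Trivial

end PermutationModules

/-! ### The transfer for a subgroup of invertible index -/

namespace PermutationModules

open BoundedHomotopy

section Transfer

variable {k : Type u} [Field k] {G : Type v} [Group G] [Finite G]

attribute [local instance] moduleK

variable (k) in
/-- The unit `M ⟶ coind (res M)`, which takes `m` to `g ↦ g⁻¹ • m`. -/
noncomputable def coindUnit (H : Subgroup G) :
    𝟭 (ModG k G) ⟶ resAlong k H.subtype ⋙ coind k H where
  app M := homMk (N := (resAlong k H.subtype ⋙ coind k H).obj M)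
    { toFun := fun m ↦ (⟨fun g ↦ rep M g⁻¹ m, fun g h ↦ by
        refine Eq.trans ?_ (rep_ofRep ((rep M).comp H.subtype) h⁻¹ (rep M g⁻¹ m)).symm
        change rep M (g * h)⁻¹ m = rep M (h : G)⁻¹ (rep M g⁻¹ m)
        rw [mul_inv_rev, map_mul]
        rfl⟩ : coindSub H ((resAlong k H.subtype).obj M))
      map_add' := fun m m' ↦ Subtype.ext (funext fun g ↦ map_add (rep M g⁻¹) m m')
      map_smul' := fun c m ↦ by
        refine Eq.trans ?_ (smul_ofRep (coindRep H ((resAlong k H.subtype).obj M)) c _).symm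
        refine Subtype.ext (funext fun g ↦ ?_)
        exact (map_smul (rep M g⁻¹) c m).trans
          (smul_ofRep ((rep M).comp H.subtype) c (rep M g⁻¹ m)).symm }
    (fun x m ↦ by
      refine Eq.trans ?_ (rep_ofRep (coindRep H ((resAlong k H.subtype).obj M)) x _).symm
      refine Subtype.ext (funext fun g ↦ ?_)
      change rep M g⁻¹ (rep M x m) = rep M (x⁻¹ * g)⁻¹ m
      rw [mul_inv_rev, inv_inv, map_mul]
      rfl)
  naturality M N f := by
    ext m
    exact Subtype.ext (funext fun g ↦ (map_rep f g⁻¹ m).symm)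

/-- The summand `g • φ g` of the transfer only depends on the coset of `g`. -/
theorem rep_coindSub_mul {H : Subgroup G} {M : ModG k G}
    (φ : coindSub H ((resAlong k H.subtype).obj M)) (g : G) (h : H) :
    rep M (g * h) (show M from φ.1 (g * h)) = rep M g (show M from φ.1 g) := by
  have h1 : (φ.1 (g * h) : M) = rep M (h : G)⁻¹ (show M from φ.1 g) :=
    (φ.2 g h).trans (rep_ofRep ((rep M).comp H.subtype) h⁻¹ (φ.1 g))
  refine (congr_arg (rep M (g * h)) h1).trans ?_
  rw [← Module.End.mul_apply, ← map_mul, mul_inv_cancel_right]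

theorem rep_coindSub_eq {H : Subgroup G} {M : ModG k G}
    (φ : coindSub H ((resAlong k H.subtype).obj M)) {g g' : G} (h : (g : G ⧸ H) = g') :
    rep M g (show M from φ.1 g) = rep M g' (show M from φ.1 g') := by
  have := rep_coindSub_mul φ g ⟨g⁻¹ * g', QuotientGroup.eq.1 h⟩
  simp only [mul_inv_cancel_left] at this
  exact this.symm

/-- The sum over the cosets which defines the transfer. -/
noncomputable def transferSum {H : Subgroup G} {M : ModG k G}
    (φ : coindSub H ((resAlong k H.subtype).obj M)) : M :=
  ∑ᶠ q : G ⧸ H, rep M q.out (show M from φ.1 q.out)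

theorem transferSum_coindRep {H : Subgroup G} {M : ModG k G}
    (φ : coindSub H ((resAlong k H.subtype).obj M)) (x : G) :
    transferSum (coindRep H ((resAlong k H.subtype).obj M) x φ) = rep M x (transferSum φ) := by
  let _ := Fintype.ofFinite (G ⧸ H)
  unfold transferSum
  rw [finsum_eq_sum_of_fintype, finsum_eq_sum_of_fintype, map_sum]
  refine Eq.trans (Finset.sum_congr rfl fun q _ ↦ ?_) (Equiv.sum_comp (MulAction.toPerm x⁻¹)
    fun q : G ⧸ H ↦ rep M x (rep M q.out (show M from φ.1 q.out)))
  have h1 : (((MulAction.toPerm x⁻¹ : Equiv.Perm (G ⧸ H)) q).out : G ⧸ H) =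
      ((x⁻¹ * q.out : G) : G ⧸ H) := by
    rw [QuotientGroup.out_eq']
    change x⁻¹ • q = _
    conv_lhs => rw [← QuotientGroup.out_eq' q]
    rfl
  refine Eq.trans ?_ (congr_arg (rep M x) (rep_coindSub_eq φ h1)).symm
  refine Eq.trans ?_ (Module.End.mul_apply (rep M x) (rep M (x⁻¹ * q.out)) _)
  rw [← map_mul, mul_inv_cancel_left]
  rfl

variable (k) in
/-- The transfer `coind (res M) ⟶ M`, which takes `φ` to the sum of `g • φ g` over the cosets
`g * H`. -/
noncomputable def coindTransfer (H : Subgroup G) :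
    resAlong k H.subtype ⋙ coind k H ⟶ 𝟭 (ModG k G) where
  app M := homMk (M := (resAlong k H.subtype ⋙ coind k H).obj M) (N := M)
    { toFun := fun (φ : coindSub H ((resAlong k H.subtype).obj M)) ↦ transferSum φ
      map_add' := fun (φ ψ : coindSub H ((resAlong k H.subtype).obj M)) ↦ by
        unfold transferSum
        rw [← finsum_add_distrib (Set.toFinite _) (Set.toFinite _)]
        exact finsum_congr fun q ↦ map_add (rep M q.out) _ _
      map_smul' := fun c (φ : coindSub H ((resAlong k H.subtype).obj M)) ↦ by
        unfold transferSum
        rw [RingHom.id_apply, smul_finsum]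
        refine finsum_congr fun q ↦ ?_
        refine Eq.trans ?_ (map_smul (rep M q.out) c (show M from φ.1 q.out))
        refine congr_arg (rep M q.out) ?_
        have h1 := smul_ofRep (coindRep H ((resAlong k H.subtype).obj M)) c φ
        exact (congr_arg (fun ψ : coindSub H ((resAlong k H.subtype).obj M) ↦ ψ.1 q.out)
          h1).trans (smul_ofRep ((rep M).comp H.subtype) c (φ.1 q.out)) }
    (fun x (φ : coindSub H ((resAlong k H.subtype).obj M)) ↦
      (congr_arg transferSum (rep_ofRep (coindRep H ((resAlong k H.subtype).obj M)) x φ)).trans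
        (transferSum_coindRep φ x))
  naturality M N f := by
    ext (φ : coindSub H ((resAlong k H.subtype).obj M))
    change ∑ᶠ q : G ⧸ H, rep N q.out (f.hom.hom (φ.1 q.out)) =
      f.hom.hom (∑ᶠ q : G ⧸ H, rep M q.out (show M from φ.1 q.out))
    let _ := Fintype.ofFinite (G ⧸ H)
    rw [finsum_eq_sum_of_fintype, finsum_eq_sum_of_fintype, map_sum]
    exact Finset.sum_congr rfl fun q _ ↦ (map_rep f q.out _).symm

variable (G) in
/-- Multiplication by a scalar, as an endomorphism of the identity functor. -/
noncomputable def scalarMap (c : k) : 𝟭 (ModG k G) ⟶ 𝟭 (ModG k G) where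
  app M := homMk (M := M) (N := M) (c • LinearMap.id) fun g m ↦ (map_smul (rep M g) c m).symm
  naturality M N f := by
    ext m
    exact (map_smul (linK f) c m).symm

/-- The transfer after the unit is multiplication by the index, so for a subgroup of invertible
index each module is a natural retract of the coinduction of its restriction. -/
theorem coindUnit_comp_transfer (H : Subgroup G) (hH : (H.index : k) ≠ 0) :
    coindUnit k H ≫ coindTransfer k H ≫ scalarMap G (H.index : k)⁻¹ = 𝟙 _ := by
  ext M m
  change (H.index : k)⁻¹ • (∑ᶠ q : G ⧸ H, rep M q.out (rep M q.out⁻¹ m)) = m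
  have h (q : G ⧸ H) : rep M q.out (rep M q.out⁻¹ m) = m := by
    rw [← Module.End.mul_apply, ← map_mul, mul_inv_cancel, map_one, Module.End.one_apply]
  let _ := Fintype.ofFinite (G ⧸ H)
  simp_rw [h]
  rw [finsum_eq_sum_of_fintype, Finset.sum_const, Finset.card_univ, ← Nat.card_eq_fintype_card,
    ← Nat.cast_smul_eq_nsmul k, smul_smul]
  exact (congr_arg (· • m) (inv_mul_cancel₀ hH)).trans (one_smul _ _)

end Transfer

/-! ### Modules over a `p`-group in characteristic `p` -/

section PGroup

variable {k : Type u} [Field k] {G : Type v} [Group G] [Finite G] {p : ℕ} [Fact p.Prime]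
  [CharP k p]

attribute [local instance] moduleK

omit [Finite G] in
/-- A `p`-group has non-zero fixed vectors in characteristic `p`: the additive group generated by
an orbit is a finite `p`-group. -/
theorem exists_fixed (hG : IsPGroup p G) [Finite G] {V : Type*} [AddCommGroup V] [Module k V]
    [Nontrivial V] (ρ : Representation k G V) : ∃ m : V, m ≠ 0 ∧ ∀ g, ρ g m = m := by
  obtain ⟨m₀, hm₀⟩ := exists_ne (0 : V)
  have hp (m : V) : p • m = 0 := by
    rw [← Nat.cast_smul_eq_nsmul k, CharP.cast_eq_zero, zero_smul]
  have : Module (ZMod p) V := AddCommGroup.zmodModule hp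
  let S : Submodule (ZMod p) V := Submodule.span (ZMod p) (Set.range fun g ↦ ρ g m₀)
  have : Module.Finite (ZMod p) ↥S :=
    Module.Finite.span_of_finite (ZMod p) (Set.finite_range (fun g ↦ ρ g m₀))
  have : Finite S := Module.finite_of_finite (ZMod p)
  have hS (g : G) (x : V) (hx : x ∈ S) : ρ g x ∈ S := by
    have h1 : S ≤ S.comap ((ρ g).toAddMonoidHom.toZModLinearMap p) := by
      rw [Submodule.span_le]
      rintro _ ⟨h, rfl⟩
      refine Submodule.subset_span ⟨g * h, ?_⟩
      change ρ (g * h) m₀ = _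
      rw [map_mul]
      rfl
    exact h1 hx
  let _ : MulAction G S :=
    { smul := fun g x ↦ ⟨ρ g x.1, hS g _ x.2⟩
      one_smul := fun x ↦ Subtype.ext (by
        change ρ 1 x.1 = x.1
        rw [map_one, Module.End.one_apply])
      mul_smul := fun g h x ↦ Subtype.ext (by
        change ρ (g * h) x.1 = ρ g (ρ h x.1)
        rw [map_mul, Module.End.mul_apply]) }
  let m₁ : S := ⟨m₀, Submodule.subset_span ⟨1, by
    change ρ 1 m₀ = m₀
    rw [map_one, Module.End.one_apply]⟩⟩
  have h1 : p ∣ Nat.card S := by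
    have h2 : addOrderOf m₁ = p := by
      refine addOrderOf_eq_prime (Subtype.ext (hp m₀)) fun h ↦ hm₀ (congr_arg Subtype.val h)
    exact (dvd_of_eq h2.symm).trans (addOrderOf_dvd_natCard m₁)
  obtain ⟨b, hb, hb'⟩ := hG.exists_fixed_point_of_prime_dvd_card_of_fixed_point S h1
    (a := (0 : S)) (fun g ↦ Subtype.ext (map_zero (ρ g)))
  exact ⟨b.1, fun h ↦ hb' (Subtype.ext h.symm), fun g ↦ congr_arg Subtype.val (hb g)⟩

/-- All modules over a `p`-group in characteristic `p` are iterated extensions of the trivial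
module. -/
theorem resMod_of_triv (hG : IsPGroup p G) (h : resMod k G (triv k G)) :
    ∀ (n : ℕ) (M : ModG k G), Module.finrank k M ≤ n → resMod k G M := by
  intro n
  induction n with
  | zero =>
    intro M hM
    have : Subsingleton M := Module.finrank_zero_iff.1 (Nat.le_zero.1 hM)
    exact resMod_of_subsingleton M
  | succ n hn =>
    intro M hM
    by_cases hM₀ : Subsingleton M
    · exact resMod_of_subsingleton M
    rw [not_subsingleton_iff_nontrivial] at hM₀
    obtain ⟨m, hm, hm'⟩ := exists_fixed hG (rep M)
    obtain ⟨e, he⟩ := permOn_fnMod k (G := G) PUnit.{v + 1}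
    let f : triv k G ⟶ M := homMk
      { toFun := fun x ↦ e x PUnit.unit • m
        map_add' := fun x y ↦ by rw [map_add, Pi.add_apply, add_smul]
        map_smul' := fun c x ↦ by
          rw [map_smul, Pi.smul_apply, smul_eq_mul, mul_smul, RingHom.id_apply] }
      (fun g x ↦ by
        change e (rep _ g x) PUnit.unit • m = rep M g (e x PUnit.unit • m)
        rw [he, map_smul, hm'])
    let R := LinearMap.range f.hom.hom
    let S : ShortComplex (ModG k G) :=
      { X₁ := triv k G
        X₂ := M
        X₃ := FGModuleCat.of (MonoidAlgebra k G) (M ⧸ R)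
        f := f
        g := FGModuleCat.ofHom R.mkQ
        zero := by
          ext x
          exact (Submodule.Quotient.mk_eq_zero R).2 ⟨x, rfl⟩ }
    have hS : S.ShortExact :=
      { exact := by
          rw [FGModuleCat.exact_iff]
          intro y hy
          exact (Submodule.Quotient.mk_eq_zero R).1 hy
        mono_f := by
          rw [FGModuleCat.mono_iff, injective_iff_map_eq_zero]
          intro x hx
          apply e.injective
          ext ⟨⟩
          rw [map_zero]
          exact (smul_eq_zero.1 (show e x PUnit.unit • m = 0 from hx)).resolve_right hm
        epi_g := by
          rw [FGModuleCat.epi_iff]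
          exact R.mkQ_surjective }
    refine resMod_of_shortExact hS h (hn _ ?_)
    have h1 := LinearMap.finrank_range_add_finrank_ker (linK S.g)
    have h2 : LinearMap.range (linK S.g) = ⊤ :=
      LinearMap.range_eq_top.2 ((FGModuleCat.epi_iff _).1 hS.epi_g)
    rw [h2, finrank_top] at h1
    have h3 : m ∈ LinearMap.ker (linK S.g) := by
      refine (Submodule.Quotient.mk_eq_zero R).2 ⟨e.symm fun _ ↦ 1, ?_⟩
      change e (e.symm fun _ ↦ 1) PUnit.unit • m = m
      rw [e.apply_symm_apply, one_smul]
    have h4 : Nontrivial (LinearMap.ker (linK S.g)) :=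
      ⟨⟨⟨m, h3⟩, 0, fun h ↦ hm (congr_arg Subtype.val h)⟩⟩
    have h5 : 0 < Module.finrank k (LinearMap.ker (linK S.g)) := Module.finrank_pos
    exact Nat.le_of_lt_succ (lt_of_lt_of_le (h1 ▸ Nat.lt_add_of_pos_right h5) hM)

/-- A bounded complex has arbitrarily free resolutions if all modules do. -/
theorem resG_Q_of_resMod (h : ∀ M, resMod k G M) {K : CochainComplex (ModG k G) ℤ}
    (hK : IsBounded _ K) : resG k G (DerivedCategory.Q.obj K) := by
  obtain ⟨⟨a, ha⟩, ⟨b, hb⟩⟩ := hK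
  refine prop_Q_of_prop_terms _ a (b + 1 - a).toNat K ha ?_ (fun i ↦ h (K.X i))
  exact K.isStrictlyLE_of_le b _ (by lia)

end PGroup

section TrivialGroup

variable {k : Type u} [Field k] {G : Type v} [Group G]

attribute [local instance] moduleK

theorem isPerm_of_subsingleton_group [Finite G] [Subsingleton G] (M : ModG k G) :
    isPerm k G M := by
  obtain ⟨A, _, _, _, h⟩ := permOn_of_free (free_of_subsingleton M)
  exact h.isPerm

theorem isResolving_of_subsingleton [Finite G] [Subsingleton G] {K : CochainComplex (ModG k G) ℤ}
    (hK : IsBounded _ K) (m : ℤ) : IsResolving (isPerm k G) (freeG k G) m K :=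
  ⟨hK, fun _ ↦ isPerm_of_subsingleton_group _, fun _ _ ↦ free_of_subsingleton _⟩

end TrivialGroup

end PermutationModules

/-! ### Splitting off a central factor of prime order -/

namespace BoundedHomotopy

variable {A : Type*} [Category A] [Abelian A]

theorem shortExact_kernel_ι {Z W : A} (h : Z ⟶ W) [Epi h] :
    (ShortComplex.mk (kernel.ι h) h (kernel.condition h)).ShortExact where
  exact := ShortComplex.exact_of_f_is_kernel _ (kernelIsKernel h)

/-- The first half of an exact sequence `0 ⟶ X ⟶ Y ⟶ Z ⟶ W`. -/
theorem shortExact_kernel_lift {X Y Z W : A} {f : X ⟶ Y} {g : Y ⟶ Z} {h : Z ⟶ W} [Mono f]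
    (w : f ≫ g = 0) (w' : g ≫ h = 0) (hf : (ShortComplex.mk f g w).Exact)
    (hg : (ShortComplex.mk g h w').Exact) :
    (ShortComplex.mk f (kernel.lift h g w') (by
      rw [← cancel_mono (kernel.ι h), Category.assoc, kernel.lift_ι, w, zero_comp])).ShortExact where
  exact := by
    let φ : ShortComplex.mk f (kernel.lift h g w') (by
        rw [← cancel_mono (kernel.ι h), Category.assoc, kernel.lift_ι, w, zero_comp]) ⟶
        ShortComplex.mk f g w :=
      { τ₁ := 𝟙 _
        τ₂ := 𝟙 _
        τ₃ := kernel.ι h }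
    have : Epi φ.τ₁ := inferInstanceAs (Epi (𝟙 X))
    have : IsIso φ.τ₂ := inferInstanceAs (IsIso (𝟙 Y))
    have : Mono φ.τ₃ := inferInstanceAs (Mono (kernel.ι h))
    exact (ShortComplex.exact_iff_of_epi_of_isIso_of_mono φ).2 hf
  epi_g := (ShortComplex.exact_iff_epi_kernel_lift _).1 hg

variable {𝔓 𝔉 : ObjectProperty A} [HasDerivedCategory A] [𝔓.IsClosedUnderIsomorphisms]
  [𝔓.IsClosedUnderBinaryProducts] [𝔉.IsClosedUnderIsomorphisms] [𝔉.IsClosedUnderBinaryProducts]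

/-- An exact sequence `0 ⟶ K ⟶ B ⟶ B ⟶ K ⟶ 0` extends the range in which `K` admits a free
resolution by two, within the range in which `B` is free. Iterating this, the range for `K`
becomes that for `B`. -/
theorem HasResolution.of_periodic {K B : CochainComplex A ℤ} {f : K ⟶ B} {g : B ⟶ B} {h : B ⟶ K}
    [Mono f] [Epi h] (w : f ≫ g = 0) (w' : g ≫ h = 0) (hf : (ShortComplex.mk f g w).Exact)
    (hg : (ShortComplex.mk g h w').Exact) {m : ℤ} (hB : IsResolving 𝔓 𝔉 m B) :
    ∀ t : ℕ, HasResolution 𝔓 𝔉 (m - 2 * t) K → HasResolution 𝔓 𝔉 m K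
  | 0, hK => by simpa using hK
  | t + 1, hK => by
    refine of_periodic w w' hf hg hB t ?_
    have h1 := HasResolution.of_shortExact (shortExact_kernel_lift w w' hf hg) hK
      (hB.mono (by push_cast; lia))
    have h2 := HasResolution.of_shortExact (shortExact_kernel_ι h) h1 (hB.mono (by push_cast; lia))
    convert h2 using 1
    push_cast
    ring

end BoundedHomotopy

/-- A function `f` on a set with an operator `s` of period `p` which moves a coordinate in `ℤ/p`
by one is of the form `ψ ∘ s - ψ`, if its sums over the periods vanish. -/
theorem exists_eq_comp_sub {Ω V : Type*} [AddCommGroup V] {p : ℕ} [NeZero p] (s : Ω → Ω)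
    (j : Ω → ZMod p) (hj : ∀ ω, j (s ω) = j ω - 1) (f : Ω → V) (ω : Ω)
    (hf : ∑ i ∈ Finset.range p, f (s^[i] ω) = 0) :
    -(∑ i ∈ Finset.range (j (s ω)).val, f (s^[i] (s ω))) -
      -(∑ i ∈ Finset.range (j ω).val, f (s^[i] ω)) = f ω := by
  have h1 (m n : ℕ) (h : n = m + 1) : ∑ i ∈ Finset.range n, f (s^[i] ω) =
      ∑ i ∈ Finset.range m, f (s^[i] (s ω)) + f ω := by
    rw [h, Finset.sum_range_succ']
    rfl
  rw [hj]
  obtain ⟨n, rfl⟩ : ∃ n, p = n + 1 := ⟨p - 1, (Nat.succ_pred (NeZero.ne p)).symm⟩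
  by_cases h0 : j ω = 0
  · have h2 : (j ω - 1).val = n := by
      rw [h0, zero_sub, ZMod.val_neg_one]
    rw [h1 n _ rfl] at hf
    rw [h2, h0, ZMod.val_zero, Finset.sum_range_zero, neg_zero, sub_zero,
      neg_eq_of_add_eq_zero_right hf]
  · have h2 : (j ω).val = (j ω - 1).val + 1 := by
      have h4 : (j ω).val ≠ 0 := fun h ↦ h0 ((ZMod.val_eq_zero _).1 h)
      have h3 : (j ω - 1).val = (j ω).val - 1 := by
        rcases n with _ | n
        · exact absurd (Subsingleton.elim (α := ZMod 1) _ _) h0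
        · have : (1 : ZMod (n + 2)).val = 1 := ZMod.val_one'' (by simp)
          rw [ZMod.val_sub (by rw [this]; lia), this]
      lia
    rw [h1 _ _ h2]
    abel

namespace PermutationModules

open BoundedHomotopy

section CyclicFactor

variable {k : Type u} [Field k] {G : Type v} [Group G]

attribute [local instance] moduleK

/-- A decomposition of `G` as the product of a subgroup `N` and the group generated by a central
element `z` of order `p`: the projection `π` to `N`, and the coordinate `j` of the second factor. -/
structure CyclicFactor (p : ℕ) (z : G) (N : Subgroup G) where
  /-- The projection to `N`. -/
  π : G →* N
  /-- The coordinate of the cyclic factor. -/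
  j : G → ZMod p
  comm : ∀ g, z * g = g * z
  pow_eq : z ^ p = 1
  π_coe : ∀ n : N, π n = n
  π_z : π z = 1
  exists_pow : ∀ g, ∃ a : ℕ, z⁻¹ ^ a * g = π g
  j_one : j 1 = 0
  j_z : ∀ g, j (z⁻¹ * g) = j g - 1
  j_mul : ∀ (g : G) (n : N), j (g * n) = j g

/-- The sum of the translates of an element of a coinduced module by the powers of `z`. -/
noncomputable def zNorm (p : ℕ) (z : G) {N : Subgroup G} {M : ModG k N} (φ : coindSub N M)
    (g : G) : M :=
  ∑ i ∈ Finset.range p, φ.1 (z⁻¹ ^ i * g)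

theorem iterate_inv_mul (z : G) (i : ℕ) (g : G) : (z⁻¹ * ·)^[i] g = z⁻¹ ^ i * g := by
  rw [mul_left_iterate]

namespace CyclicFactor

variable {p : ℕ} {z : G} {N : Subgroup G} (D : CyclicFactor p z N)

include D

theorem comm_inv (g : G) : z⁻¹ * g = g * z⁻¹ := by
  rw [inv_mul_eq_iff_eq_mul, ← mul_assoc, D.comm, mul_inv_cancel_right]

theorem comm_inv_pow (a : ℕ) (g : G) : z⁻¹ ^ a * g = g * z⁻¹ ^ a :=
  (Commute.pow_left (D.comm_inv g) a).eq

/-- The invariant elements of a coinduced module are determined by their values at `1`. -/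
theorem apply_eq_of_invariant {M : ModG k N} (φ : coindSub N M)
    (hφ : ∀ g, φ.1 (z⁻¹ * g) = φ.1 g) (g : G) : φ.1 g = rep M (D.π g)⁻¹ (φ.1 1) := by
  have h (a : ℕ) (x : G) : φ.1 (z⁻¹ ^ a * x) = φ.1 x := by
    induction a with
    | zero => simp
    | succ a ha => rw [pow_succ', mul_assoc, hφ, ha]
  obtain ⟨a, ha⟩ := D.exists_pow g
  rw [← h a g, ha]
  simpa using φ.2 1 (D.π g)

theorem zNorm_z {M : ModG k N} (φ : coindSub N M) (g : G) :
    zNorm p z φ (z⁻¹ * g) = zNorm p z φ g := by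
  unfold zNorm
  have h := Finset.sum_range_succ' (fun i ↦ φ.1 (z⁻¹ ^ i * g)) p
  rw [Finset.sum_range_succ] at h
  simp only [inv_pow z p, D.pow_eq, inv_one, pow_zero] at h
  rw [add_right_cancel h]
  simp only [pow_succ, mul_assoc]

/-- The norm of an element of a coinduced module is `z`-invariant, so it is determined by its value
at `1`. -/
theorem zNorm_eq {M : ModG k N} (φ : coindSub N M) (g : G) :
    zNorm p z φ g = rep M (D.π g)⁻¹ (zNorm p z φ 1) := by
  refine D.apply_eq_of_invariant (⟨zNorm p z φ, fun g h ↦ ?_⟩ : coindSub N M) (D.zNorm_z φ) g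
  unfold zNorm
  rw [map_sum]
  refine Finset.sum_congr rfl fun i _ ↦ ?_
  rw [← mul_assoc]
  exact φ.2 _ h

variable (k) [Finite G]

/-- The embedding of the inflation of a module in the coinduced module, as the `z`-invariants. -/
noncomputable def incl : resAlong k D.π ⟶ coind k N where
  app M := homMk (M := (resAlong k D.π).obj M) (N := (coind k N).obj M)
    { toFun := fun (m : M) ↦ (⟨fun g ↦ rep M (D.π g)⁻¹ m, fun g h ↦ by
        change rep M (D.π (g * h))⁻¹ m = rep M h⁻¹ (rep M (D.π g)⁻¹ m)
        rw [map_mul, D.π_coe, mul_inv_rev, map_mul]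
        rfl⟩ : coindSub N M)
      map_add' := fun (m m' : M) ↦ Subtype.ext (funext fun g ↦ map_add (rep M (D.π g)⁻¹) m m')
      map_smul' := fun c (m : M) ↦ by
        refine Eq.trans ?_ (smul_ofRep (coindRep N M) c _).symm
        refine Subtype.ext (funext fun g ↦ ?_)
        exact (congr_arg (rep M (D.π g)⁻¹) (smul_ofRep ((rep M).comp D.π) c m)).trans
          (map_smul (rep M (D.π g)⁻¹) c m) }
    (fun x (m : M) ↦ by
      refine Eq.trans ?_ (rep_ofRep (coindRep N M) x _).symm
      refine Subtype.ext (funext fun g ↦ ?_)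
      refine (congr_arg (rep M (D.π g)⁻¹) (rep_ofRep ((rep M).comp D.π) x m)).trans ?_
      change rep M (D.π g)⁻¹ (rep M (D.π x) m) = rep M (D.π (x⁻¹ * g))⁻¹ m
      rw [map_mul, mul_inv_rev, map_inv D.π x, inv_inv, map_mul]
      rfl)
  naturality M M' f := by
    ext (m : M)
    exact Subtype.ext (funext fun g ↦ (map_rep f (D.π g)⁻¹ m).symm)

/-- The endomorphism `z - 1` of the coinduced modules. -/
noncomputable def zSubOne : coind k N ⟶ coind k N where
  app M := homMk (M := (coind k N).obj M) (N := (coind k N).obj M)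
    { toFun := fun (φ : coindSub N M) ↦ (⟨fun g ↦ φ.1 (z⁻¹ * g) - φ.1 g, fun g h ↦ by
        change φ.1 (z⁻¹ * (g * h)) - φ.1 (g * h) = rep M h⁻¹ (φ.1 (z⁻¹ * g) - φ.1 g)
        rw [← mul_assoc, φ.2, φ.2, map_sub]⟩ : coindSub N M)
      map_add' := fun (φ ψ : coindSub N M) ↦ Subtype.ext (funext fun g ↦
        add_sub_add_comm (φ.1 (z⁻¹ * g)) (ψ.1 (z⁻¹ * g)) (φ.1 g) (ψ.1 g))
      map_smul' := fun c (φ : coindSub N M) ↦ by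
        refine Eq.trans ?_ (smul_ofRep (coindRep N M) c _).symm
        have h1 := smul_ofRep (coindRep N M) c φ
        refine Subtype.ext (funext fun g ↦ ?_)
        refine (congr_arg (fun ψ : coindSub N M ↦ ψ.1 (z⁻¹ * g) - ψ.1 g) h1).trans ?_
        exact (smul_sub c (φ.1 (z⁻¹ * g)) (φ.1 g)).symm }
    (fun x (φ : coindSub N M) ↦ by
      refine Eq.trans ?_ (rep_ofRep (coindRep N M) x _).symm
      refine Subtype.ext (funext fun g ↦ ?_)
      refine (congr_arg (fun ψ : coindSub N M ↦ ψ.1 (z⁻¹ * g) - ψ.1 g)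
        (rep_ofRep (coindRep N M) x φ)).trans ?_
      change φ.1 (x⁻¹ * (z⁻¹ * g)) - φ.1 (x⁻¹ * g) = φ.1 (z⁻¹ * (x⁻¹ * g)) - φ.1 (x⁻¹ * g)
      rw [← mul_assoc, ← D.comm_inv, mul_assoc])
  naturality M M' f := by
    ext (φ : coindSub N M)
    exact Subtype.ext (funext fun g ↦ (map_sub (linK f) (φ.1 (z⁻¹ * g)) (φ.1 g)).symm)

/-- The norm, from the coinduced modules to the inflated modules. -/
noncomputable def normMap : coind k N ⟶ resAlong k D.π where
  app M := homMk (M := (coind k N).obj M) (N := (resAlong k D.π).obj M)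
    { toFun := fun (φ : coindSub N M) ↦ (zNorm p z φ 1 : M)
      map_add' := fun (φ ψ : coindSub N M) ↦ Finset.sum_add_distrib
      map_smul' := fun c (φ : coindSub N M) ↦ by
        have h1 := smul_ofRep (coindRep N M) c φ
        refine Eq.trans ?_ (smul_ofRep ((rep M).comp D.π) c _).symm
        refine (congr_arg (fun ψ : coindSub N M ↦ (zNorm p z ψ 1 : M)) h1).trans ?_
        exact (Finset.smul_sum (r := c) (f := fun i ↦ φ.1 (z⁻¹ ^ i * 1))).symm }
    (fun x (φ : coindSub N M) ↦ by
      refine (congr_arg (fun ψ : coindSub N M ↦ (zNorm p z ψ 1 : M))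
        (rep_ofRep (coindRep N M) x φ)).trans ?_
      refine Eq.trans ?_ (rep_ofRep ((rep M).comp D.π) x (zNorm p z φ 1 : M)).symm
      have h1 : (zNorm p z (coindRep N M x φ) 1 : M) = zNorm p z φ x⁻¹ := by
        refine Finset.sum_congr rfl fun i _ ↦ ?_
        change φ.1 (x⁻¹ * (z⁻¹ ^ i * 1)) = φ.1 (z⁻¹ ^ i * x⁻¹)
        rw [mul_one, D.comm_inv_pow]
      refine h1.trans ((D.zNorm_eq φ x⁻¹).trans ?_)
      rw [map_inv D.π x, inv_inv]
      rfl)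
  naturality M M' f := by
    ext (φ : coindSub N M)
    exact (map_sum (linK f) (fun i ↦ φ.1 (z⁻¹ ^ i * 1)) (Finset.range p)).symm

theorem incl_comp_zSubOne : D.incl k ≫ D.zSubOne k = 0 := by
  ext M (m : M)
  refine Subtype.ext (funext fun g ↦ ?_)
  change rep M (D.π (z⁻¹ * g))⁻¹ m - rep M (D.π g)⁻¹ m = 0
  rw [map_mul, map_inv D.π z, D.π_z, inv_one, one_mul, sub_self]

theorem zSubOne_comp_normMap : D.zSubOne k ≫ D.normMap k = 0 := by
  ext M (φ : coindSub N M)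
  change ∑ i ∈ Finset.range p, (φ.1 (z⁻¹ * (z⁻¹ ^ i * 1)) - φ.1 (z⁻¹ ^ i * 1)) = (0 : M)
  rw [Finset.sum_sub_distrib, sub_eq_zero]
  refine Eq.trans ?_ (D.zNorm_z φ 1)
  refine Finset.sum_congr rfl fun i _ ↦ ?_
  rw [mul_one, mul_one, D.comm_inv_pow]

theorem mono_incl (M : ModG k N) : Mono ((D.incl k).app M) := by
  rw [FGModuleCat.mono_iff]
  intro (m : M) (m' : M) h
  have h1 : rep M (D.π 1)⁻¹ m = rep M (D.π 1)⁻¹ m' := congr_fun (congr_arg Subtype.val h) 1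
  rw [map_one, inv_one, map_one] at h1
  exact h1

theorem exact_incl (M : ModG k N) :
    (ShortComplex.mk ((D.incl k).app M) ((D.zSubOne k).app M)
      (NatTrans.congr_app (D.incl_comp_zSubOne k) M)).Exact := by
  rw [FGModuleCat.exact_iff]
  intro (φ : coindSub N M) h
  refine ⟨(φ.1 1 : M), Subtype.ext (funext fun g ↦ ?_)⟩
  refine (D.apply_eq_of_invariant φ (fun g ↦ ?_) g).symm
  exact sub_eq_zero.1 (congr_fun (congr_arg Subtype.val h) g)

variable [NeZero p]

theorem exact_zSubOne (M : ModG k N) :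
    (ShortComplex.mk ((D.zSubOne k).app M) ((D.normMap k).app M)
      (NatTrans.congr_app (D.zSubOne_comp_normMap k) M)).Exact := by
  rw [FGModuleCat.exact_iff]
  intro (φ : coindSub N M) (h : zNorm p z φ 1 = (0 : M))
  refine ⟨(⟨fun g ↦ -∑ i ∈ Finset.range (D.j g).val, φ.1 ((z⁻¹ * ·)^[i] g), fun g n ↦ ?_⟩ :
    coindSub N M), Subtype.ext (funext fun g ↦ ?_)⟩
  · change -∑ i ∈ Finset.range (D.j (g * n)).val, φ.1 ((z⁻¹ * ·)^[i] (g * n)) =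
      rep M n⁻¹ (-∑ i ∈ Finset.range (D.j g).val, φ.1 ((z⁻¹ * ·)^[i] g))
    rw [D.j_mul, map_neg, map_sum]
    congr 1
    refine Finset.sum_congr rfl fun i _ ↦ ?_
    rw [iterate_inv_mul, iterate_inv_mul, ← mul_assoc]
    exact φ.2 _ n
  · refine exists_eq_comp_sub (z⁻¹ * ·) D.j D.j_z φ.1 g ?_
    simp only [iterate_inv_mul]
    exact (D.zNorm_eq φ g).trans (by rw [h, map_zero])

theorem epi_normMap (M : ModG k N) : Epi ((D.normMap k).app M) := by
  classical
  rw [FGModuleCat.epi_iff]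
  intro (m : M)
  -- A function supported in one point of each period has a single summand in its norm.
  refine ⟨(⟨fun g ↦ if D.j g = 0 then rep M (D.π g)⁻¹ m else 0, fun g n ↦ ?_⟩ : coindSub N M), ?_⟩
  · change (if D.j (g * n) = 0 then rep M (D.π (g * n))⁻¹ m else 0) =
      rep M n⁻¹ (if D.j g = 0 then rep M (D.π g)⁻¹ m else 0)
    rw [D.j_mul]
    split_ifs
    · rw [map_mul, D.π_coe, mul_inv_rev, map_mul]
      rfl
    · rw [map_zero]
  · have hj (i : ℕ) : D.j (z⁻¹ ^ i * 1) = -i := by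
      induction i with
      | zero => simp [D.j_one]
      | succ i hi => rw [pow_succ', mul_assoc, D.j_z, hi]; push_cast; ring
    change ∑ i ∈ Finset.range p, (if D.j (z⁻¹ ^ i * 1) = 0 then
      rep M (D.π (z⁻¹ ^ i * 1))⁻¹ m else 0) = m
    rw [Finset.sum_eq_single 0]
    · rw [if_pos (by simp [D.j_one])]
      simp
    · intro i hi hi0
      rw [if_neg]
      rw [hj, neg_eq_zero, ZMod.natCast_eq_zero_iff]
      exact fun h ↦ hi0 (Nat.eq_zero_of_dvd_of_lt h (Finset.mem_range.1 hi))
    · exact fun h ↦ absurd (Finset.mem_range.2 (NeZero.pos p)) h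

/-- If `G` is the product of `N` and a cyclic group of order `p`, then a resolution `P` of the
trivial module of `N` inflates to a complex of permutation modules of `G`, quasi-isomorphic to the
trivial module of `G`. The periodic exact sequence
`0 ⟶ infl P ⟶ coind P ⟶ coind P ⟶ infl P ⟶ 0`, whose maps are the inclusion of the `z`-invariants, `z - 1` and the norm, makes it as free as `coind P`. -/
theorem resMod_triv (h : resMod k N (triv k N)) : resMod k G (triv k G) := by
  rw [resMod_iff] at h ⊢
  intro m
  obtain ⟨P, s, hP, hs⟩ := h m
  let I := (resAlong k D.π).mapHomologicalComplex (ComplexShape.up ℤ)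
  let F := (coind k N).mapHomologicalComplex (ComplexShape.up ℤ)
  let a : I ⟶ F := NatTrans.mapHomologicalComplex (D.incl k) _
  let t : F ⟶ F := NatTrans.mapHomologicalComplex (D.zSubOne k) _
  let b : F ⟶ I := NatTrans.mapHomologicalComplex (D.normMap k) _
  have w : a.app P ≫ t.app P = 0 := by
    ext i : 1
    exact NatTrans.congr_app (D.incl_comp_zSubOne k) (P.X i)
  have w' : t.app P ≫ b.app P = 0 := by
    ext i : 1
    exact NatTrans.congr_app (D.zSubOne_comp_normMap k) (P.X i)
  have h1 : Mono (a.app P) := HomologicalComplex.mono_of_mono_f _ fun i ↦ D.mono_incl k (P.X i)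
  have h2 : Epi (b.app P) := HomologicalComplex.epi_of_epi_f _ fun i ↦ D.epi_normMap k (P.X i)
  have h3 : (ShortComplex.mk _ _ w).Exact :=
    HomologicalComplex.exact_of_degreewise_exact _ fun i ↦ D.exact_incl k (P.X i)
  have h4 : (ShortComplex.mk _ _ w').Exact :=
    HomologicalComplex.exact_of_degreewise_exact _ fun i ↦ D.exact_zSubOne k (P.X i)
  have hF : IsResolving (isPerm k G) (freeG k G) m (F.obj P) :=
    hP.map _ (fun _ ↦ isPerm_coind N) (fun _ ↦ free_coind N)
  -- The inflated complex is at least free in the degrees where it vanishes, which starts the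
  -- periodic improvement.
  obtain ⟨r, hr⟩ : ∃ r, IsResolving (isPerm k G) (freeG k G) r (I.obj P) := by
    obtain ⟨_, ⟨b, hb⟩⟩ := hP.bounded
    have hP' : IsResolving (isPerm k N) (fun X ↦ IsZero X) (-b - 1) P :=
      ⟨hP.bounded, hP.prop, fun i hi ↦ P.isZero_of_isStrictlyLE b i (by lia)⟩
    refine ⟨-b - 1, hP'.map _ (fun _ ↦ isPerm_resAlong D.π) (fun X hX ↦ ?_)⟩
    exact ObjectProperty.prop_of_isZero _ (Functor.map_isZero _ hX)
  obtain ⟨Q, q, hQ, hq⟩ : HasResolution (isPerm k G) (freeG k G) m (I.obj P) := by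
    refine HasResolution.of_periodic w w' h3 h4 hF (m - r).toNat
      ⟨_, 𝟙 _, hr.mono (by lia), inferInstance⟩
  obtain ⟨e⟩ := (permOn_resAlong D.π (permOn_fnMod k (G := N) PUnit.{v + 1})).nonempty_iso
    (permOn_fnMod k (G := G) PUnit.{v + 1})
  let e' : I.obj ((CochainComplex.singleFunctor (ModG k N) 0).obj (triv k N)) ≅
      (CochainComplex.singleFunctor (ModG k G) 0).obj (triv k G) :=
    (HomologicalComplex.singleMapHomologicalComplex (resAlong k D.π) (ComplexShape.up ℤ)
      0).app (triv k N) ≪≫ (CochainComplex.singleFunctor (ModG k G) 0).mapIso e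
  have : QuasiIso (I.map s) := inferInstance
  have : QuasiIso (q ≫ I.map s) := quasiIso_comp _ _
  exact ⟨Q, (q ≫ I.map s) ≫ e'.hom, hQ, quasiIso_comp _ e'.hom⟩

end CyclicFactor

end CyclicFactor

end PermutationModules

/-! ### Cochains on a join of circles -/

namespace CircleJoin

/-- The cells of a circle with `p` points `some (false, j)` and `p` arcs `some (true, j)`, together
with the empty cell `none`. The group `ℤ/p` acts by rotation. The families `X → Cell p` are the
cells of the join of circles indexed by `X`, a sphere of dimension `2 * card X - 1`. -/
abbrev Cell (p : ℕ) := Option (Bool × ZMod p)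

namespace Cell

variable {p : ℕ}

/-- The dimension of a cell, plus one: the empty cell has dimension zero in this numbering, which
is additive for joins. -/
def dim : Cell p → ℕ
  | none => 0
  | some (false, _) => 1
  | some (true, _) => 2

/-- The rotations of the cells. -/
def rot (a : ZMod p) : Cell p → Cell p
  | none => none
  | some (b, j) => some (b, a + j)

@[simp]
theorem rot_zero (c : Cell p) : rot 0 c = c := by
  rcases c with _ | ⟨b, j⟩ <;> simp [rot]

theorem rot_rot (a b : ZMod p) (c : Cell p) : rot a (rot b c) = rot (a + b) c := by
  rcases c with _ | ⟨_, j⟩ <;> simp [rot, add_assoc]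

@[simp]
theorem dim_rot (a : ZMod p) (c : Cell p) : (rot a c).dim = c.dim := by
  rcases c with _ | ⟨_ | _, j⟩ <;> rfl

end Cell

variable {p : ℕ} {k : Type*} [Field k]

/-- `r` on the odd cells and `1` on the even cells. -/
def weight (r : k) (c : Cell p) : k := if c.dim = 1 then r else 1

/-- An operator on the functions on the cells is odd if it anticommutes with the sign which is `-1`
on the odd cells. The sign is an arbitrary square root `r` of `1`, with `r = 1` imposing no
condition, since the signs of a product of operators are governed by `ρ x y = ± 1`. -/
def IsOdd (T : (Cell p → k) →ₗ[k] (Cell p → k)) : Prop :=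
  ∀ (r : k), r * r = 1 → ∀ (f : Cell p → k) (c : Cell p),
    T (fun c ↦ weight r c * f c) c = r * (weight r c * T f c)

/-- The differential of the augmented cochain complex of the circle. There are no cells below the
empty one, so that the coboundaries vanish there. -/
def D : (Cell p → k) →ₗ[k] (Cell p → k) where
  toFun f c := match c with
    | none => 0
    | some (false, _) => f none
    | some (true, j) => f (some (false, j)) - f (some (false, j + 1))
  map_add' f g := by
    ext (_ | ⟨_ | _, j⟩) <;> simp [add_sub_add_comm]
  map_smul' a f := by
    ext (_ | ⟨_ | _, j⟩) <;> simp [mul_sub]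

/-- A homotopy from the operator `Q` to the identity. On points it takes minus the sum over the
arcs between the origin and the point. -/
def h : (Cell p → k) →ₗ[k] (Cell p → k) where
  toFun f c := match c with
    | none => f (some (false, 0))
    | some (false, j) => -∑ i ∈ Finset.range j.val, f (some (true, (i : ZMod p)))
    | some (true, _) => 0
  map_add' f g := by
    ext (_ | ⟨_ | _, j⟩) <;> simp [Finset.sum_add_distrib, add_comm]
  map_smul' a f := by
    ext (_ | ⟨_ | _, j⟩) <;> simp [Finset.mul_sum]

/-- The operator which concentrates functions in the last arc, retaining the sum over the arcs. It
is the projection to the reduced cohomology of the circle. -/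
def Q [NeZero p] : (Cell p → k) →ₗ[k] (Cell p → k) where
  toFun f c := if c = some (true, -1) then ∑ i : ZMod p, f (some (true, i)) else 0
  map_add' f g := by
    ext c
    simp only [Pi.add_apply, Finset.sum_add_distrib]
    split_ifs <;> simp
  map_smul' a f := by
    ext c
    simp only [Pi.smul_apply, smul_eq_mul, ← Finset.mul_sum, RingHom.id_apply, mul_ite, mul_zero]

theorem isOdd_D : IsOdd (D (p := p) (k := k)) := by
  rintro r hr f (_ | ⟨_ | _, j⟩)
  · simp [D]
  · simp [D, weight, Cell.dim, ← mul_assoc, hr]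
  · simp [D, weight, Cell.dim, mul_sub]

theorem isOdd_h : IsOdd (h (p := p) (k := k)) := by
  rintro r hr f (_ | ⟨_ | _, j⟩)
  · simp [h, weight, Cell.dim]
  · simp [h, weight, Cell.dim, ← mul_assoc, hr]
  · simp [h]

theorem D_D (f : Cell p → k) : D (D f) = 0 := by
  ext (_ | ⟨_ | _, j⟩) <;> simp [D]

theorem D_rot (a : ZMod p) (f : Cell p → k) (c : Cell p) :
    D (fun c ↦ f (c.rot a)) c = D f (c.rot a) := by
  rcases c with _ | ⟨_ | _, j⟩ <;> simp [D, Cell.rot, add_assoc]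

/-- The augmented cochain complex of the circle has cohomology `k`, on the arcs. -/
theorem D_h_add_h_D [NeZero p] (f : Cell p → k) : D (h f) + h (D f) = f - Q f := by
  ext (_ | ⟨_ | _, j⟩)
  · simp [D, h, Q]
  · have := Finset.sum_range_sub' (fun i : ℕ ↦ f (some (false, (i : ZMod p)))) j.val
    simp only [Nat.cast_succ, Nat.cast_zero, ZMod.natCast_val, ZMod.cast_id'] at this
    simp only [D, h, Q, LinearMap.coe_mk, AddHom.coe_mk, Pi.add_apply, Pi.sub_apply, this]
    simp
  · obtain ⟨n, rfl⟩ : ∃ n, p = n + 1 := ⟨p - 1, (Nat.succ_pred (NeZero.ne p)).symm⟩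
    have hsum : ∑ i : ZMod (n + 1), f (some (true, i)) =
        ∑ i ∈ Finset.range (n + 1), f (some (true, (i : ZMod (n + 1)))) := by
      rw [Finset.sum_range]
      exact Finset.sum_congr rfl fun i _ ↦ by
        congr 3
        exact (Fin.cast_val_eq_self i).symm
    simp only [D, h, Q, LinearMap.coe_mk, AddHom.coe_mk, Pi.add_apply, Pi.sub_apply, add_zero,
      Option.some.injEq, Prod.mk.injEq, true_and, sub_neg_eq_add]
    split_ifs with hj
    · subst hj
      rw [neg_add_cancel, ZMod.val_zero, Finset.sum_range_zero, ZMod.val_neg_one, hsum,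
        Finset.sum_range_succ]
      have : ((n : ℕ) : ZMod (n + 1)) = -1 := by
        rw [eq_neg_iff_add_eq_zero]
        exact_mod_cast ZMod.natCast_self (n + 1)
      rw [this]
      ring
    · have hj' : (j + 1).val = j.val + 1 := by
        rw [ZMod.val_add, ZMod.val_one_eq_one_mod, Nat.add_mod_mod, Nat.mod_eq_of_lt]
        refine Nat.succ_lt_succ
          (lt_of_le_of_ne (Nat.lt_succ_iff.1 (ZMod.val_lt j)) fun h ↦ hj ?_)
        apply ZMod.val_injective
        rw [h, ZMod.val_neg_one]
      rw [hj', Finset.sum_range_succ]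
      simp

variable {X : Type*} [DecidableEq X]

/-- The operator on the functions on the families of cells by which `T` acts in one factor. -/
def loc (T : (Cell p → k) →ₗ[k] (Cell p → k)) (x : X) :
    ((X → Cell p) → k) →ₗ[k] ((X → Cell p) → k) where
  toFun f c := T (fun κ ↦ f (Function.update c x κ)) (c x)
  map_add' f g := by
    ext c
    exact congr_fun (map_add T (fun κ ↦ f (Function.update c x κ))
      (fun κ ↦ g (Function.update c x κ))) (c x)
  map_smul' a f := by
    ext c
    exact congr_fun (map_smul T a (fun κ ↦ f (Function.update c x κ))) (c x)

theorem loc_apply (T : (Cell p → k) →ₗ[k] (Cell p → k)) (x : X) (f : (X → Cell p) → k)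
    (c : X → Cell p) : loc T x f c = T (fun κ ↦ f (Function.update c x κ)) (c x) := rfl

theorem loc_loc (T S : (Cell p → k) →ₗ[k] (Cell p → k)) (x : X) (f : (X → Cell p) → k) :
    loc T x (loc S x f) = loc (T ∘ₗ S) x f := by
  ext c
  simp only [loc_apply, Function.update_idem, Function.update_self, LinearMap.comp_apply]

theorem loc_comm [NeZero p] (T S : (Cell p → k) →ₗ[k] (Cell p → k)) {x y : X} (hxy : x ≠ y)
    (f : (X → Cell p) → k) : loc T x (loc S y f) = loc S y (loc T x f) := by
  ext c
  simp only [loc_apply, Function.update_of_ne hxy.symm, Function.update_of_ne hxy]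
  rw [T.pi_apply_eq_sum_univ, S.pi_apply_eq_sum_univ]
  simp_rw [fun κ ↦ S.pi_apply_eq_sum_univ
      (fun κ' ↦ f (Function.update (Function.update c x κ) y κ')),
    fun κ ↦ T.pi_apply_eq_sum_univ (fun κ' ↦ f (Function.update (Function.update c y κ) x κ'))]
  simp only [Finset.sum_apply, Pi.smul_apply, smul_eq_mul, Finset.sum_mul]
  rw [Finset.sum_comm]
  refine Finset.sum_congr rfl fun κ _ ↦ Finset.sum_congr rfl fun κ' _ ↦ ?_
  rw [Function.update_comm hxy]
  ring

variable [Fintype X] (ρ : X → X → k)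

/-- The sign of the factor `x`: the product of the signs `ρ y x` over the odd factors `y ≠ x`. -/
def sgn (x : X) (c : X → Cell p) : k := ∏ y ∈ Finset.univ.erase x, weight (ρ y x) (c y)

theorem sgn_update_self (x : X) (c : X → Cell p) (κ : Cell p) :
    sgn ρ x (Function.update c x κ) = sgn ρ x c :=
  Finset.prod_congr rfl fun y hy ↦ by rw [Function.update_of_ne (Finset.ne_of_mem_erase hy)]

theorem sgn_update {x y : X} (hxy : x ≠ y) (c : X → Cell p) (κ : Cell p) :
    sgn ρ y (Function.update c x κ) = weight (ρ x y) κ *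
      ∏ y' ∈ (Finset.univ.erase y).erase x, weight (ρ y' y) (c y') := by
  rw [sgn, ← Finset.mul_prod_erase _ _ (Finset.mem_erase.2 ⟨hxy, Finset.mem_univ x⟩),
    Function.update_self]
  congr 1
  exact Finset.prod_congr rfl fun y' hy ↦ by rw [Function.update_of_ne (Finset.ne_of_mem_erase hy)]

theorem sgn_mul_self (hρ : ∀ x y, ρ x y * ρ x y = 1) (x : X) (c : X → Cell p) :
    sgn ρ x c * sgn ρ x c = 1 := by
  rw [sgn, ← Finset.prod_mul_distrib]
  refine Finset.prod_eq_one fun y _ ↦ ?_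
  rw [weight]
  split_ifs
  · exact hρ y x
  · rw [one_mul]

theorem isOdd_sgn_update {T : (Cell p → k) →ₗ[k] (Cell p → k)} (hT : IsOdd T)
    (hρ : ∀ x y, ρ x y * ρ x y = 1) {x y : X} (hxy : x ≠ y) (c : X → Cell p) (f : Cell p → k) :
    T (fun κ ↦ sgn ρ y (Function.update c x κ) * f κ) (c x) =
      ρ x y * (sgn ρ y c * T f (c x)) := by
  have h1 := sgn_update ρ hxy c (c x)
  rw [Function.update_eq_self] at h1
  simp_rw [h1, sgn_update ρ hxy, mul_assoc]
  rw [hT _ (hρ x y)]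
  have h2 := congr_fun (map_smul T (∏ y' ∈ (Finset.univ.erase y).erase x, weight (ρ y' y) (c y')) f)
    (c x)
  simp only [Pi.smul_apply, smul_eq_mul] at h2
  change ρ x y * (weight _ _ * T ((∏ y' ∈ (Finset.univ.erase y).erase x, weight (ρ y' y) (c y')) • f)
    (c x)) = _
  rw [← h2]

/-- The action of an operator in one factor, with a sign. -/
def op (T : (Cell p → k) →ₗ[k] (Cell p → k)) (x : X) :
    ((X → Cell p) → k) →ₗ[k] ((X → Cell p) → k) where
  toFun f c := sgn ρ x c * loc T x f c
  map_add' f g := by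
    ext c
    rw [map_add]
    exact mul_add _ _ _
  map_smul' a f := by
    ext c
    rw [map_smul]
    exact mul_left_comm _ _ _

theorem op_apply (T : (Cell p → k) →ₗ[k] (Cell p → k)) (x : X) (f : (X → Cell p) → k)
    (c : X → Cell p) : op ρ T x f c = sgn ρ x c * T (fun κ ↦ f (Function.update c x κ)) (c x) := rfl

theorem op_op_self (hρ : ∀ x y, ρ x y * ρ x y = 1) (T S : (Cell p → k) →ₗ[k] (Cell p → k)) (x : X)
    (f : (X → Cell p) → k) : op ρ T x (op ρ S x f) = loc (T ∘ₗ S) x f := by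
  rw [← loc_loc]
  ext c
  rw [op_apply]
  have h1 : (fun κ ↦ op ρ S x f (Function.update c x κ)) =
      sgn ρ x c • fun κ ↦ loc S x f (Function.update c x κ) := by
    ext κ
    change sgn ρ x _ * _ = sgn ρ x c * _
    rw [sgn_update_self]
  rw [h1, map_smul, Pi.smul_apply, smul_eq_mul, ← mul_assoc, sgn_mul_self ρ hρ, one_mul]
  rfl

/-- Moving an odd operator in the factor `x` past the sign of the factor `y` gives `ρ x y`. -/
theorem op_op {T : (Cell p → k) →ₗ[k] (Cell p → k)} (hT : IsOdd T)
    (hρ : ∀ x y, ρ x y * ρ x y = 1) (S : (Cell p → k) →ₗ[k] (Cell p → k)) {x y : X} (hxy : x ≠ y)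
    (f : (X → Cell p) → k) (c : X → Cell p) :
    op ρ T x (op ρ S y f) c = ρ x y * (sgn ρ x c * sgn ρ y c * loc T x (loc S y f) c) := by
  rw [op_apply]
  change sgn ρ x c * T (fun κ ↦ sgn ρ y (Function.update c x κ) *
    loc S y f (Function.update c x κ)) (c x) = _
  rw [isOdd_sgn_update ρ hT hρ hxy]
  change sgn ρ x c * (ρ x y * (sgn ρ y c * loc T x (loc S y f) c)) = _
  ring

/-- The actions of odd operators in different factors anticommute. -/
theorem op_anticomm [NeZero p] {T S : (Cell p → k) →ₗ[k] (Cell p → k)} (hT : IsOdd T) (hS : IsOdd S)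
    (hρ : ∀ x y, ρ x y * ρ x y = 1) (hρ' : ∀ x y, x ≠ y → ρ x y = -ρ y x) {x y : X} (hxy : x ≠ y)
    (f : (X → Cell p) → k) : op ρ T x (op ρ S y f) = -op ρ S y (op ρ T x f) := by
  ext c
  rw [Pi.neg_apply, op_op ρ hT hρ S hxy, op_op ρ hS hρ T hxy.symm, loc_comm T S hxy, hρ' x y hxy]
  ring

/-- The differential on the functions on the families of cells: the augmented cochain complex of the
join of the circles. The signs `ρ` play the role of a total order of the factors, but may be chosen
to be invariant under a group which permutes them. -/
def d : ((X → Cell p) → k) →ₗ[k] ((X → Cell p) → k) := ∑ x, op ρ D x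

theorem d_apply (f : (X → Cell p) → k) : d ρ f = ∑ x, op ρ D x f := by
  rw [d, LinearMap.sum_apply]

variable (hρ : ∀ x y, ρ x y * ρ x y = 1) (hρ' : ∀ x y, x ≠ y → ρ x y = -ρ y x)

include hρ hρ'

/-- The homotopy `h` in one factor, as a homotopy of the augmented complex of the join. -/
theorem d_op_h [NeZero p] (x : X) (f : (X → Cell p) → k) :
    d ρ (op ρ h x f) + op ρ h x (d ρ f) = f - loc Q x f := by
  rw [d_apply, d_apply, map_sum, ← Finset.sum_add_distrib, Finset.sum_eq_single x]
  · rw [op_op_self ρ hρ, op_op_self ρ hρ]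
    ext c
    have h1 := congr_fun (D_h_add_h_D (fun κ ↦ f (Function.update c x κ))) (c x)
    simp only [Pi.add_apply, Pi.sub_apply, Function.update_eq_self] at h1
    exact h1
  · intro y _ hy
    rw [op_anticomm ρ isOdd_D isOdd_h hρ hρ' hy, neg_add_cancel]
  · exact fun h ↦ absurd (Finset.mem_univ x) h

omit hρ hρ' in
/-- The double sum of an alternating function vanishes, also in characteristic two. -/
theorem two_sum_eq_zero {V : Type*} [AddCommGroup V] (F : X → X → V) (h₁ : ∀ x, F x x = 0)
    (h₂ : ∀ x y, x ≠ y → F x y = -F y x) : ∑ x, ∑ y, F x y = 0 := by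
  rw [← Finset.sum_product']
  refine Finset.sum_involution (fun a _ ↦ (a.2, a.1)) ?_ ?_ ?_ ?_
  · rintro ⟨x, y⟩ _
    by_cases hxy : x = y
    · subst hxy
      rw [h₁, add_zero]
    · rw [h₂ x y hxy, neg_add_cancel]
  · rintro ⟨x, y⟩ _ h h'
    obtain rfl : y = x := congr_arg Prod.fst h'
    exact h (h₁ _)
  · simp
  · simp

theorem d_d [NeZero p] (f : (X → Cell p) → k) : d ρ (d ρ f) = 0 := by
  simp only [d_apply, map_sum]
  refine two_sum_eq_zero _ (fun x ↦ ?_) (fun x y hxy ↦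
    op_anticomm ρ isOdd_D isOdd_D hρ hρ' hxy.symm f)
  rw [op_op_self ρ hρ]
  ext c
  exact congr_fun (D_D _) _

omit hρ hρ'

/-- The sum of the values of a function on the families of arcs. -/
def ε [NeZero p] (f : (X → Cell p) → k) : k := ∑ c : X → ZMod p, f fun x ↦ some (true, c x)

/-- The sum over the top-dimensional cells vanishes on coboundaries, as each cell of codimension one
is a face of two of them, with opposite signs. -/
theorem ε_d [NeZero p] (f : (X → Cell p) → k) : ε (d ρ f) = 0 := by
  unfold ε
  simp only [d_apply, Finset.sum_apply]
  rw [Finset.sum_comm]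
  refine Finset.sum_eq_zero fun x _ ↦ ?_
  have hs (c : X → ZMod p) : sgn ρ x (fun x ↦ (some (true, c x) : Cell p)) = 1 :=
    Finset.prod_eq_one fun _ _ ↦ rfl
  simp only [op_apply, hs, one_mul]
  have h1 (c : X → ZMod p) (κ : Cell p) :
      D (fun κ ↦ f (Function.update (fun x ↦ some (true, c x)) x κ)) (some (true, c x)) =
      f (Function.update (fun x ↦ some (true, c x)) x (some (false, c x))) -
        f (Function.update (fun x ↦ some (true, c x)) x (some (false, c x + 1))) := rfl
  simp only [h1 _ none, Finset.sum_sub_distrib]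
  rw [sub_eq_zero, ← Equiv.sum_comp (Equiv.addRight (Pi.single x (1 : ZMod p)))]
  refine Finset.sum_congr rfl fun c _ ↦ ?_
  congr 1
  ext y : 1
  by_cases hy : y = x
  · subst hy
    simp
  · simp [hy]

include hρ hρ'

/-- The augmented cochain complex of the join of circles is exact up to the class in the top degree
which is detected by `ε`. -/
theorem exists_d_eq [NeZero p] (f : (X → Cell p) → k) (hf : d ρ f = 0) (hf' : ε f = 0) :
    ∃ g, d ρ g = f := by
  -- Up to coboundaries, `f` is supported on the families with the last arc in all factors of `S`.
  have H (S : Finset X) : ∃ g : (X → Cell p) → k, ∀ c : X → Cell p,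
      (∃ x ∈ S, c x ≠ some (true, -1)) → (f - d ρ g) c = 0 := by
    induction S using Finset.induction_on with
    | empty => exact ⟨0, by simp⟩
    | insert x S hx hS =>
      obtain ⟨g, hg⟩ := hS
      have h1 : d ρ (f - d ρ g) = 0 := by rw [map_sub, hf, d_d ρ hρ hρ', sub_zero]
      have h2 := d_op_h ρ hρ hρ' x (f - d ρ g)
      rw [h1, map_zero, add_zero] at h2
      refine ⟨g + op ρ h x (f - d ρ g), fun c hc ↦ ?_⟩
      rw [map_add, h2]
      have h3 : f - (d ρ g + (f - d ρ g - loc Q x (f - d ρ g))) = loc Q x (f - d ρ g) := by abel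
      rw [h3, loc_apply]
      change ite _ _ _ = _
      split_ifs with hcx
      · refine Finset.sum_eq_zero fun i _ ↦ hg _ ?_
        obtain ⟨y, hy, hcy⟩ := hc
        have hyx : y ≠ x := fun h ↦ hcy (h ▸ hcx)
        exact ⟨y, (Finset.mem_insert.1 hy).resolve_left hyx, by rwa [Function.update_of_ne hyx]⟩
      · rfl
  -- What remains is a multiple of an indicator function, and the multiple is given by `ε`.
  obtain ⟨g, hg⟩ := H Finset.univ
  refine ⟨g, ?_⟩
  rw [eq_comm, ← sub_eq_zero]
  have h1 : ε (f - d ρ g) = 0 := by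
    have h2 : ε (f - d ρ g) = ε f - ε (d ρ g) := Finset.sum_sub_distrib _ _
    rw [h2, hf', ε_d, sub_zero]
  ext c
  by_cases hc : ∃ x ∈ Finset.univ, c x ≠ some (true, -1)
  · exact hg c hc
  · have hc' : c = fun _ ↦ some (true, -1) := by
      ext x : 1
      by_contra h
      exact hc ⟨x, Finset.mem_univ x, h⟩
    subst hc'
    refine Eq.trans ?_ h1
    rw [ε, Finset.sum_eq_single (fun _ ↦ -1)]
    · intro c' _ hc'
      refine hg _ ?_
      by_contra! h
      exact hc' (funext fun x ↦ (Prod.ext_iff.1 (Option.some.inj (h x (Finset.mem_univ x)))).2)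
    · exact fun h ↦ absurd (Finset.mem_univ _) h

end CircleJoin

/-! ### The group action on a join of circles -/

namespace CircleJoin

open Cell

section Degree

variable {p : ℕ} {k : Type*} [Field k] {X : Type*} [Fintype X]

/-- The dimension of a family of cells, as a cell of the join, plus one. -/
def deg (c : X → Cell p) : ℕ := ∑ x, (c x).dim

theorem deg_eq_zero_iff (c : X → Cell p) : deg c = 0 ↔ c = fun _ ↦ none := by
  rw [deg, Finset.sum_eq_zero_iff, funext_iff]
  refine ⟨fun h x ↦ ?_, fun h x _ ↦ by rw [h]; rfl⟩
  have := h x (Finset.mem_univ x)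
  rcases hx : c x with _ | ⟨_ | _, j⟩
  · rfl
  · rw [hx] at this
    exact absurd this one_ne_zero
  · rw [hx] at this
    exact absurd this two_ne_zero

theorem dim_le (c : Cell p) : c.dim ≤ 2 := by
  rcases c with _ | ⟨_ | _, j⟩ <;> simp [dim]

theorem deg_le (c : X → Cell p) : deg c ≤ 2 * Fintype.card X := by
  refine (Finset.sum_le_card_nsmul _ _ 2 fun x _ ↦ dim_le (c x)).trans ?_
  rw [Finset.card_univ, smul_eq_mul, mul_comm]

theorem deg_eq_iff (c : X → Cell p) :
    deg c = 2 * Fintype.card X ↔ ∃ f : X → ZMod p, c = fun x ↦ some (true, f x) := by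
  have h1 : 2 * Fintype.card X = ∑ _x : X, 2 := by simp [mul_comm]
  rw [h1, deg, Finset.sum_eq_sum_iff_of_le fun x _ ↦ dim_le (c x)]
  constructor
  · intro h
    have h2 (x : X) : ∃ j, c x = some (true, j) := by
      have := h x (Finset.mem_univ x)
      rcases hx : c x with _ | ⟨_ | _, j⟩
      · rw [hx] at this
        exact absurd this (by simp [dim])
      · rw [hx] at this
        exact absurd this (by simp [dim])
      · exact ⟨j, rfl⟩
    choose f hf using h2
    exact ⟨f, funext hf⟩
  · rintro ⟨f, rfl⟩ x _
    rfl

variable [DecidableEq X]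

theorem deg_update (c : X → Cell p) (x : X) (κ : Cell p) :
    deg (Function.update c x κ) + (c x).dim = deg c + κ.dim := by
  rw [deg, deg, ← Finset.add_sum_erase _ _ (Finset.mem_univ x),
    ← Finset.add_sum_erase (Finset.univ) (fun x ↦ (c x).dim) (Finset.mem_univ x),
    Function.update_self, Finset.sum_congr rfl (fun y hy ↦ by
      rw [Function.update_of_ne (Finset.ne_of_mem_erase hy)])]
  ring

/-- The differential raises the dimension by one. -/
theorem d_eq_zero (ρ : X → X → k) (f : (X → Cell p) → k) (c : X → Cell p)
    (hf : ∀ c', deg c' + 1 = deg c → f c' = 0) : d ρ f c = 0 := by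
  rw [d_apply, Finset.sum_apply]
  refine Finset.sum_eq_zero fun x _ ↦ ?_
  rw [op_apply]
  refine mul_eq_zero_of_right _ ?_
  have h1 (κ : Cell p) (hκ : κ.dim + 1 = (c x).dim) : f (Function.update c x κ) = 0 :=
    hf _ (by have := deg_update c x κ; lia)
  rcases hx : c x with _ | ⟨_ | _, j⟩
  · rfl
  · exact h1 _ (by rw [hx]; rfl)
  · change f _ - f _ = 0
    rw [h1 _ (by rw [hx]; rfl), h1 _ (by rw [hx]; rfl), sub_zero]

end Degree

variable (p : ℕ) (G : Type v) [Group G] (X : Type v) [MulAction G X]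

/-- A cocycle on `G` with values in the functions from `X` to `ℤ/p`, which makes `G` act on the
products over `X` of cells, by permutations and rotations of the factors. -/
structure Cocycle where
  /-- The rotation from the factor `x` to the factor `g • x`. -/
  a : G → X → ZMod p
  a_mul : ∀ g h x, a (g * h) x = a g (h • x) + a h x

variable {p G X} (A : Cocycle p G X)

theorem Cocycle.a_one (x : X) : A.a 1 x = 0 := by
  have := A.a_mul 1 1 x
  rw [one_mul, one_smul] at this
  exact left_eq_add.1 this

/-- The action of `G` on the families of cells which is given by a cocycle. -/
def Cocycle.act (g : G) (c : X → Cell p) : X → Cell p :=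
  fun y ↦ rot (A.a g (g⁻¹ • y)) (c (g⁻¹ • y))

theorem act_one (c : X → Cell p) : A.act 1 c = c := by
  ext y : 1
  rw [Cocycle.act, A.a_one, rot_zero, inv_one, one_smul]

theorem act_mul (g h : G) (c : X → Cell p) : A.act (g * h) c = A.act g (A.act h c) := by
  ext y : 1
  simp only [Cocycle.act, rot_rot, A.a_mul, mul_inv_rev, mul_smul, smul_inv_smul]

theorem act_apply_smul (g : G) (c : X → Cell p) (y : X) :
    A.act g c (g • y) = rot (A.a g y) (c y) := by
  rw [Cocycle.act, inv_smul_smul]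

theorem deg_act [Fintype X] (g : G) (c : X → Cell p) : deg (A.act g c) = deg c := by
  unfold deg
  rw [← Equiv.sum_comp (MulAction.toPerm g)]
  refine Finset.sum_congr rfl fun y _ ↦ ?_
  rw [MulAction.toPerm_apply, act_apply_smul, dim_rot]

section

variable [Fintype X] [DecidableEq X] {k : Type u} [Field k] {ρ : X → X → k}
  (hρ : ∀ (g : G) x y, ρ (g • x) (g • y) = ρ x y)

include hρ in
theorem sgn_act (g : G) (c : X → Cell p) (x : X) : sgn ρ (g • x) (A.act g c) = sgn ρ x c := by
  unfold sgn
  refine (Finset.prod_equiv (MulAction.toPerm g) (fun y ↦ ?_) fun y _ ↦ ?_).symm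
  · simp
  · rw [MulAction.toPerm_apply, act_apply_smul, hρ, weight, weight, dim_rot]

omit [Fintype X] in
theorem update_act (g : G) (c : X → Cell p) (x : X) (κ : Cell p) :
    Function.update (A.act g c) (g • x) (rot (A.a g x) κ) = A.act g (Function.update c x κ) := by
  ext y : 1
  obtain ⟨y, rfl⟩ := MulAction.surjective g y
  dsimp only
  rw [act_apply_smul]
  by_cases h : y = x
  · subst h
    rw [Function.update_self, Function.update_self]
  · rw [Function.update_of_ne ((MulAction.injective g).ne h), Function.update_of_ne h,
      act_apply_smul]

include hρ in
theorem d_act (g : G) (f : (X → Cell p) → k) (c : X → Cell p) :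
    d ρ (fun c ↦ f (A.act g c)) c = d ρ f (A.act g c) := by
  rw [d_apply, d_apply, Finset.sum_apply, Finset.sum_apply,
    ← Equiv.sum_comp (MulAction.toPerm g) (fun x ↦ op ρ D x f (A.act g c))]
  refine Finset.sum_congr rfl fun x _ ↦ ?_
  rw [MulAction.toPerm_apply, op_apply, op_apply, sgn_act A hρ, act_apply_smul, ← D_rot]
  simp only [update_act]

end

theorem ε_act [NeZero p] [Fintype X] [DecidableEq X] {k : Type u} [Field k] (g : G)
    (f : (X → Cell p) → k) : ε (fun c ↦ f (A.act g c)) = ε f := by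
  unfold ε
  let σ : Equiv.Perm (X → ZMod p) :=
    { toFun := fun c y ↦ A.a g (g⁻¹ • y) + c (g⁻¹ • y)
      invFun := fun c y ↦ -A.a g y + c (g • y)
      left_inv := fun c ↦ by
        ext y
        simp
      right_inv := fun c ↦ by
        ext y
        simp }
  exact Equiv.sum_comp σ (fun c ↦ f fun x ↦ some (true, c x))

variable [Fintype X]

/-- The families of cells with `deg = i + 1`, that is the cells of dimension `i` of the join. The
empty cell is excluded, so that there is none for `i = -1`. -/
@[ext]
structure GradedCells (_ : Cocycle p G X) (i : ℤ) where
  /-- The underlying family of cells. -/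
  val : X → Cell p
  deg_eq : (deg val : ℤ) = i + 1
  deg_ne : deg val ≠ 0

instance (i : ℤ) : MulAction G (GradedCells A i) where
  smul g c := ⟨A.act g c.val, by rw [deg_act, c.deg_eq], by rw [deg_act]; exact c.deg_ne⟩
  one_smul c := GradedCells.ext (act_one A c.val)
  mul_smul g h c := GradedCells.ext (act_mul A g h c.val)

theorem val_smul {i : ℤ} (g : G) (c : GradedCells A i) : (g • c).val = A.act g c.val := rfl

instance [NeZero p] (i : ℤ) : Finite (GradedCells A i) :=
  Finite.of_injective GradedCells.val fun _ _ ↦ GradedCells.ext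

variable {k : Type u} [Field k]

open Classical in
/-- The extension by zero of a function on the cells of dimension `i` of the join. -/
noncomputable def ext (i : ℤ) : (GradedCells A i → k) →ₗ[k] ((X → Cell p) → k) where
  toFun f c := if h : (deg c : ℤ) = i + 1 ∧ deg c ≠ 0 then f ⟨c, h.1, h.2⟩ else 0
  map_add' f g := by
    ext c
    by_cases h : (deg c : ℤ) = i + 1 ∧ deg c ≠ 0 <;> simp [h]
  map_smul' a f := by
    ext c
    by_cases h : (deg c : ℤ) = i + 1 ∧ deg c ≠ 0 <;> simp [h]

theorem ext_val {i : ℤ} (f : GradedCells A i → k) (c : GradedCells A i) :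
    ext A i f c.val = f c := dif_pos ⟨c.deg_eq, c.deg_ne⟩

theorem ext_eq_zero {i : ℤ} (f : GradedCells A i → k) {c : X → Cell p}
    (h : ¬((deg c : ℤ) = i + 1 ∧ deg c ≠ 0)) : ext A i f c = 0 := dif_neg h

theorem ext_act {i : ℤ} (f : GradedCells A i → k) (g : G) (c : X → Cell p) :
    ext A i (fun c ↦ f (g • c)) c = ext A i f (A.act g c) := by
  by_cases h : (deg c : ℤ) = i + 1 ∧ deg c ≠ 0
  · exact (ext_val A (fun c ↦ f (g • c)) ⟨c, h.1, h.2⟩).trans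
      (ext_val A f (g • ⟨c, h.1, h.2⟩)).symm
  · rw [ext_eq_zero A _ h, ext_eq_zero A]
    rwa [deg_act]

/-- The restriction of a function to the cells of dimension `i` of the join. -/
def res (i : ℤ) : ((X → Cell p) → k) →ₗ[k] (GradedCells A i → k) :=
  LinearMap.funLeft k k GradedCells.val

theorem res_apply {i : ℤ} (f : (X → Cell p) → k) (c : GradedCells A i) :
    res A i f c = f c.val := rfl

variable [DecidableEq X] (ρ : X → X → k)

theorem res_d_ext {i j : ℤ} (hij : i + 1 ≠ j) (f : GradedCells A i → k) :
    res A j (d ρ (ext A i f)) = 0 := by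
  ext c
  refine d_eq_zero ρ _ c.val fun c' hc' ↦ ext_eq_zero A f fun h ↦ ?_
  have := c.deg_eq
  lia

theorem ext_res_d_ext {i j : ℤ} (hij : i + 1 = j) (f : GradedCells A i → k) :
    ext A j (res A j (d ρ (ext A i f))) = d ρ (ext A i f) := by
  ext c
  by_cases h : (deg c : ℤ) = j + 1 ∧ deg c ≠ 0
  · exact dif_pos h
  · rw [ext_eq_zero A _ h]
    refine (d_eq_zero ρ _ c fun c' hc' ↦ ext_eq_zero A f fun h' ↦ h ?_).symm
    lia

end CircleJoin

/-! ### The complex of modules of cochains -/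

namespace PermutationModules

open BoundedHomotopy

section FnHom

variable {k : Type u} [Field k] {G : Type v} [Group G]

attribute [local instance] moduleK

variable (k G) in
/-- The elements of a module of functions, as functions. -/
noncomputable def fnEquiv (Ω : Type v) [Finite Ω] [MulAction G Ω] :
    fnMod k (G := G) Ω ≃ₗ[k] (Ω → k) where
  toFun f := f
  map_add' _ _ := rfl
  map_smul' c f := smul_ofRep (fnRep k Ω) c f
  invFun f := f
  left_inv _ := rfl
  right_inv _ := rfl

variable {Ω Ω' : Type v} [Finite Ω] [MulAction G Ω] [Finite Ω'] [MulAction G Ω']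

theorem fnEquiv_rep (g : G) (m : fnMod k (G := G) Ω) (ω : Ω) :
    fnEquiv k G Ω (rep _ g m) ω = fnEquiv k G Ω m (g⁻¹ • ω) :=
  congr_fun (rep_ofRep (fnRep k Ω) g m) ω

/-- An equivariant map between modules of functions. -/
noncomputable def fnHom (T : (Ω → k) →ₗ[k] (Ω' → k))
    (hT : ∀ (g : G) f ω, T (fun ω ↦ f (g • ω)) ω = T f (g • ω)) :
    fnMod k (G := G) Ω ⟶ fnMod k (G := G) Ω' :=
  homMk ((fnEquiv k G Ω').symm.toLinearMap ∘ₗ T ∘ₗ (fnEquiv k G Ω).toLinearMap) fun g m ↦ by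
    apply (fnEquiv k G Ω').injective
    ext ω
    rw [fnEquiv_rep]
    simp only [LinearMap.comp_apply, LinearEquiv.coe_coe, LinearEquiv.apply_symm_apply]
    rw [← hT]
    exact congr_fun (congr_arg T (funext fun ω ↦ fnEquiv_rep g m ω)) ω

theorem fnEquiv_fnHom (T : (Ω → k) →ₗ[k] (Ω' → k))
    (hT : ∀ (g : G) f ω, T (fun ω ↦ f (g • ω)) ω = T f (g • ω)) (m : fnMod k (G := G) Ω) :
    fnEquiv k G Ω' ((fnHom T hT).hom.hom m) = T (fnEquiv k G Ω m) := rfl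

theorem fnMod_hom_ext {M : ModG k G} {f g : M ⟶ fnMod k (G := G) Ω}
    (h : ∀ m, fnEquiv k G Ω (f.hom.hom m) = fnEquiv k G Ω (g.hom.hom m)) : f = g := by
  ext m
  exact (fnEquiv k G Ω).injective (h m)

end FnHom

section Central

variable {k : Type u} [Field k] {G : Type v} [Group G]

attribute [local instance] moduleK

/-- The action of a central element on a complex of modules. -/
noncomputable def zMap (z : G) (hz : ∀ g, z * g = g * z) (K : CochainComplex (ModG k G) ℤ) :
    End K where
  f i := homMk (rep (K.X i) z) fun g m ↦ by
    rw [← Module.End.mul_apply, ← Module.End.mul_apply, ← map_mul, ← map_mul, hz]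
  comm' i j _ := by
    ext m
    exact map_rep (K.d i j) z m

variable {z : G} (hz : ∀ g, z * g = g * z) (K : CochainComplex (ModG k G) ℤ)

theorem zMap_pow_apply (n : ℕ) (i : ℤ) (m : K.X i) :
    (((zMap z hz K) ^ n : End K).f i).hom.hom m = rep (K.X i) (z ^ n) m := by
  induction n with
  | zero => rw [pow_zero, pow_zero, map_one]; rfl
  | succ n hn =>
    rw [pow_succ', pow_succ', map_mul, Module.End.mul_apply, ← hn]
    rfl

/-- The endomorphism `z - 1` of a complex. -/
noncomputable def zSub : K ⟶ K := (zMap z hz K - 1 : End K)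

/-- The endomorphism `1 + z + ⋯ + z ^ (p - 1)` of a complex. -/
noncomputable def zSum (p : ℕ) : K ⟶ K := (∑ i ∈ Finset.range p, (zMap z hz K) ^ i : End K)

theorem zSub_apply (i : ℤ) (m : K.X i) :
    ((zSub hz K).f i).hom.hom m = rep (K.X i) z m - m := rfl

theorem zSum_apply (p : ℕ) (i : ℤ) (m : K.X i) :
    ((zSum hz K p).f i).hom.hom m = ∑ j ∈ Finset.range p, rep (K.X i) (z ^ j) m := by
  let ev : End K →+ K.X i := AddMonoidHom.mk' (fun f ↦ (f.f i).hom.hom m) fun f g ↦ rfl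
  refine (map_sum ev (fun j ↦ (zMap z hz K) ^ j) (Finset.range p)).trans ?_
  exact Finset.sum_congr rfl fun j _ ↦ zMap_pow_apply hz K j i m

theorem zMap_pow_eq_one {p : ℕ} (hp : z ^ p = 1) : (zMap z hz K) ^ p = 1 := by
  apply HomologicalComplex.hom_ext
  intro i
  ext m
  refine (zMap_pow_apply hz K p i m).trans ?_
  rw [hp, map_one]
  rfl

theorem zSub_zSum {p : ℕ} (hp : z ^ p = 1) : zSub hz K ≫ zSum hz K p = 0 := by
  refine (geom_sum_mul (zMap z hz K) p).trans ?_
  rw [zMap_pow_eq_one hz K hp, sub_self]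

theorem zSum_zSub {p : ℕ} (hp : z ^ p = 1) : zSum hz K p ≫ zSub hz K = 0 := by
  refine (mul_geom_sum (zMap z hz K) p).trans ?_
  rw [zMap_pow_eq_one hz K hp, sub_self]

variable {p : ℕ} [NeZero p] {Ω : Type v} [Finite Ω] [MulAction G Ω] (j : Ω → ZMod p)
  (hj : ∀ ω, j (z⁻¹ • ω) = j ω - 1)

include hj in
/-- If the position `j` shows that `z` acts freely with period `p`, then the kernel of the norm is
the image of `z - 1`. -/
theorem exists_rep_sub_eq (m : fnMod k (G := G) Ω)
    (hm : ∑ i ∈ Finset.range p, rep _ (z ^ i) m = 0) : ∃ m', rep _ z m' - m' = m := by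
  refine ⟨(fnEquiv k G Ω).symm fun ω ↦
    -(∑ i ∈ Finset.range (j ω).val, fnEquiv k G Ω m ((z⁻¹ • ·)^[i] ω)), ?_⟩
  apply (fnEquiv k G Ω).injective
  ext ω
  rw [map_sub, Pi.sub_apply, fnEquiv_rep, LinearEquiv.apply_symm_apply]
  refine exists_eq_comp_sub (z⁻¹ • ·) j hj (fnEquiv k G Ω m) ω ?_
  have h1 := congr_fun (congr_arg (fnEquiv k G Ω) hm) ω
  rw [map_sum, Finset.sum_apply, map_zero, Pi.zero_apply] at h1
  rw [← h1]
  refine Finset.sum_congr rfl fun i _ ↦ ?_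
  rw [fnEquiv_rep, smul_iterate, inv_pow]

include hj in
/-- If the position `j` shows that `z` acts freely with period `p`, then the invariants of `z` are
norms: a function supported in one point of each orbit has the prescribed norm. -/
theorem exists_sum_rep_eq (m : fnMod k (G := G) Ω) (hm : rep _ z m = m) :
    ∃ m', ∑ i ∈ Finset.range p, rep _ (z ^ i) m' = m := by
  classical
  refine ⟨(fnEquiv k G Ω).symm fun ω ↦ if j ω = 0 then fnEquiv k G Ω m ω else 0, ?_⟩
  apply (fnEquiv k G Ω).injective
  ext ω
  rw [map_sum, Finset.sum_apply]
  simp only [fnEquiv_rep, LinearEquiv.apply_symm_apply]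
  have h1 (i : ℕ) (ω : Ω) : j ((z ^ i)⁻¹ • ω) = j ω - i := by
    induction i generalizing ω with
    | zero => simp
    | succ i hi => rw [pow_succ', mul_inv_rev, mul_smul, hi, hj]; push_cast; ring
  have h2 (i : ℕ) (ω : Ω) : fnEquiv k G Ω m ((z ^ i)⁻¹ • ω) = fnEquiv k G Ω m ω := by
    induction i generalizing ω with
    | zero => simp
    | succ i hi =>
      rw [pow_succ', mul_inv_rev, mul_smul, hi, ← fnEquiv_rep, hm]
  simp only [h1, h2]
  rw [Finset.sum_eq_single (j ω).val]
  · rw [if_pos]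
    rw [ZMod.natCast_val, ZMod.cast_id', id, sub_self]
  · intro i hi hi'
    rw [if_neg]
    intro h
    rw [sub_eq_zero] at h
    rw [h, ZMod.val_natCast_of_lt (Finset.mem_range.1 hi)] at hi'
    exact hi' rfl
  · exact fun h ↦ absurd (Finset.mem_range.2 (ZMod.val_lt _)) h

end Central

section Complex

open CircleJoin

variable {k : Type u} [Field k] {G : Type v} [Group G] {p : ℕ} [NeZero p]
  {X : Type v} [MulAction G X] [Fintype X] [DecidableEq X] (A : Cocycle p G X)

attribute [local instance] moduleK

/-- The conditions on the signs `ρ` which give an equivariant differential: an invariant choice of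
an orientation for each pair of factors. -/
structure IsSign (G : Type v) [Group G] {X : Type v} [MulAction G X] (ρ : X → X → k) : Prop where
  smul : ∀ (g : G) x y, ρ (g • x) (g • y) = ρ x y
  mul_self : ∀ x y, ρ x y * ρ x y = 1
  eq_neg : ∀ x y, x ≠ y → ρ x y = -ρ y x

variable {ρ : X → X → k} (hρ : IsSign G ρ)

/-- The complex of cochains on the join of circles, in the degrees from `0` to `2 * card X - 1`. -/
noncomputable def circleComplex : CochainComplex (ModG k G) ℤ where
  X i := fnMod k (GradedCells A i)
  d i j := fnHom (res A j ∘ₗ d ρ ∘ₗ ext A i) fun g f ω ↦ by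
    simp only [LinearMap.comp_apply, res_apply]
    have h1 : ext A i (fun ω ↦ f (g • ω)) = fun c ↦ ext A i f (A.act g c) :=
      funext (ext_act A f g)
    rw [h1, d_act A hρ.smul]
    rfl
  shape i j hij := fnMod_hom_ext fun m ↦ by
    rw [fnEquiv_fnHom]
    exact res_d_ext A ρ hij _
  d_comp_d' i j l hij hjl := fnMod_hom_ext fun m ↦ by
    change res A l (d ρ (ext A j (res A j (d ρ (ext A i (fnEquiv k G _ m)))))) = 0
    rw [ext_res_d_ext A ρ hij, d_d ρ hρ.mul_self hρ.eq_neg, map_zero]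

/-- The values of an element of the complex. -/
noncomputable def circleEquiv (i : ℤ) :
    (circleComplex A hρ).X i ≃ₗ[k] (GradedCells A i → k) := fnEquiv k G _

theorem circleEquiv_d (i j : ℤ) (m : (circleComplex A hρ).X i) :
    circleEquiv A hρ j (((circleComplex A hρ).d i j).hom.hom m) =
      res A j (d ρ (ext A i (circleEquiv A hρ i m))) := rfl

theorem isZero_circleComplex (i : ℤ) [IsEmpty (GradedCells A i)] :
    IsZero ((circleComplex A hρ).X i) := by
  have : Subsingleton ((circleComplex A hρ).X i) := (circleEquiv A hρ i).toEquiv.subsingleton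
  rw [IsZero.iff_id_eq_zero]
  ext m
  exact Subsingleton.elim _ _

instance : (circleComplex A hρ).IsStrictlyGE 0 := by
  rw [CochainComplex.isStrictlyGE_iff]
  intro i hi
  have : IsEmpty (GradedCells A i) := ⟨fun c ↦ by
    have h1 := c.deg_eq
    have h2 := c.deg_ne
    lia⟩
  exact isZero_circleComplex A hρ i

theorem isStrictlyLE_circleComplex :
    (circleComplex A hρ).IsStrictlyLE (2 * Fintype.card X - 1) := by
  rw [CochainComplex.isStrictlyLE_iff]
  intro i hi
  have : IsEmpty (GradedCells A i) := ⟨fun c ↦ by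
    have h1 := c.deg_eq
    have h2 := deg_le c.val
    lia⟩
  exact isZero_circleComplex A hρ i

/-- The families of arcs are the cells of the top dimension. -/
theorem ε_ext_eq_zero {i : ℤ} (hi : i ≠ 2 * Fintype.card X - 1) (f : GradedCells A i → k) :
    ε (ext A i f) = 0 := by
  refine Finset.sum_eq_zero fun c _ ↦ ext_eq_zero A f fun h ↦ hi ?_
  have := (deg_eq_iff (p := p) _).2 ⟨c, rfl⟩
  lia

/-- A cocycle of the complex is a coboundary of the augmented complex, provided that its values on
the families of arcs sum to zero. -/
theorem exists_d_eq_ext {i : ℤ} (m : (circleComplex A hρ).X i)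
    (hm : ((circleComplex A hρ).d i (i + 1)).hom.hom m = 0)
    (hm' : ε (ext A i (circleEquiv A hρ i m)) = 0) :
    ∃ g, d ρ g = ext A i (circleEquiv A hρ i m) := by
  refine exists_d_eq ρ hρ.mul_self hρ.eq_neg _ ?_ hm'
  rw [← ext_res_d_ext A ρ (i := i) rfl]
  have h1 : res A (i + 1) (d ρ (ext A i (circleEquiv A hρ i m))) = 0 := by
    rw [← circleEquiv_d, hm, map_zero]
  rw [h1, map_zero]

/-- Away from degree zero, a cocycle is a coboundary, provided that its values on the families of
arcs sum to zero. -/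
theorem exists_circle_d_eq {i : ℤ} (hi : i ≠ 0) (m : (circleComplex A hρ).X i)
    (hm : ((circleComplex A hρ).d i (i + 1)).hom.hom m = 0)
    (hm' : ε (ext A i (circleEquiv A hρ i m)) = 0) :
    ∃ m', ((circleComplex A hρ).d (i - 1) i).hom.hom m' = m := by
  obtain ⟨g, hg⟩ := exists_d_eq_ext A hρ m hm hm'
  refine ⟨(circleEquiv A hρ (i - 1)).symm (res A (i - 1) g), ?_⟩
  apply (circleEquiv A hρ i).injective
  ext c
  rw [circleEquiv_d, LinearEquiv.apply_symm_apply, ← ext_val A (circleEquiv A hρ i m), ← hg,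
    res_apply, ← sub_eq_zero, ← Pi.sub_apply, ← map_sub]
  refine d_eq_zero ρ _ _ fun c' hc' ↦ ?_
  have h1 := c.deg_eq
  rw [Pi.sub_apply, sub_eq_zero]
  exact ext_val A (res A (i - 1) g) ⟨c', by lia, by lia⟩

/-- The indicator function of the empty cell. -/
def emptyFn (p : ℕ) (k : Type u) [Field k] (X : Type v) [Fintype X] (c : X → Cell p) : k :=
  if deg c = 0 then 1 else 0

/-- The coboundary of the indicator function of the empty cell. -/
def pointFn : GradedCells A 0 → k := res A 0 (d ρ (emptyFn p k X))

omit [NeZero p] in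
variable (ρ) in
theorem ext_pointFn : ext A 0 (pointFn (ρ := ρ) A) = d ρ (emptyFn p k X) := by
  ext c
  by_cases h : (deg c : ℤ) = 0 + 1 ∧ deg c ≠ 0
  · exact dif_pos h
  · rw [ext_eq_zero A _ h]
    refine (d_eq_zero ρ _ c fun c' hc' ↦ if_neg fun h' ↦ h ?_).symm
    lia

omit [NeZero p] in
include hρ in
theorem pointFn_smul (g : G) (c : GradedCells A 0) :
    pointFn (ρ := ρ) A (g • c) = pointFn (ρ := ρ) A c := by
  refine (d_act A hρ.smul g (emptyFn p k X) c.val).symm.trans ?_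
  have h1 : (fun c ↦ emptyFn p k X (A.act g c)) = emptyFn p k X := by
    ext c
    unfold emptyFn
    rw [deg_act]
  rw [h1]
  rfl

omit [NeZero p] in
theorem exists_pointFn_ne_zero [Nonempty X] : ∃ c, pointFn (ρ := ρ) A c ≠ 0 := by
  obtain ⟨x⟩ := ‹Nonempty X›
  let c₀ : X → Cell p := fun _ ↦ none
  have h0 : deg c₀ = 0 := (deg_eq_zero_iff c₀).2 rfl
  let c : X → Cell p := Function.update c₀ x (some (false, 0))
  have hc : deg c = 1 := by
    have h1 : deg c + 0 = deg c₀ + 1 := deg_update c₀ x (some (false, 0))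
    lia
  refine ⟨⟨c, by rw [hc]; rfl, by rw [hc]; exact one_ne_zero⟩, ?_⟩
  have h2 : d ρ (emptyFn p k X) c = 1 := by
    rw [d_apply, Finset.sum_apply, Finset.sum_eq_single x]
    · rw [op_apply]
      have h3 : c x = some (false, 0) := Function.update_self _ _ _
      have h4 : sgn ρ x c = 1 := by
        refine Finset.prod_eq_one fun y hy ↦ ?_
        have h5 : c y = none := Function.update_of_ne (Finset.ne_of_mem_erase hy) _ _
        rw [h5]
        rfl
      rw [h3, h4, one_mul]
      change emptyFn p k X (Function.update c x none) = 1
      rw [Function.update_idem]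
      have h5 : Function.update c₀ x none = c₀ := Function.update_eq_self x c₀
      rw [h5]
      exact if_pos h0
    · intro y _ hy
      rw [op_apply]
      have h3 : c y = none := Function.update_of_ne hy _ _
      rw [h3]
      exact mul_zero _
    · exact fun h ↦ absurd (Finset.mem_univ x) h
  change d ρ (emptyFn p k X) c ≠ 0
  rw [h2]
  exact one_ne_zero

/-- In degree zero, the cocycles are the multiples of one invariant function. -/
theorem exists_eq_smul_pointFn [Nonempty X] (m : (circleComplex A hρ).X 0)
    (hm : ((circleComplex A hρ).d 0 1).hom.hom m = 0) :
    ∃ a : k, circleEquiv A hρ 0 m = a • pointFn (ρ := ρ) A := by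
  obtain ⟨g, hg⟩ := exists_d_eq_ext A hρ m hm (ε_ext_eq_zero A (by
    have := Fintype.card_pos (α := X)
    lia) _)
  refine ⟨g fun _ ↦ none, ?_⟩
  ext c
  rw [← ext_val A (circleEquiv A hρ 0 m), ← hg, Pi.smul_apply]
  change _ = (g fun _ ↦ none) • d ρ (emptyFn p k X) c.val
  rw [← Pi.smul_apply, ← map_smul, ← sub_eq_zero, ← Pi.sub_apply, ← map_sub]
  refine d_eq_zero ρ _ _ fun c' hc' ↦ ?_
  have h1 := c.deg_eq
  have h2 : deg c' = 0 := by lia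
  rw [Pi.sub_apply, Pi.smul_apply, emptyFn, if_pos h2, (deg_eq_zero_iff c').1 h2, smul_eq_mul,
    mul_one, sub_self]

/-- The embedding of the trivial module as the cocycles of degree zero. -/
noncomputable def pointMap : triv k G ⟶ (circleComplex A hρ).X 0 :=
  fnHom (LinearMap.toSpanSingleton k _ (pointFn (ρ := ρ) A) ∘ₗ LinearMap.proj PUnit.unit)
    fun g f ω ↦ congr_arg (f PUnit.unit • ·) (pointFn_smul A hρ g ω).symm

theorem circleEquiv_pointMap (m : triv k G) : circleEquiv A hρ 0 ((pointMap A hρ).hom.hom m) =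
    fnEquiv k G PUnit m PUnit.unit • pointFn (ρ := ρ) A := rfl

theorem pointMap_d : pointMap A hρ ≫ (circleComplex A hρ).d 0 1 = 0 := by
  refine fnMod_hom_ext fun m ↦ ?_
  change res A 1 (d ρ (ext A 0 (fnEquiv k G PUnit m PUnit.unit • pointFn (ρ := ρ) A))) = 0
  rw [map_smul, ext_pointFn, map_smul, d_d ρ hρ.mul_self hρ.eq_neg, smul_zero, map_zero]

theorem mono_pointMap [Finite G] [Nonempty X] : Mono (pointMap A hρ) := by
  rw [FGModuleCat.mono_iff, injective_iff_map_eq_zero]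
  intro m hm
  obtain ⟨c, hc⟩ := exists_pointFn_ne_zero (ρ := ρ) A
  have h1 := congr_fun (congr_arg (circleEquiv A hρ 0) hm) c
  rw [circleEquiv_pointMap, map_zero] at h1
  apply (fnEquiv k G PUnit).injective
  ext ⟨⟩
  rw [map_zero]
  exact (mul_eq_zero.1 h1).resolve_right hc

/-- The sum of the values on the families of arcs. -/
noncomputable def augMap (i : ℤ) : (circleComplex A hρ).X i ⟶ triv k G :=
  fnHom
    { toFun := fun f _ ↦ ε (ext A i f)
      map_add' := fun f g ↦ by
        ext
        rw [map_add]
        exact Finset.sum_add_distrib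
      map_smul' := fun a f ↦ by
        ext
        rw [map_smul]
        exact (Finset.mul_sum _ _ _).symm } fun g f _ ↦ by
    have h1 : ext A i (fun ω ↦ f (g • ω)) = fun c ↦ ext A i f (A.act g c) :=
      funext (ext_act A f g)
    change ε (ext A i fun ω ↦ f (g • ω)) = ε (ext A i f)
    rw [h1, ε_act]

theorem d_augMap (i j : ℤ) (hij : i + 1 = j) : (circleComplex A hρ).d i j ≫ augMap A hρ j = 0 := by
  refine fnMod_hom_ext fun m ↦ ?_
  ext
  change ε (ext A j (res A j (d ρ (ext A i (circleEquiv A hρ i m))))) = 0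
  rw [ext_res_d_ext A ρ hij, ε_d]

end Complex

end PermutationModules

/-! ### Dimension shifting -/

namespace BoundedHomotopy

open DerivedCategory

variable {A : Type*} [Category A] [Abelian A] [HasDerivedCategory A]

theorem mono_homologyFunctor_map_Q {K L : CochainComplex A ℤ} (f : K ⟶ L) (i : ℤ)
    (hf : Mono (HomologicalComplex.homologyMap f i)) :
    Mono ((homologyFunctor A i).map (Q.map f)) := by
  have h := (homologyFunctorFactors A i).hom.naturality f
  have : Mono ((HomologicalComplex.homologyFunctor A (ComplexShape.up ℤ) i).map f) := hf
  have h2 : Mono ((Q ⋙ homologyFunctor A i).map f ≫ (homologyFunctorFactors A i).hom.app L) := by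
    rw [h]
    infer_instance
  exact @mono_of_mono _ _ _ _ _ _ _ h2

theorem homologyFunctor_map_Q_eq_zero {K L : CochainComplex A ℤ} (f : K ⟶ L) (i : ℤ)
    (hf : HomologicalComplex.homologyMap f i = 0) :
    (homologyFunctor A i).map (Q.map f) = 0 := by
  have h := (homologyFunctorFactors A i).hom.naturality f
  have h1 : (HomologicalComplex.homologyFunctor A (ComplexShape.up ℤ) i).map f = 0 := hf
  rw [h1, comp_zero] at h
  exact (cancel_mono ((homologyFunctorFactors A i).hom.app L)).1 (h.trans zero_comp.symm)

/-- A morphism which is injective on `H^(i + 1)` is, after a shift, injective on `H^i`. -/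
theorem mono_homologyFunctor_map_shift {X Y : DerivedCategory A} (f : X ⟶ Y) (i i' : ℤ)
    (hi : 1 + i = i') (hf : Mono ((homologyFunctor A i').map f)) :
    Mono ((homologyFunctor A i).map (f⟦(1 : ℤ)⟧')) := by
  have h := ((homologyFunctor A 0).shiftIso 1 i i' hi).hom.naturality f
  have : Mono (((homologyFunctor A 0).shift i').map f) := hf
  have h2 : Mono ((shiftFunctor (DerivedCategory A) (1 : ℤ) ⋙ (homologyFunctor A 0).shift i).map f ≫
      ((homologyFunctor A 0).shiftIso 1 i i' hi).hom.app Y) := by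
    rw [h]
    infer_instance
  exact @mono_of_mono _ _ _ _ _ _ _ h2

/-- A step of dimension shifting along an exact sequence of complexes
`0 ⟶ ker σ ⟶ K ⟶ ker τ ⟶ 0` in which the second map is zero on `H^i`: the connecting morphism
`ker τ ⟶ (ker σ)⟦1⟧` is injective on `H^i`. -/
theorem exists_mono_homology_step {K : CochainComplex A ℤ} {τ σ : K ⟶ K} (w : σ ≫ τ = 0)
    (hex : (ShortComplex.mk σ τ w).Exact) (Y : DerivedCategory A) (i i' : ℤ) (hi : i + 1 = i')
    (h0 : HomologicalComplex.homologyMap (kernel.lift τ σ w) i = 0)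
    (h : ∃ β : Q.obj (kernel σ) ⟶ Y⟦-i'⟧, Mono ((homologyFunctor A i').map β)) :
    ∃ β : Q.obj (kernel τ) ⟶ Y⟦-i⟧, Mono ((homologyFunctor A i).map β) := by
  obtain ⟨β, hβ⟩ := h
  have hS := shortExact_kernel_lift (kernel.condition σ) w
    (ShortComplex.exact_of_f_is_kernel _ (kernelIsKernel σ)) hex
  have hT := triangleOfSES_distinguished hS
  have h1 : Mono (HomologySequence.δ (triangleOfSES hS) i i' hi) :=
    (HomologySequence.exact₃ _ hT i i' hi).mono_g (homologyFunctor_map_Q_eq_zero _ _ h0)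
  let δ : Q.obj (kernel τ) ⟶ (Q.obj (kernel σ))⟦(1 : ℤ)⟧ := (triangleOfSES hS).mor₃
  have h2 : Mono ((homologyFunctor A i).map δ) := by
    have h3 : HomologySequence.δ (triangleOfSES hS) i i' hi =
      (homologyFunctor A i).map (triangleOfSES hS).mor₃ ≫
        ((homologyFunctor A 0).shiftIso 1 i i' (by lia)).hom.app _ := rfl
    rw [h3] at h1
    exact @mono_of_mono _ _ _ _ _ _ _ h1
  have h3 := mono_homologyFunctor_map_shift β i i' (by lia) hβ
  let e : (Y⟦-i'⟧)⟦(1 : ℤ)⟧ ≅ Y⟦-i⟧ := (shiftFunctorAdd' _ (-i') 1 (-i) (by lia)).symm.app Y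
  refine ⟨δ ≫ β⟦(1 : ℤ)⟧' ≫ e.hom, ?_⟩
  rw [CategoryTheory.Functor.map_comp, CategoryTheory.Functor.map_comp]
  infer_instance

/-- An object whose identity factors, up to a monomorphism, through `W` is a retract of `W`. -/
theorem exists_retract_of_mono {Y : A} (hY : ∀ f : Y ⟶ Y, Mono f → IsIso f) {W : DerivedCategory A}
    (η : (singleFunctor A 0).obj Y ⟶ W) (β : W ⟶ (singleFunctor A 0).obj Y)
    (hη : Mono ((homologyFunctor A 0).map η)) (hβ : Mono ((homologyFunctor A 0).map β)) :
    ∃ q, η ≫ q = 𝟙 _ := by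
  obtain ⟨f, hf⟩ := (singleFunctor A 0).map_surjective (η ≫ β)
  have h1 : Mono ((homologyFunctor A 0).map ((singleFunctor A 0).map f)) := by
    rw [hf, Functor.map_comp]
    exact mono_comp _ _
  have h2 : Mono f := by
    have h3 := (singleFunctorCompHomologyFunctorIso A 0).hom.naturality f
    have h4 : f = (singleFunctorCompHomologyFunctorIso A 0).inv.app Y ≫
        (homologyFunctor A 0).map ((singleFunctor A 0).map f) ≫
          (singleFunctorCompHomologyFunctorIso A 0).hom.app Y := by
      refine Eq.symm ((Iso.inv_comp_eq
        ((singleFunctorCompHomologyFunctorIso A 0).app Y)).2 h3)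
    rw [h4]
    infer_instance
  have := hY f h2
  have : IsIso (η ≫ β) := by
    rw [← hf]
    infer_instance
  exact ⟨β ≫ inv (η ≫ β), by rw [← Category.assoc, IsIso.hom_inv_id]⟩

end BoundedHomotopy

/-! ### The invariants of a central element acting freely -/

namespace CircleJoin

open Cell

/-- The position of a cell on the circle. -/
def Cell.pos {p : ℕ} : Cell p → ZMod p
  | none => 0
  | some (_, j) => j

theorem Cell.pos_rot {p : ℕ} (a : ZMod p) {c : Cell p} (hc : c ≠ none) :
    (rot a c).pos = a + c.pos := by
  rcases c with _ | ⟨b, j⟩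
  · exact absurd rfl hc
  · rfl

theorem Cell.rot_ne_none {p : ℕ} (a : ZMod p) {c : Cell p} : rot a c ≠ none ↔ c ≠ none := by
  rcases c with _ | ⟨b, j⟩ <;> simp [rot]

variable {p : ℕ} {G : Type v} [Group G] {X : Type v} [MulAction G X] (A : Cocycle p G X)
  {z : G} (hzX : ∀ x : X, z • x = x) (hza : ∀ x, A.a z x = 1)

include hzX hza in
theorem act_inv_apply (c : X → Cell p) (x : X) : A.act z⁻¹ c x = rot (-1) (c x) := by
  have h1 : A.a z⁻¹ x = -1 := by
    have := A.a_mul z⁻¹ z x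
    rw [inv_mul_cancel, A.a_one, hzX, hza] at this
    exact eq_neg_of_add_eq_zero_left this.symm
  rw [Cocycle.act, inv_inv, hzX, h1]

variable [Fintype X]

open Classical in
/-- The position of one of the non-empty cells in a family. It is the same factor for all families
which have the same empty members, so that rotating the whole family by one moves it by one. -/
noncomputable def GradedCells.pos {A : Cocycle p G X} {i : ℤ} (c : GradedCells A i) : ZMod p :=
  if h : ∃ x, c.val x ≠ none then (c.val h.choose).pos else 0

include hzX hza in
theorem GradedCells.pos_smul {i : ℤ} (c : GradedCells A i) :
    (z⁻¹ • c).pos = c.pos - 1 := by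
  have h1 : ∃ x, c.val x ≠ none := by
    by_contra! h
    exact c.deg_ne ((deg_eq_zero_iff _).2 (funext h))
  have h2 : (fun x ↦ (z⁻¹ • c).val x ≠ none) = fun x ↦ c.val x ≠ none := by
    ext x
    rw [val_smul, act_inv_apply A hzX hza, Cell.rot_ne_none]
  have h3 : ∃ x, (z⁻¹ • c).val x ≠ none := by rwa [h2]
  -- The choices agree because the two predicates are equal.
  have h4 : h3.choose = h1.choose := by
    unfold Exists.choose
    congr 1
  unfold GradedCells.pos
  rw [dif_pos h1, dif_pos h3, h4, val_smul, act_inv_apply A hzX hza, Cell.pos_rot _ h1.choose_spec]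
  ring

end CircleJoin

namespace PermutationModules

open BoundedHomotopy CircleJoin DerivedCategory

variable {k : Type u} [Field k] {G : Type v} [Group G] {p : ℕ} [NeZero p]
  {X : Type v} [MulAction G X] [Fintype X] [DecidableEq X] (A : Cocycle p G X)
  {ρ : X → X → k} (hρ : IsSign G ρ)
  {z : G} (hz : ∀ g, z * g = g * z) (hp : z ^ p = 1)
  (hzX : ∀ x : X, z • x = x) (hza : ∀ x, A.a z x = 1)

attribute [local instance] moduleK

include hzX hza in
theorem exists_circle_zSub_eq {i : ℤ} (m : (circleComplex A hρ).X i)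
    (hm : ((zSum hz _ p).f i).hom.hom m = 0) : ∃ m', ((zSub hz _).f i).hom.hom m' = m := by
  rw [zSum_apply] at hm
  exact exists_rep_sub_eq GradedCells.pos (GradedCells.pos_smul A hzX hza) m hm

include hzX hza in
theorem exists_circle_zSum_eq {i : ℤ} (m : (circleComplex A hρ).X i)
    (hm : ((zSub hz _).f i).hom.hom m = 0) : ∃ m', ((zSum hz _ p).f i).hom.hom m' = m := by
  rw [zSub_apply, sub_eq_zero] at hm
  obtain ⟨m', hm'⟩ : ∃ m' : (circleComplex A hρ).X i,
      ∑ j ∈ Finset.range p, rep ((circleComplex A hρ).X i) (z ^ j) m' = m :=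
    exists_sum_rep_eq GradedCells.pos (GradedCells.pos_smul A hzX hza) m hm
  refine ⟨m', ?_⟩
  rw [zSum_apply]
  exact hm'

variable [Finite G]

include hzX hza in
/-- The cochains on the join are periodic, since `z` acts freely on the cells. -/
theorem exact_zSub_zSum : (ShortComplex.mk (zSub hz (circleComplex A hρ)) (zSum hz _ p)
    (zSub_zSum hz _ hp)).Exact := by
  refine HomologicalComplex.exact_of_degreewise_exact _ fun i ↦ ?_
  rw [FGModuleCat.exact_iff]
  exact exists_circle_zSub_eq A hρ hz hzX hza

include hzX hza in
theorem exact_zSum_zSub : (ShortComplex.mk (zSum hz (circleComplex A hρ) p) (zSub hz _)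
    (zSum_zSub hz _ hp)).Exact := by
  refine HomologicalComplex.exact_of_degreewise_exact _ fun i ↦ ?_
  rw [FGModuleCat.exact_iff]
  exact exists_circle_zSum_eq A hρ hz hzX hza

/-- The join of circles has the cohomology of a sphere of dimension `2 * card X - 1`. -/
theorem isZero_homology_circleComplex {i : ℤ} (hi : i ≠ 0) (hi' : i ≠ 2 * Fintype.card X - 1) :
    IsZero ((circleComplex A hρ).homology i) := by
  rw [← HomologicalComplex.exactAt_iff_isZero_homology,
    HomologicalComplex.exactAt_iff' _ (i - 1) i (i + 1) (by simp) (by simp),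
    FGModuleCat.exact_iff]
  intro m hm
  exact exists_circle_d_eq A hρ hi m hm (ε_ext_eq_zero A hi' _)

theorem homologyMap_eq_zero {C : Type*} [Category C] [Abelian C] {K L : CochainComplex C ℤ}
    (f : K ⟶ L) (i : ℤ) (h : K.iCycles i ≫ f.f i = 0) :
    HomologicalComplex.homologyMap f i = 0 := by
  have h1 : HomologicalComplex.cyclesMap f i = 0 := by
    rw [← cancel_mono (L.iCycles i), HomologicalComplex.cyclesMap_i, h, zero_comp]
  rw [← cancel_epi (K.homologyπ i), HomologicalComplex.homologyπ_naturality, h1, zero_comp,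
    comp_zero]

omit [NeZero p] [Finite G] in
/-- On a fixed vector of `z`, the norm is multiplication by `p = 0`. -/
theorem sum_range_rep_eq_zero [CharP k p] {M : ModG k G} (m : M) (hm : rep M z m = m) :
    ∑ j ∈ Finset.range p, rep M (z ^ j) m = 0 := by
  have h (j : ℕ) : rep M (z ^ j) m = m := by
    induction j with
    | zero => rw [pow_zero, map_one]; rfl
    | succ j hj => rw [pow_succ, map_mul, Module.End.mul_apply, hm, hj]
  rw [Finset.sum_congr rfl fun j _ ↦ h j, Finset.sum_const, Finset.card_range,
    ← Nat.cast_smul_eq_nsmul k, CharP.cast_eq_zero, zero_smul]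

variable [CharP k p] [Nonempty X]

/-- The norm vanishes on `H^0`, which is spanned by an invariant cocycle. -/
theorem homologyMap_zSum_eq_zero : HomologicalComplex.homologyMap
    (kernel.lift (zSub hz (circleComplex A hρ)) (zSum hz _ p) (zSum_zSub hz _ hp)) 0 = 0 := by
  refine homologyMap_eq_zero _ _ ?_
  have : Mono ((kernel.ι (zSub hz (circleComplex A hρ))).f 0) := inferInstance
  rw [← cancel_mono ((kernel.ι (zSub hz (circleComplex A hρ))).f 0), Category.assoc,
    ← HomologicalComplex.comp_f, kernel.lift_ι, zero_comp]
  ext m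
  have h1 := congr_arg (fun f ↦ f.hom.hom m) ((circleComplex A hρ).iCycles_d 0 1)
  obtain ⟨a, ha⟩ := exists_eq_smul_pointFn A hρ _ h1
  refine (zSum_apply hz _ p 0 _).trans (sum_range_rep_eq_zero _ ?_)
  apply (circleEquiv A hρ 0).injective
  ext c
  refine (fnEquiv_rep z _ c).trans ?_
  refine (congr_fun ha _).trans (Eq.trans ?_ (congr_fun ha _).symm)
  rw [Pi.smul_apply, Pi.smul_apply, pointFn_smul A hρ]

omit [Nonempty X] [Finite G] in
theorem augMap_zSum (i : ℤ) : (zSum hz (circleComplex A hρ) p).f i ≫ augMap A hρ i = 0 := by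
  ext m
  have h1 : (augMap A hρ i).hom.hom (((zSum hz (circleComplex A hρ) p).f i).hom.hom m) =
      ∑ j ∈ Finset.range p, rep _ (z ^ j) ((augMap A hρ i).hom.hom m) := by
    rw [zSum_apply, map_sum]
    exact Finset.sum_congr rfl fun j _ ↦ map_rep (augMap A hρ i) _ _
  refine h1.trans (sum_range_rep_eq_zero _ ?_)
  apply (fnEquiv k G PUnit).injective
  ext x
  exact fnEquiv_rep z _ x

end PermutationModules

/-! ### The trivial module as a retract of the complex of invariants -/

namespace BoundedHomotopy

open DerivedCategory

variable {C : Type*} [Category C] [Abelian C] [HasDerivedCategory C]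

omit [HasDerivedCategory C] in
theorem exact_kernel_ι_f {K L : CochainComplex C ℤ} (f : K ⟶ L) (i : ℤ) :
    (ShortComplex.mk ((kernel.ι f).f i) (f.f i) (by
      rw [← HomologicalComplex.comp_f, kernel.condition, HomologicalComplex.zero_f])).Exact :=
  (ShortComplex.exact_of_f_is_kernel (ShortComplex.mk (kernel.ι f) f (kernel.condition f))
    (kernelIsKernel f)).map (HomologicalComplex.eval _ _ i)

omit [HasDerivedCategory C] in
theorem mono_homologyMap_mkHomToSingle {K : CochainComplex C ℤ} {M : C} {i : ℤ}
    (φ : K.X i ⟶ M) (w : K.d (i - 1) i ≫ φ = 0)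
    (hφ : ∀ j, (ComplexShape.up ℤ).Rel j i → K.d j i ≫ φ = 0)
    (h : (ShortComplex.mk _ _ w).Exact) :
    Mono (HomologicalComplex.homologyMap (HomologicalComplex.mkHomToSingle φ hφ) i) := by
  rw [HomologicalComplex.mono_homologyMap_iff_up_to_refinements _ (i - 1) i (i + 1) (by simp)
    (by simp)]
  intro T x _ y hxy
  rw [ShortComplex.exact_iff_exact_up_to_refinements] at h
  obtain ⟨T', π, hπ, x₁, hx₁⟩ := h x (by
    have h1 : y = 0 := (HomologicalComplex.isZero_single_obj_X _ _ _ _ (by lia)).eq_of_tgt _ _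
    rw [h1, zero_comp, HomologicalComplex.mkHomToSingle_f, ← Category.assoc] at hxy
    exact (cancel_mono _).1 (hxy.trans zero_comp.symm))
  exact ⟨T', π, hπ, x₁, hx₁⟩

/-- A map from the term in degree `i` which only kills the coboundaries induces a morphism to a
complex concentrated in degree `i` which is injective on `H^i`. -/
theorem exists_mono_homology_toSingle {K : CochainComplex C ℤ} {M : C} {i : ℤ}
    (φ : K.X i ⟶ M) (w : K.d (i - 1) i ≫ φ = 0) (h : (ShortComplex.mk _ _ w).Exact) :
    ∃ β : Q.obj K ⟶ ((singleFunctor C 0).obj M)⟦-i⟧, Mono ((homologyFunctor C i).map β) := by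
  have hφ : ∀ j, (ComplexShape.up ℤ).Rel j i → K.d j i ≫ φ = 0 := by
    intro j hj
    obtain rfl : j = i - 1 := by
      have : j + 1 = i := hj
      lia
    exact w
  let f : K ⟶ (CochainComplex.singleFunctor C i).obj M := HomologicalComplex.mkHomToSingle φ hφ
  have h1 : Mono ((homologyFunctor C i).map (Q.map f)) :=
    mono_homologyFunctor_map_Q _ i (mono_homologyMap_mkHomToSingle φ w hφ h)
  let e : Q.obj ((CochainComplex.singleFunctor C i).obj M) ≅ ((singleFunctor C 0).obj M)⟦-i⟧ :=
    ((singleFunctorIsoCompQ C i).app M).symm ≪≫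
      (((singleFunctors C).shiftIso (-i) i 0 (by lia)).app M).symm
  refine ⟨Q.map f ≫ e.hom, ?_⟩
  rw [CategoryTheory.Functor.map_comp]
  exact mono_comp _ _

omit [HasDerivedCategory C] in
theorem mono_homologyMap_mkHomFromSingle {K : CochainComplex C ℤ} {M : C} {i : ℤ}
    (φ : M ⟶ K.X i) [Mono φ] (hφ : ∀ j, (ComplexShape.up ℤ).Rel i j → φ ≫ K.d i j = 0)
    (h : IsZero (K.X (i - 1))) :
    Mono (HomologicalComplex.homologyMap (HomologicalComplex.mkHomFromSingle φ hφ) i) := by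
  rw [HomologicalComplex.mono_homologyMap_iff_up_to_refinements _ (i - 1) i (i + 1) (by simp)
    (by simp)]
  intro T x _ y hxy
  have h1 : y = 0 := h.eq_of_tgt _ _
  rw [h1, zero_comp, HomologicalComplex.mkHomFromSingle_f] at hxy
  refine ⟨T, 𝟙 T, inferInstance, 0, ?_⟩
  rw [zero_comp, Category.id_comp]
  exact (cancel_mono _).1 (hxy.trans zero_comp.symm)

/-- An embedding in the cocycles of the lowest degree is injective on cohomology. -/
theorem exists_mono_homology_fromSingle {K : CochainComplex C ℤ} {M : C}
    (φ : M ⟶ K.X 0) [Mono φ] (w : φ ≫ K.d 0 1 = 0) [K.IsStrictlyGE 0] :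
    ∃ η : (singleFunctor C 0).obj M ⟶ Q.obj K, Mono ((homologyFunctor C 0).map η) := by
  have hφ : ∀ j, (ComplexShape.up ℤ).Rel 0 j → φ ≫ K.d 0 j = 0 := by
    intro j hj
    obtain rfl : j = 1 := by
      have : 0 + 1 = j := hj
      lia
    exact w
  let f : (CochainComplex.singleFunctor C 0).obj M ⟶ K := HomologicalComplex.mkHomFromSingle φ hφ
  have h1 : Mono ((homologyFunctor C 0).map (Q.map f)) :=
    mono_homologyFunctor_map_Q _ 0 (mono_homologyMap_mkHomFromSingle φ hφ
      (K.isZero_of_isStrictlyGE 0 _ (by lia)))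
  let e : (singleFunctor C 0).obj M ≅ Q.obj ((CochainComplex.singleFunctor C 0).obj M) :=
    (singleFunctorIsoCompQ C 0).app M
  refine ⟨e.hom ≫ Q.map f, ?_⟩
  rw [CategoryTheory.Functor.map_comp]
  exact mono_comp _ _

end BoundedHomotopy

namespace PermutationModules

open BoundedHomotopy CircleJoin DerivedCategory

variable {k : Type u} [Field k] {G : Type v} [Group G] {p : ℕ} [NeZero p]
  {X : Type v} [MulAction G X] [Fintype X] [DecidableEq X] (A : Cocycle p G X)
  {ρ : X → X → k} (hρ : IsSign G ρ)
  {z : G} (hz : ∀ g, z * g = g * z) (hp : z ^ p = 1)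
  (hzX : ∀ x : X, z • x = x) (hza : ∀ x, A.a z x = 1)

attribute [local instance] moduleK

variable [Finite G] [CharP k p] [Nonempty X]

omit [Nonempty X] in
include hp hzX hza in
/-- The start of the dimension shifting: the complex `ker N`, where `N` is the norm, has a morphism
to the trivial module placed in the top degree which is injective on the top cohomology. -/
theorem exists_mono_homology_top :
    ∃ β : Q.obj (kernel (zSum hz (circleComplex A hρ) p)) ⟶
      ((singleFunctor _ 0).obj (triv k G))⟦-(2 * Fintype.card X - 1 : ℤ)⟧,
      Mono ((homologyFunctor _ (2 * Fintype.card X - 1)).map β) := by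
  set C := circleComplex A hρ
  set n : ℤ := 2 * Fintype.card X - 1 with hn
  have hn₀ : n ≠ 0 := by lia
  let e : C ⟶ kernel (zSum hz C p) := kernel.lift _ (zSub hz C) (zSub_zSum hz C hp)
  have he : ∀ i, Epi (e.f i) := by
    have h1 := shortExact_kernel_lift (f := kernel.ι (zSub hz C)) (g := zSub hz C)
      (h := zSum hz C p) (kernel.condition (zSub hz C)) (zSub_zSum hz C hp)
      (ShortComplex.exact_of_f_is_kernel _ (kernelIsKernel _)) (exact_zSub_zSum A hρ hz hp hzX hza)
    have : Epi e := h1.epi_g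
    intro i
    infer_instance
  have he₁ (i : ℤ) : e.f i ≫ (kernel.ι (zSum hz C p)).f i = (zSub hz C).f i := by
    rw [← HomologicalComplex.comp_f, kernel.lift_ι]
  -- The augmentation descends along `z - 1 : C ⟶ ker N`, because it kills the invariants of `z`:
  -- they are norms, and the augmentation takes norms to multiples of `p`.
  have h1 : kernel.ι (e.f n) ≫ augMap A hρ n = 0 := by
    ext m
    have h2 : ((zSub hz C).f n).hom.hom ((kernel.ι (e.f n)).hom.hom m) = 0 := by
      rw [← he₁]
      have := congr_arg (fun f ↦ f.hom.hom m) (kernel.condition (e.f n))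
      exact (congr_arg ((kernel.ι (zSum hz C p)).f n).hom.hom this).trans (map_zero _)
    obtain ⟨m', hm'⟩ := exists_circle_zSum_eq A hρ hz hzX hza _ h2
    have h3 := congr_arg (fun f ↦ f.hom.hom m') (augMap_zSum A hρ hz n)
    refine Eq.trans ?_ h3
    exact congr_arg (augMap A hρ n).hom.hom hm'.symm
  let φ : (kernel (zSum hz C p)).X n ⟶ triv k G := Abelian.epiDesc (e.f n) (augMap A hρ n) h1
  have hφ : e.f n ≫ φ = augMap A hρ n := Abelian.comp_epiDesc _ _ _
  have w : (kernel (zSum hz C p)).d (n - 1) n ≫ φ = 0 := by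
    rw [← cancel_epi (e.f (n - 1)), ← Category.assoc, e.comm, Category.assoc, hφ, comp_zero]
    exact d_augMap A hρ _ _ (by lia)
  refine exists_mono_homology_toSingle φ w ?_
  rw [FGModuleCat.exact_iff]
  intro y hy
  obtain ⟨x, rfl⟩ := (FGModuleCat.epi_iff (e.f n)).1 (he n) y
  have h2 : (augMap A hρ n).hom.hom x = 0 := by
    rw [← hφ]
    exact hy
  have h3 : (C.d n (n + 1)).hom.hom x = 0 := by
    have : C.IsStrictlyLE n := isStrictlyLE_circleComplex A hρ
    have h4 : C.d n (n + 1) = 0 := (C.isZero_of_isStrictlyLE n _ (by lia)).eq_of_tgt _ _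
    rw [h4]
    rfl
  obtain ⟨x', hx'⟩ := exists_circle_d_eq A hρ hn₀ x h3
    (congr_fun (congr_arg (fnEquiv k G PUnit) h2) PUnit.unit)
  refine ⟨(e.f (n - 1)).hom.hom x', ?_⟩
  have h4 := congr_arg (fun f ↦ f.hom.hom x') (e.comm (n - 1) n)
  refine h4.trans ?_
  exact congr_arg (e.f n).hom.hom hx'

include hp hzX hza in
/-- The result of the dimension shifting from the top degree to degree zero. The cohomology of the
sphere vanishes in the intermediate degrees, so the only condition is on the last step, which is
`homologyMap_zSum_eq_zero`. -/
theorem exists_mono_homology_zero :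
    ∃ β : Q.obj (kernel (zSub hz (circleComplex A hρ))) ⟶ (singleFunctor _ 0).obj (triv k G),
      Mono ((homologyFunctor _ 0).map β) := by
  have h0 (i : ℤ) (hi : i ≠ 0) (hi' : i ≠ 2 * Fintype.card X - 1)
      {L : CochainComplex (ModG k G) ℤ} (f : circleComplex A hρ ⟶ L) :
      HomologicalComplex.homologyMap f i = 0 :=
    (isZero_homology_circleComplex A hρ hi hi').eq_of_src _ _
  -- Two steps, for `N` and for `z - 1`, lead from `ker N` in degree `i + 2` to `ker N` in degree
  -- `i`, starting with the odd number `2 * card X - 1`.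
  have key (n : ℕ) : ∀ i : ℤ, i + 2 * n = 2 * Fintype.card X - 1 → 0 < i →
      ∃ β : Q.obj (kernel (zSum hz (circleComplex A hρ) p)) ⟶
        ((singleFunctor _ 0).obj (triv k G))⟦-i⟧, Mono ((homologyFunctor _ i).map β) := by
    induction n with
    | zero =>
      intro i hi _
      obtain rfl : i = 2 * Fintype.card X - 1 := by lia
      exact exists_mono_homology_top A hρ hz hp hzX hza
    | succ n hn =>
      intro i hi hi₀
      have h1 := hn (i + 2) (by lia) (by lia)
      have h2 := exists_mono_homology_step (zSum_zSub hz _ hp)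
        (exact_zSum_zSub A hρ hz hp hzX hza) _ (i + 1) (i + 2) (by lia)
        (h0 _ (by lia) (by lia) _) h1
      exact exists_mono_homology_step (zSub_zSum hz _ hp)
        (exact_zSub_zSum A hρ hz hp hzX hza) _ i (i + 1) rfl
        (h0 _ (by lia) (by lia) _) h2
  have hX := Fintype.card_pos (α := X)
  obtain ⟨β, hβ⟩ := exists_mono_homology_step (zSum_zSub hz _ hp)
    (exact_zSum_zSub A hρ hz hp hzX hza) _ 0 1 (by lia)
    (homologyMap_zSum_eq_zero A hρ hz hp) (key (Fintype.card X - 1) 1 (by lia) (by lia))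
  let e : ((singleFunctor (ModG k G) 0).obj (triv k G))⟦-(0 : ℤ)⟧ ≅
      (singleFunctor _ 0).obj (triv k G) :=
    (shiftFunctorZero' _ (-(0 : ℤ)) (by simp)).app _
  refine ⟨β ≫ e.hom, ?_⟩
  rw [CategoryTheory.Functor.map_comp]
  exact mono_comp _ _

include hp hzX hza in
/-- The trivial module is a retract of the complex of `z`-invariant cochains. -/
theorem exists_retract_kernel_zSub :
    ∃ (η : (singleFunctor _ 0).obj (triv k G) ⟶ Q.obj (kernel (zSub hz (circleComplex A hρ)))) (q :
      Q.obj (kernel (zSub hz (circleComplex A hρ))) ⟶ (singleFunctor _ 0).obj (triv k G)),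
      η ≫ q = 𝟙 _ := by
  set C := circleComplex A hρ
  set κ := kernel.ι (zSub hz C) with hκ
  have h1 : pointMap A hρ ≫ (zSub hz C).f 0 = 0 := by
    ext m
    have h2 := map_rep (pointMap A hρ) z m
    refine (sub_eq_zero.2 (h2.symm.trans ?_) : rep (C.X 0) z _ - _ = 0)
    refine congr_arg (pointMap A hρ).hom.hom ?_
    apply (fnEquiv k G PUnit).injective
    ext x
    exact fnEquiv_rep z _ x
  have h2 := exact_kernel_ι_f (zSub hz C) 0
  have hκ₀ (i : ℤ) : Mono (κ.f i) := inferInstance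
  let φ : triv k G ⟶ (kernel (zSub hz C)).X 0 := h2.lift (pointMap A hρ) h1
  have hφ : φ ≫ κ.f 0 = pointMap A hρ := h2.lift_f _ _
  have : Mono (pointMap A hρ) := mono_pointMap A hρ
  have : Mono φ := by
    have : Mono (φ ≫ κ.f 0) := by rwa [hφ]
    exact mono_of_mono φ (κ.f 0)
  have hw : φ ≫ (kernel (zSub hz C)).d 0 1 = 0 := by
    rw [← cancel_mono (κ.f 1), Category.assoc, ← κ.comm, ← Category.assoc, hφ, zero_comp]
    exact pointMap_d A hρ
  have : (kernel (zSub hz C)).IsStrictlyGE 0 := by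
    rw [CochainComplex.isStrictlyGE_iff]
    intro i hi
    have : C.IsStrictlyGE 0 := inferInstanceAs ((circleComplex A hρ).IsStrictlyGE 0)
    exact IsZero.of_mono (κ.f i) (C.isZero_of_isStrictlyGE 0 i hi)
  -- Both morphisms are injective on `H^0`, so their composition is an injective endomorphism of the
  -- trivial module, hence an automorphism.
  obtain ⟨η, hη⟩ := exists_mono_homology_fromSingle φ hw
  obtain ⟨β, hβ⟩ := exists_mono_homology_zero A hρ hz hp hzX hza
  refine ⟨η, exists_retract_of_mono (fun f hf ↦ ?_) η β hη hβ⟩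
  rw [FGModuleCat.mono_iff] at hf
  have h3 : Function.Surjective (linK f) := LinearMap.surjective_of_injective (f := linK f) hf
  have : Epi f := (FGModuleCat.epi_iff f).2 h3
  have : Mono f := (FGModuleCat.mono_iff f).2 hf
  exact isIso_of_mono_of_epi f

end PermutationModules

/-! ### The stabilizers of the orbits of cells -/

namespace CircleJoin

open Cell

variable {p : ℕ} {G : Type v} [Group G] {X : Type v} [MulAction G X] {A : Cocycle p G X}
  {z : G} (hzX : ∀ x : X, z • x = x) (hza : ∀ x, A.a z x = 1) [Fintype X]

include hzX hza in
theorem GradedCells.pos_pow_smul {i : ℤ} (c : GradedCells A i) (n : ℕ) :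
    (z ^ n • c).pos = c.pos + n := by
  induction n with
  | zero => simp
  | succ n hn =>
    have h1 := pos_smul A hzX hza (z ^ (n + 1) • c)
    rw [smul_smul, pow_succ', inv_mul_cancel_left, hn] at h1
    rw [pow_succ', sub_eq_iff_eq_add.1 h1.symm]
    push_cast
    ring

variable (hz : ∀ g, z * g = g * z)

include hz in
theorem pow_smul_comm {Ω : Type*} [MulAction G Ω] (g : G) (n : ℕ) (c : Ω) :
    g • z ^ n • c = z ^ n • g • c := by
  rw [smul_smul, smul_smul, ((show Commute z g from hz g).pow_left n).eq]

include hzX hza hz in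
/-- If the group preserves an orbit of `z` on the families of cells, then the position on this
orbit splits off the subgroup generated by `z`. -/
theorem exists_hom_of_forall {i : ℤ} (c : GradedCells A i)
    (h : ∀ g : G, ∃ n : ℕ, z ^ n • c = g • c) :
    ∃ φ : G →* Multiplicative (ZMod p), φ z = Multiplicative.ofAdd 1 := by
  refine ⟨{ toFun := fun g ↦ Multiplicative.ofAdd ((g • c).pos - c.pos)
            map_one' := by simp
            map_mul' := fun g g' ↦ ?_ }, ?_⟩
  · obtain ⟨n, hn⟩ := h g'
    rw [← ofAdd_add, mul_smul, ← hn, pow_smul_comm hz, GradedCells.pos_pow_smul hzX hza,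
      GradedCells.pos_pow_smul hzX hza]
    congr 1
    ring
  · have h1 := GradedCells.pos_pow_smul hzX hza c 1
    rw [pow_one] at h1
    change Multiplicative.ofAdd ((z • c).pos - c.pos) = _
    rw [h1]
    simp

end CircleJoin

namespace PermutationModules

open BoundedHomotopy CircleJoin DerivedCategory

attribute [local instance] moduleK

section

variable {k : Type u} [Field k] {G : Type v} [Group G] {p : ℕ} [NeZero p]
  {X : Type v} [MulAction G X] [Fintype X] [DecidableEq X] (A : Cocycle p G X)
  {ρ : X → X → k} (hρ : IsSign G ρ)
  {z : G} (hz : ∀ g, z * g = g * z) (hp : z ^ p = 1)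
  (hzX : ∀ x : X, z • x = x) (hza : ∀ x, A.a z x = 1)

/-- Two elements are equivalent if they are in the same orbit of `z`. -/
def powSetoid (Ω : Type*) [MulAction G Ω] : Setoid Ω where
  r a b := ∃ n : ℕ, z ^ n • a = b
  iseqv :=
    { refl := fun a ↦ ⟨0, by simp⟩
      symm := by
        rintro a _ ⟨n, rfl⟩
        refine ⟨(p - 1) * n, ?_⟩
        have h1 : (p - 1) * n + n = p * n := by
          rw [← Nat.succ_mul, Nat.succ_eq_add_one, Nat.sub_add_cancel NeZero.one_le]
        rw [smul_smul, ← pow_add, h1, pow_mul, hp, one_pow, one_smul]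
      trans := by
        rintro a _ _ ⟨n, rfl⟩ ⟨m, rfl⟩
        exact ⟨m + n, by rw [pow_add, mul_smul]⟩ }

include hz in
theorem powSetoid_smul (Ω : Type*) [MulAction G Ω] (g : G) (a b : Ω) (h : powSetoid hp Ω a b) :
    powSetoid hp Ω (g • a) (g • b) := by
  obtain ⟨n, rfl⟩ := h
  exact ⟨n, (pow_smul_comm hz g n a).symm⟩

variable [Finite G]

/-- The terms of the complex of `z`-invariants are permutation modules on the `z`-orbits. -/
theorem permOn_kernel_zSub (i : ℤ) :
    letI := quotientAction (powSetoid hp (GradedCells A i)) (powSetoid_smul hz hp (GradedCells A i))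
    PermOn (Quotient (powSetoid hp (GradedCells A i)))
      ((kernel (zSub hz (circleComplex A hρ))).X i) := by
  set C := circleComplex A hρ
  let κ : (kernel (zSub hz C)).X i ⟶ C.X i := (kernel.ι (zSub hz C)).f i
  have hκ : Function.Injective κ.hom.hom := (FGModuleCat.mono_iff κ).1 inferInstance
  have hex := (FGModuleCat.exact_iff _).1 (exact_kernel_ι_f (zSub hz C) i)
  have hzero (m : (kernel (zSub hz C)).X i) : rep (C.X i) z (κ.hom.hom m) = κ.hom.hom m := by
    have h1 : κ ≫ (zSub hz C).f i = 0 := by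
      change (kernel.ι (zSub hz C)).f i ≫ _ = 0
      rw [← HomologicalComplex.comp_f, kernel.condition, HomologicalComplex.zero_f]
    have h2 := congr_arg (fun f ↦ f.hom.hom m) h1
    exact sub_eq_zero.1 ((zSub_apply hz C i (κ.hom.hom m)).symm.trans h2)
  refine permOn_quotient (powSetoid hp (GradedCells A i)) (powSetoid_smul hz hp _)
    ((circleEquiv A hρ i).toLinearMap ∘ₗ linK κ) ?_ ?_ ?_ ?_
  · intro g m ω
    have h1 := map_rep κ g m
    exact (congr_arg (fun x ↦ circleEquiv A hρ i x ω) h1).trans (fnEquiv_rep g _ ω)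
  · exact (circleEquiv A hρ i).injective.comp hκ
  · rintro m a _ ⟨n, rfl⟩
    have h1 (c : GradedCells A i) : circleEquiv A hρ i (κ.hom.hom m) (z⁻¹ • c) =
        circleEquiv A hρ i (κ.hom.hom m) c :=
      (fnEquiv_rep z _ c).symm.trans
        (congr_arg (fun x ↦ circleEquiv A hρ i x c) (hzero m))
    change circleEquiv A hρ i (κ.hom.hom m) a = circleEquiv A hρ i (κ.hom.hom m) (z ^ n • a)
    induction n with
    | zero => rw [pow_zero, one_smul]
    | succ n hn => rw [hn, ← h1 (z ^ (n + 1) • a), smul_smul, pow_succ', inv_mul_cancel_left]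
  · intro f hf
    obtain ⟨m, hm⟩ := hex ((circleEquiv A hρ i).symm f) (by
      refine (zSub_apply hz C i _).trans (sub_eq_zero.2 ?_)
      apply (circleEquiv A hρ i).injective
      ext c
      refine (fnEquiv_rep z _ c).trans ?_
      change circleEquiv A hρ i ((circleEquiv A hρ i).symm f) (z⁻¹ • c) =
        circleEquiv A hρ i ((circleEquiv A hρ i).symm f) c
      rw [LinearEquiv.apply_symm_apply]
      exact hf _ _ ⟨1, by rw [pow_one, smul_inv_smul]⟩)
    refine ⟨m, ?_⟩
    refine (congr_arg (circleEquiv A hρ i) hm).trans ?_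
    exact LinearEquiv.apply_symm_apply _ _

theorem resMod_of_forall_stabilizer {Ω : Type v} [Finite Ω] [MulAction G Ω] {M : ModG k G}
    (hM : PermOn Ω M) (h : ∀ H : Subgroup G, H ≠ ⊤ → resMod k H (triv k H))
    (hΩ : ∀ ω : Ω, ∃ g : G, g • ω ≠ ω) : resMod k G M := by
  refine resMod_of_permOn _ le_rfl (fun ω ↦ h _ fun h' ↦ ?_) hM
  obtain ⟨g, hg⟩ := hΩ ω
  exact hg (MulAction.mem_stabilizer_iff.1 (h' ▸ Subgroup.mem_top g))

include hp hzX hza in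
/-- If the group generated by `z` is not a direct factor, then the stabilizers of the `z`-orbits of
cells are proper subgroups. If the trivial modules of all proper subgroups have arbitrarily free
resolutions, then so does the complex of invariants. -/
theorem resG_kernel_zSub (h : ∀ H : Subgroup G, H ≠ ⊤ → resMod k H (triv k H))
    (hφ : ¬∃ φ : G →* Multiplicative (ZMod p), φ z = Multiplicative.ofAdd 1) :
    resG k G (Q.obj (kernel (zSub hz (circleComplex A hρ)))) := by
  have h1 (i : ℤ) (hi : IsZero ((circleComplex A hρ).X i)) :
      IsZero ((kernel (zSub hz (circleComplex A hρ))).X i) := by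
    have h2 : Mono ((kernel.ι (zSub hz (circleComplex A hρ))).f i) := inferInstance
    exact IsZero.of_mono ((kernel.ι (zSub hz (circleComplex A hρ))).f i) hi
  refine prop_Q_of_prop_terms _ 0 (2 * Fintype.card X) _ ?_ ?_ fun i ↦ ?_
  · rw [CochainComplex.isStrictlyGE_iff]
    intro i hi
    exact h1 i ((circleComplex A hρ).isZero_of_isStrictlyGE 0 i hi)
  · rw [CochainComplex.isStrictlyLE_iff]
    intro i hi
    have := isStrictlyLE_circleComplex A hρ
    refine h1 i ((circleComplex A hρ).isZero_of_isStrictlyLE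
      (2 * Fintype.card X - 1) i ?_)
    push_cast at hi
    lia
  · let _ := quotientAction (powSetoid hp (GradedCells A i))
      (powSetoid_smul hz hp (GradedCells A i))
    refine resMod_of_forall_stabilizer (permOn_kernel_zSub A hρ hz hp i) h ?_
    rintro ⟨c⟩
    by_contra! h'
    refine hφ (exists_hom_of_forall hzX hza hz c fun g ↦ ?_)
    exact (powSetoid hp (GradedCells A i)).symm (Quotient.exact (h' g))

variable [CharP k p] [Nonempty X]

include hp hρ hz hzX hza in
/-- The inductive step for a central element `z` of order `p` which does not generate a direct
factor: the trivial module is a retract of the complex of invariants of `z`. -/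
theorem resMod_triv_of_cocycle (h : ∀ H : Subgroup G, H ≠ ⊤ → resMod k H (triv k H))
    (hφ : ¬∃ φ : G →* Multiplicative (ZMod p), φ z = Multiplicative.ofAdd 1) :
    resMod k G (triv k G) := by
  obtain ⟨η, q, hq⟩ := exists_retract_kernel_zSub A hρ hz hp hzX hza
  let K : CochainComplex (ModG k G) ℤ := (CochainComplex.singleFunctor (ModG k G) 0).obj (triv k G)
  have hK₀ (i : ℤ) (hi : i ≠ 0) : IsZero (K.X i) :=
    HomologicalComplex.isZero_single_obj_X (ComplexShape.up ℤ) 0 (triv k G) i hi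
  have hK : IsResolving (isPerm k G) (freeG k G) (-1) K := by
    refine ⟨⟨⟨0, inferInstance⟩, ⟨0, inferInstance⟩⟩, fun i ↦ ?_, fun i hi ↦ ?_⟩
    · by_cases hi : i = 0
      · subst hi
        exact (isPerm k G).prop_of_iso
          (HomologicalComplex.singleObjXSelf (ComplexShape.up ℤ) 0 (triv k G)).symm
          (permOn_fnMod k PUnit).isPerm
      · exact ObjectProperty.prop_of_isZero _ (hK₀ i hi)
    · exact ObjectProperty.prop_of_isZero _ (hK₀ i (by lia))
  -- The trivial module is its own resolution, with no term in negative homological degrees, which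
  -- are the only ones where freeness is required for `r = -1`.
  exact resAll_of_retract (projective_of_freeG k G)
    (resG_kernel_zSub A hρ hz hp hzX hza h hφ) η q hq (r := -1)
    ⟨K, hK, ⟨((singleFunctorIsoCompQ (ModG k G) 0).app (triv k G)).symm⟩⟩

end

end PermutationModules

/-! ### The trivial module of a `p`-group -/

namespace PermutationModules

open BoundedHomotopy CircleJoin DerivedCategory

section

variable {p : ℕ} {G : Type v} [Group G] {z : G} (hz : ∀ g, z * g = g * z)

include hz in
theorem smul_quotient_zpowers (x : G ⧸ Subgroup.zpowers z) : z • x = x := by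
  obtain ⟨g, rfl⟩ := QuotientGroup.mk_surjective x
  refine QuotientGroup.eq.2 ?_
  rw [Subgroup.mem_zpowers_iff]
  refine ⟨-1, ?_⟩
  change z ^ (-1 : ℤ) = (z * g)⁻¹ * g
  rw [hz, mul_inv_rev, inv_mul_cancel_right, zpow_neg_one]

include hz in
/-- The cocycle of the central extension of `G ⧸ zpowers z` by `ℤ/p`, relative to a choice of
representatives. On the points of the circles it gives the translation action of `G` on itself. -/
theorem exists_cocycle (hp : orderOf z = p) : ∃ A : Cocycle p G (G ⧸ Subgroup.zpowers z),
    ∀ x, A.a z x = 1 := by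
  let s (x : G ⧸ Subgroup.zpowers z) : G := Quotient.out x
  have hs (g : G) (x) : ∃ n : ℤ, z ^ n = (s (g • x))⁻¹ * (g * s x) := by
    rw [← Subgroup.mem_zpowers_iff, ← QuotientGroup.eq]
    refine (QuotientGroup.out_eq' _).trans ?_
    rw [← smul_eq_mul, MulAction.Quotient.coe_smul_out]
  choose n hn using hs
  have key {a b : ℤ} (h : z ^ a = z ^ b) : (a : ZMod p) = b := by
    rw [ZMod.intCast_eq_intCast_iff, ← hp]
    exact zpow_eq_zpow_iff_modEq.1 h
  have hn' (g h : G) (x) : (n (g * h) x : ZMod p) = n g (h • x) + n h x := by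
    rw [← Int.cast_add]
    apply key
    rw [zpow_add, hn, hn, hn, mul_smul]
    group
  refine ⟨⟨fun g x ↦ (n g x : ZMod p), hn'⟩, fun x ↦ ?_⟩
  · change (n z x : ZMod p) = 1
    rw [← Int.cast_one]
    apply key
    rw [hn, smul_quotient_zpowers hz, hz, inv_mul_cancel_left, zpow_one]

end

section

variable {k : Type u} [Field k] {p : ℕ} [Fact p.Prime] [CharP k p] {G : Type v} [Group G]
  [Finite G]

/-- Invariant signs exist for a `p`-group in characteristic `p`: the product over the group of the
translates of the signs of a total order is alternating, as `(-1) ^ card G = -1`. For `p = 2` this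
says that `-1 = 1`. -/
theorem exists_isSign (hG : IsPGroup p G) (X : Type v) [MulAction G X] [Finite X] :
    ∃ ρ : X → X → k, IsSign G ρ := by
  classical
  have := Fintype.ofFinite G
  let e := Finite.equivFin X
  let ρ₀ (x y : X) : k := if e x ≤ e y then 1 else -1
  refine ⟨fun x y ↦ ∏ g : G, ρ₀ (g • x) (g • y), fun g x y ↦ ?_, fun x y ↦ ?_, fun x y hxy ↦ ?_⟩
  · rw [← Equiv.prod_comp (Equiv.mulRight g) fun h ↦ ρ₀ (h • x) (h • y)]
    simp only [Equiv.coe_mulRight, mul_smul]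
  · rw [← Finset.prod_mul_distrib]
    refine Finset.prod_eq_one fun g _ ↦ ?_
    dsimp only [ρ₀]
    split_ifs <;> simp
  · have h (g : G) : ρ₀ (g • x) (g • y) = -1 * ρ₀ (g • y) (g • x) := by
      have h1 : e (g • x) ≠ e (g • y) := fun h ↦ hxy (MulAction.injective g (e.injective h))
      dsimp only [ρ₀]
      rcases lt_or_gt_of_ne h1 with h2 | h2
      · rw [if_pos h2.le, if_neg (not_le.2 h2)]
        ring
      · rw [if_neg (not_le.2 h2), if_pos h2.le]
        ring
    obtain ⟨n, hn⟩ := IsPGroup.iff_card.1 hG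
    rw [Finset.prod_congr rfl fun g _ ↦ h g, Finset.prod_mul_distrib, Finset.prod_const,
      Finset.card_univ, ← Nat.card_eq_fintype_card, hn, neg_one_pow_char_pow, neg_one_mul]

omit [CharP k p] [Finite G] in
variable {z : G} in
/-- A homomorphism to `ℤ/p` which takes the value `1` at a central element `z` of order `p`
splits `G` as a product of its kernel and the group generated by `z`. -/
theorem nonempty_cyclicFactor (hz : ∀ g, z * g = g * z) (hp : z ^ p = 1)
    (φ : G →* Multiplicative (ZMod p)) (hφ : φ z = Multiplicative.ofAdd 1) :
    Nonempty (CyclicFactor p z φ.ker) := by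
  have hpow (n : ℕ) : φ (z⁻¹ ^ n) = Multiplicative.ofAdd (-n : ZMod p) := by
    rw [map_pow, map_inv, hφ, ← ofAdd_neg, ← ofAdd_nsmul]
    simp
  have hcomm (g h : G) (n : ℕ) : z⁻¹ ^ n * (g * h) = g * (z⁻¹ ^ n * h) := by
    have h1 : z⁻¹ ^ n * g = g * z⁻¹ ^ n := ((show Commute z g from hz g).inv_left.pow_left n).eq
    rw [← mul_assoc, h1, mul_assoc]
  have hval (a b : ZMod p) : z⁻¹ ^ (a + b).val = z⁻¹ ^ a.val * z⁻¹ ^ b.val := by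
    rw [ZMod.val_add, ← pow_add, ← pow_eq_pow_mod _ (by rw [inv_pow, hp, inv_one])]
  refine ⟨{ π :=
              { toFun := fun g ↦ ⟨z⁻¹ ^ (φ g).toAdd.val * g, ?_⟩
                map_one' := ?_
                map_mul' := fun g h ↦ ?_ }
            j := fun g ↦ (φ g).toAdd
            comm := hz
            pow_eq := hp
            π_coe := ?_
            π_z := ?_
            exists_pow := fun g ↦ ⟨(φ g).toAdd.val, rfl⟩
            j_one := ?_
            j_z := fun g ↦ ?_
            j_mul := fun g n ↦ ?_ }⟩
  · rw [MonoidHom.mem_ker, map_mul, hpow, ZMod.natCast_val, ZMod.cast_id', id]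
    exact neg_add_cancel (φ g).toAdd
  · ext
    simp
  · ext
    simp only [map_mul, toAdd_mul, Subgroup.coe_mul, hval]
    rw [mul_assoc, mul_assoc, ← hcomm g h, hcomm]
  · rintro ⟨n, hn⟩
    rw [MonoidHom.mem_ker] at hn
    ext
    simp [hn]
  · ext
    have h1 : z⁻¹ ^ ((φ z).toAdd).val = z⁻¹ ^ 1 := by
      rw [hφ, toAdd_ofAdd, ZMod.val_one]
    change z⁻¹ ^ ((φ z).toAdd).val * z = 1
    rw [h1, pow_one, inv_mul_cancel]
  · simp
  · have h1 := hpow 1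
    rw [pow_one] at h1
    rw [map_mul, h1, toAdd_mul, toAdd_ofAdd, Nat.cast_one]
    ring
  · have h1 : φ n = 1 := n.2
    rw [map_mul, h1, mul_one]

theorem resMod_triv_of_subsingleton [Subsingleton G] : resMod k G (triv k G) := by
  rw [resMod_iff]
  exact fun m ↦ ⟨_, 𝟙 _, isResolving_of_subsingleton ⟨⟨0, inferInstance⟩, ⟨0, inferInstance⟩⟩ m,
    inferInstance⟩

omit [CharP k p] in
theorem exists_central_orderOf_eq [Nontrivial G] (hG : IsPGroup p G) :
    ∃ z : G, (∀ g, z * g = g * z) ∧ orderOf z = p := by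
  have := hG.center_nontrivial
  obtain ⟨n, hn, hn'⟩ := (hG.to_subgroup (Subgroup.center G)).nontrivial_iff_card.1 this
  obtain ⟨z, hz⟩ := exists_prime_orderOf_dvd_card' (G := Subgroup.center G) p
    (hn' ▸ dvd_pow_self p hn.ne')
  exact ⟨z, fun g ↦ (Subgroup.mem_center_iff.1 z.2 g).symm, (Subgroup.orderOf_coe z).trans hz⟩

end

/-- The trivial module of a `p`-group has arbitrarily free resolutions, by induction on the order
with respect to a central element of order `p`. -/
theorem resMod_triv_of_isPGroup {k : Type u} [Field k] {p : ℕ} [Fact p.Prime] [CharP k p] (n : ℕ) :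
    ∀ {G : Type v} [Group G] [Finite G], IsPGroup p G → Nat.card G ≤ n →
      resMod k G (triv k G) := by
  induction n with
  | zero =>
    intro G _ _ hG hn
    have := Nat.card_pos (α := G)
    lia
  | succ n hn =>
    intro G _ _ hG hcard
    rcases subsingleton_or_nontrivial G with h | h
    · exact resMod_triv_of_subsingleton
    obtain ⟨z, hz, hz'⟩ := exists_central_orderOf_eq hG
    have hp : z ^ p = 1 := by rw [← hz', pow_orderOf_eq_one]
    have hlt (H : Subgroup G) (hH : H ≠ ⊤) : resMod k H (triv k H) := by
      refine hn (hG.to_subgroup H) ?_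
      have h1 := H.card_le_card_group
      have h2 : Nat.card H ≠ Nat.card G := fun h ↦ hH (Subgroup.card_eq_iff_eq_top H |>.1 h)
      lia
    by_cases hφ : ∃ φ : G →* Multiplicative (ZMod p), φ z = Multiplicative.ofAdd 1
    · obtain ⟨φ, hφ⟩ := hφ
      obtain ⟨D⟩ := nonempty_cyclicFactor hz hp φ hφ
      refine D.resMod_triv k (hlt _ fun h ↦ ?_)
      have h1 : φ z = 1 := (h ▸ Subgroup.mem_top z : z ∈ φ.ker)
      rw [hφ] at h1
      exact one_ne_zero (α := ZMod p) h1
    · classical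
      obtain ⟨A, hA⟩ := exists_cocycle hz hz'
      obtain ⟨ρ, hρ⟩ := exists_isSign (k := k) hG (G ⧸ Subgroup.zpowers z)
      have := Fintype.ofFinite (G ⧸ Subgroup.zpowers z)
      exact resMod_triv_of_cocycle A hρ hz hp (smul_quotient_zpowers hz) hA hlt hφ

theorem resG_Q_of_isPGroup {k : Type u} [Field k] {p : ℕ} [Fact p.Prime] [CharP k p]
    {G : Type v} [Group G] [Finite G] (hG : IsPGroup p G) {K : CochainComplex (ModG k G) ℤ}
    (hK : IsBounded _ K) : resG k G (DerivedCategory.Q.obj K) :=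
  resG_Q_of_resMod (fun M ↦ resMod_of_triv hG (resMod_triv_of_isPGroup _ hG le_rfl) _ M le_rfl) hK

end PermutationModules

/-! ### The subcategory `𝒜(G;k)` -/

namespace PermutationModules

open BoundedHomotopy DerivedCategory

variable {k : Type u} [Field k] {G : Type v} [Group G] [Finite G]

/-- A subgroup of invertible index, for which the derived category is the subcategory of complexes
with permutation resolutions: a Sylow subgroup at the characteristic, or the trivial subgroup in
characteristic zero. -/
theorem exists_subgroup_resG (k : Type u) [Field k] (G : Type v) [Group G] [Finite G] :
    ∃ H : Subgroup G, (H.index : k) ≠ 0 ∧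
      ∀ K : CochainComplex (ModG k H) ℤ, IsBounded _ K → resG k H (Q.obj K) := by
  obtain ⟨p, hp⟩ := CharP.exists k
  rcases CharP.char_is_prime_or_zero k p with h | rfl
  · have := Fact.mk h
    obtain ⟨S⟩ : Nonempty (Sylow p G) := inferInstance
    refine ⟨S, fun h ↦ ?_, fun K hK ↦ resG_Q_of_isPGroup S.isPGroup' hK⟩
    exact S.not_dvd_index ((CharP.cast_eq_zero_iff k p _).1 h)
  · have := CharP.charP_to_charZero k
    refine ⟨⊥, ?_, fun K hK m ↦ ⟨K, isResolving_of_subsingleton hK m, ⟨Iso.refl _⟩⟩⟩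
    exact Nat.cast_ne_zero.2 Subgroup.index_ne_zero_of_finite

/-- A bounded complex `K` is a retract of a complex which is coinduced from a subgroup of invertible
index and has arbitrarily free resolutions; therefore `K⟦1⟧ ⊞ K` has arbitrarily free
resolutions. -/
theorem resG_Q_shift_biprod {K : CochainComplex (ModG k G) ℤ} (hK : IsBounded _ K) :
    resG k G ((Q.obj K)⟦(1 : ℤ)⟧ ⊞ Q.obj K) := by
  obtain ⟨H, hH, hres⟩ := exists_subgroup_resG k G
  obtain ⟨⟨a, ha⟩, ⟨b, hb⟩⟩ := id hK
  let L := ((resAlong k H.subtype).mapHomologicalComplex (ComplexShape.up ℤ)).obj K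
  have hL : IsBounded _ L := ⟨⟨a, inferInstanceAs (CochainComplex.IsStrictlyGE
      (((resAlong k H.subtype).mapHomologicalComplex (ComplexShape.up ℤ)).obj K) a)⟩,
    ⟨b, inferInstanceAs (CochainComplex.IsStrictlyLE
      (((resAlong k H.subtype).mapHomologicalComplex (ComplexShape.up ℤ)).obj K) b)⟩⟩
  let W := ((coind k H).mapHomologicalComplex (ComplexShape.up ℤ)).obj L
  have hW : resG k G (Q.obj W) := fun m ↦
    (((hres L hL).hasResolution (projective_of_freeG k H) hL m).map (coind k H)
      (fun X hX ↦ isPerm_coind H hX) (fun X hX ↦ free_coind H hX)).res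
  let η : K ⟶ W :=
    { f := fun i ↦ (coindUnit k H).app (K.X i)
      comm' := fun i j _ ↦ ((coindUnit k H).naturality (K.d i j)).symm }
  let q : W ⟶ K :=
    { f := fun i ↦ (coindTransfer k H ≫ scalarMap G (H.index : k)⁻¹).app (K.X i)
      comm' := fun i j _ ↦
        ((coindTransfer k H ≫ scalarMap G (H.index : k)⁻¹).naturality (K.d i j)).symm }
  have h : η ≫ q = 𝟙 K := by
    ext i : 1
    exact congr_app (coindUnit_comp_transfer H hH) (K.X i)
  refine prop_biprod_shift_of_retract _ hW (Q.map η) (Q.map q) ?_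
  rw [← CategoryTheory.Functor.map_comp, h, CategoryTheory.Functor.map_id]

theorem hasResolution_iff (K : CochainComplex (ModG k G) ℤ) (m : ℤ) :
    HasResolution (isPerm k G) (freeG k G) m K ↔ HasFreePermResolution K m := by
  constructor
  · rintro ⟨P, s, hP, hs⟩
    exact ⟨P, s, hP.bounded, hP.prop, fun i hi ↦ hP.free (-i) (by lia), hs⟩
  · rintro ⟨P, s, hP, hP', hP'', hs⟩
    refine ⟨P, s, ⟨hP, hP', fun i hi ↦ ?_⟩, hs⟩
    have := hP'' (-i) (by lia)
    rwa [neg_neg] at this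

/-- Whether a complex has free permutation resolutions, by quasi-isomorphisms of complexes, only
depends on its image in the derived category. -/
theorem catA_iff (X : DbG k G) : catA k G X ↔ resG k G (Q.obj X.complex) := by
  obtain ⟨hX, -⟩ := X.exists_eq_of
  constructor
  · intro h m
    obtain ⟨P, s, hP, hs⟩ := (hasResolution_iff _ _).2 (h (max m 0) (le_max_right _ _))
    exact HasResolution.res ⟨P, s, hP.mono (le_max_left _ _), hs⟩
  · intro h m _
    exact (hasResolution_iff _ _).1 (h.hasResolution (projective_of_freeG k G) hX m)

theorem nonempty_toDerived_iso (X : DbG k G) :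
    Nonempty ((toDerived (ModG k G)).obj X ≅ Q.obj X.complex) := by
  obtain ⟨hX, h⟩ := X.exists_eq_of
  exact ⟨eqToIso (congr_arg (toDerived (ModG k G)).obj h) ≪≫ toDerivedOfIso X.complex hX⟩

theorem catA_iff_toDerived (X : DbG k G) : catA k G X ↔ resG k G ((toDerived _).obj X) := by
  obtain ⟨e⟩ := nonempty_toDerived_iso X
  rw [catA_iff]
  exact ((resG k G).prop_iff_of_iso e).symm

instance : HasBinaryBiproducts (DbG k G) :=
  CategoryTheory.Pretriangulated.instHasBinaryBiproducts

theorem exists_catA_biprod (X : DbG k G) : ∃ Y : DbG k G, catA k G (X ⊞ Y) := by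
  obtain ⟨hX, -⟩ := X.exists_eq_of
  obtain ⟨e⟩ := nonempty_toDerived_iso X
  obtain ⟨⟨a, _⟩, ⟨b, _⟩⟩ := id hX
  have hY : IsBounded _ (X.complex⟦(1 : ℤ)⟧) :=
    ⟨⟨a - 1, X.complex.isStrictlyGE_shift a 1 (a - 1) (by lia)⟩,
      ⟨b - 1, X.complex.isStrictlyLE_shift b 1 (b - 1) (by lia)⟩⟩
  refine ⟨Db.of _ hY, (catA_iff_toDerived _).2 ?_⟩
  let e' : (toDerived (ModG k G)).obj (Db.of _ hY) ≅ (Q.obj X.complex)⟦(1 : ℤ)⟧ :=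
    toDerivedOfIso _ hY ≪≫ (Q.commShiftIso (1 : ℤ)).app X.complex
  have := preservesBinaryBiproducts_of_preservesBiproducts (toDerived (ModG k G))
  exact (resG k G).prop_of_iso
    ((toDerived (ModG k G)).mapBiprod X (Db.of _ hY) ≪≫ biprod.mapIso e e' ≪≫
      biprod.braiding _ _).symm (resG_Q_shift_biprod hX)

variable (k G) in
theorem catANat_eq_top : catANat k G = ⊤ := by
  refine top_unique fun X _ ↦ ?_
  obtain ⟨Y, hY⟩ := exists_catA_biprod X
  exact ⟨Y, (catA k G).le_isoClosure _ hY⟩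

variable (k) in
theorem catA_eq_top_of_isPGroup {p : ℕ} (hp : p.Prime) [CharP k p] (hG : IsPGroup p G) :
    catA k G = ⊤ := by
  have := Fact.mk hp
  refine top_unique fun X _ ↦ (catA_iff X).2 ?_
  obtain ⟨hX, -⟩ := X.exists_eq_of
  exact resG_Q_of_isPGroup hG hX

end PermutationModules

/-! ### Idempotent completion of a functor, and covers in the Verdier quotient -/

namespace BoundedHomotopy

section Karoubi

variable {C D : Type*} [Category C] [Category D]

/-- A fully faithful functor to an idempotent complete category, such that every object of the
target is a retract of an object in the image, induces an equivalence on the idempotent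
completion. -/
theorem isEquivalence_functorExtension_obj [IsIdempotentComplete D] (F : C ⥤ D) [F.Full]
    [F.Faithful] (hF : ∀ Y : D, ∃ (X : C) (i : Y ⟶ F.obj X) (r : F.obj X ⟶ Y), i ≫ r = 𝟙 Y) :
    ((Idempotents.functorExtension C D).obj F).IsEquivalence := by
  let F' : Idempotents.Karoubi C ⥤ Idempotents.Karoubi D :=
    (Idempotents.functorExtension₂ C D).obj F
  have hf {P P' : Idempotents.Karoubi C} (f : P ⟶ P') : (F'.map f).f = F.map f.f := rfl
  have : F'.Faithful := ⟨fun {P P'} f g h ↦ by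
    ext
    apply F.map_injective
    rw [← hf, ← hf, h]⟩
  have : F'.Full := ⟨fun {P P'} φ ↦ by
    let φ' : F.obj P.X ⟶ F.obj P'.X := φ.f
    refine ⟨⟨F.preimage φ', ?_⟩, ?_⟩
    · apply F.map_injective
      rw [Functor.map_comp, Functor.map_comp, F.map_preimage]
      exact φ.comm
    · ext
      rw [hf]
      exact F.map_preimage φ'⟩
  have : F'.EssSurj := ⟨fun Q ↦ by
    let e := (Idempotents.toKaroubi D).objObjPreimageIso Q
    obtain ⟨X, i, r, h⟩ := hF ((Idempotents.toKaroubi D).objPreimage Q)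
    let P : Idempotents.Karoubi C :=
      ⟨X, F.preimage (r ≫ i), F.map_injective (by
        rw [Functor.map_comp, F.map_preimage, Category.assoc, reassoc_of% h])⟩
    have hP : (F'.obj P).p = r ≫ i := F.map_preimage (r ≫ i)
    refine ⟨P, ⟨?_ ≪≫ e⟩⟩
    exact
      { hom := ⟨r, by
          rw [hP]
          change (r ≫ i) ≫ r ≫ 𝟙 _ = r
          rw [Category.comp_id, Category.assoc, h, Category.comp_id]⟩
        inv := ⟨i, by
          rw [hP]
          change 𝟙 _ ≫ i ≫ r ≫ i = i
          rw [Category.id_comp, reassoc_of% h]⟩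
        hom_inv_id := by
          ext
          exact hP.symm
        inv_hom_id := by
          ext
          exact h }⟩
  have : F'.IsEquivalence := { }
  change (F' ⋙ (Idempotents.toKaroubiEquivalence D).inverse).IsEquivalence
  infer_instance

end Karoubi

end BoundedHomotopy

namespace PermutationModules

open BoundedHomotopy DerivedCategory

variable {k : Type u} [Field k] {G : Type v} [Group G] [Finite G]

/-- The inclusion of complexes of permutation modules in complexes of modules. -/
noncomputable abbrev inclComplex (k : Type u) [Field k] (G : Type v) [Group G] [Finite G] :
    CochainComplex (Perm k G) ℤ ⥤ CochainComplex (ModG k G) ℤ :=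
  (isPerm k G).ι.mapHomologicalComplex (ComplexShape.up ℤ)

theorem isBounded_inclComplex {P : CochainComplex (Perm k G) ℤ} (hP : IsBounded _ P) :
    IsBounded _ ((inclComplex k G).obj P) := by
  obtain ⟨⟨a, _⟩, ⟨b, _⟩⟩ := hP
  exact ⟨⟨a, inferInstanceAs (CochainComplex.IsStrictlyGE ((inclComplex k G).obj P) a)⟩,
    ⟨b, inferInstanceAs (CochainComplex.IsStrictlyLE ((inclComplex k G).obj P) b)⟩⟩

theorem inclKb_map_homOf {P L : CochainComplex (Perm k G) ℤ} (hP : IsBounded _ P)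
    (hL : IsBounded _ L) (f : P ⟶ L) : (inclKb k G).map (Kb.homOf hP hL f) =
      Kb.homOf (isBounded_inclComplex hP) (isBounded_inclComplex hL) ((inclComplex k G).map f) :=
  rfl

/-- A resolving complex lifts to a complex of permutation modules. -/
theorem exists_inclComplex_eq {m : ℤ} {Z : CochainComplex (ModG k G) ℤ}
    (hZ : IsResolving (isPerm k G) (freeG k G) m Z) :
    ∃ (P : CochainComplex (Perm k G) ℤ) (_ : IsBounded _ P), (inclComplex k G).obj P = Z := by
  let P : CochainComplex (Perm k G) ℤ :=
    HomologicalComplex.liftObjectProperty (isPerm k G) Z hZ.prop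
  obtain ⟨⟨a, ha⟩, ⟨b, hb⟩⟩ := hZ.bounded
  refine ⟨P, ⟨⟨a, ?_⟩, ⟨b, ?_⟩⟩, rfl⟩
  · have : CochainComplex.IsStrictlyGE ((inclComplex k G).obj P) a := ha
    rwa [CochainComplex.isStrictlyGE_mapHomologicalComplex_obj_iff] at this
  · have : CochainComplex.IsStrictlyLE ((inclComplex k G).obj P) b := hb
    rwa [CochainComplex.isStrictlyLE_mapHomologicalComplex_obj_iff] at this

/-- The localization functor of the Verdier quotient of the permutation modules. -/
noncomputable abbrev permQ (k : Type u) [Field k] (G : Type v) [Group G] [Finite G] :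
    Kb (Perm k G) ⥤ PermQuotient k G := (acyclicPerm k G).trW.Q

theorem isIso_permQ_map_homOf {P L : CochainComplex (Perm k G) ℤ} (hP : IsBounded _ P)
    (hL : IsBounded _ L) (s : P ⟶ L) (hs : QuasiIso ((inclComplex k G).map s)) :
    IsIso ((permQ k G).map (Kb.homOf hP hL s)) := by
  refine Localization.inverts _ (acyclicPerm k G).trW _ ?_
  refine (ObjectProperty.inverseImage_trW_iff (acyclic (ModG k G)) (inclKb k G) _).2 ?_
  rw [inclKb_map_homOf]
  exact (acyclic_trW_homOf_iff _ _ _).2 hs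

theorem isBounded_biprod {C : Type*} [Category C] [Preadditive C] [HasBinaryBiproducts C]
    {K L : CochainComplex C ℤ} (hK : IsBounded C K) (hL : IsBounded C L) : IsBounded C (K ⊞ L) := by
  obtain ⟨⟨a, _⟩, ⟨b, _⟩⟩ := hK
  obtain ⟨⟨a', _⟩, ⟨b', _⟩⟩ := hL
  have h (i : ℤ) (h₁ : IsZero (K.X i)) (h₂ : IsZero (L.X i)) : IsZero ((K ⊞ L).X i) := by
    refine IsZero.of_iso ?_ (HomologicalComplex.biprodXIso K L i)
    rw [biprod_isZero_iff]
    exact ⟨h₁, h₂⟩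
  refine ⟨⟨min a a', ?_⟩, ⟨max b b', ?_⟩⟩
  · rw [CochainComplex.isStrictlyGE_iff]
    exact fun i hi ↦ h i (K.isZero_of_isStrictlyGE a _ (by lia))
      (L.isZero_of_isStrictlyGE a' _ (by lia))
  · rw [CochainComplex.isStrictlyLE_iff]
    exact fun i hi ↦ h i (K.isZero_of_isStrictlyLE b _ (by lia))
      (L.isZero_of_isStrictlyLE b' _ (by lia))

theorem resG_Q_inclComplex_biprod {P : CochainComplex (Perm k G) ℤ} (hP : IsBounded _ P) :
    resG k G (Q.obj ((inclComplex k G).obj (P⟦(1 : ℤ)⟧ ⊞ P))) := by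
  have h₁ := preservesBinaryBiproducts_of_preservesBiproducts (inclComplex k G)
  have h₂ := preservesBinaryBiproducts_of_preservesBiproducts (Q (C := ModG k G))
  refine (resG k G).prop_of_iso ?_ (resG_Q_shift_biprod (isBounded_inclComplex hP))
  let e₁ : (inclComplex k G).obj (P⟦(1 : ℤ)⟧) ≅ ((inclComplex k G).obj P)⟦(1 : ℤ)⟧ :=
    ((inclComplex k G).commShiftIso (1 : ℤ)).app P
  let e₂ : Q.obj (((inclComplex k G).obj P)⟦(1 : ℤ)⟧) ≅
      (Q.obj ((inclComplex k G).obj P))⟦(1 : ℤ)⟧ :=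
    (Q.commShiftIso (1 : ℤ)).app ((inclComplex k G).obj P)
  exact (Q.mapIso ((inclComplex k G).mapBiprod _ _) ≪≫ Q.mapBiprod _ _ ≪≫
    biprod.mapIso (Q.mapIso e₁ ≪≫ e₂) (Iso.refl _)).symm

/-- In the Verdier quotient, every complex of permutation modules is a retract of a complex
which is free in many degrees, namely of a resolution of `P⟦1⟧ ⊞ P`. -/
theorem exists_permQ_cover {P : CochainComplex (Perm k G) ℤ} (hP : IsBounded _ P) (m : ℤ) :
    ∃ (Z : CochainComplex (Perm k G) ℤ) (hZ : IsBounded _ Z) (w : Z ⟶ P)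
      (σ : (permQ k G).obj (Kb.of P hP) ⟶ (permQ k G).obj (Kb.of Z hZ)),
      (∀ i, m ≤ i → Projective (((inclComplex k G).obj Z).X i)) ∧
        σ ≫ (permQ k G).map (Kb.homOf hZ hP w) = 𝟙 _ := by
  obtain ⟨⟨a, _⟩, ⟨b, _⟩⟩ := id hP
  have hP' : IsBounded _ (P⟦(1 : ℤ)⟧) :=
    ⟨⟨a - 1, P.isStrictlyGE_shift a 1 (a - 1) (by lia)⟩,
      ⟨b - 1, P.isStrictlyLE_shift b 1 (b - 1) (by lia)⟩⟩
  have hB := isBounded_biprod hP' hP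
  obtain ⟨Z₀, s, hZ₀, hs⟩ := (resG_Q_inclComplex_biprod hP).hasResolution
    (projective_of_freeG k G) (isBounded_inclComplex hB) (-m)
  obtain ⟨Z, hZ, rfl⟩ := exists_inclComplex_eq hZ₀
  obtain ⟨s, rfl⟩ := (inclComplex k G).map_surjective s
  have := isIso_permQ_map_homOf hZ hB s hs
  refine ⟨Z, hZ, s ≫ biprod.snd, (permQ k G).map (Kb.homOf hP hB biprod.inr) ≫
    inv ((permQ k G).map (Kb.homOf hZ hB s)), fun i hi ↦ ?_, ?_⟩
  · exact projective_of_freeG k G _ (hZ₀.free i (by lia))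
  · rw [Kb.homOf_comp hZ hB hP, Functor.map_comp, Category.assoc, IsIso.inv_hom_id_assoc,
      ← Functor.map_comp, ← Kb.homOf_comp, biprod.inr_snd]
    exact (permQ k G).map_id _

end PermutationModules

/-! ### The functor from the Verdier quotient to the bounded derived category -/

namespace PermutationModules

open BoundedHomotopy DerivedCategory

variable {k : Type u} [Field k] {G : Type v} [Group G] [Finite G]

/-- The functor `upsilonQuotient` extends `upsilon`. -/
noncomputable def upsilonQuotientIso (k : Type u) [Field k] (G : Type v) [Group G] [Finite G] :
    permQ k G ⋙ upsilonQuotient k G ≅ inclKb k G ⋙ (acyclic (ModG k G)).trW.Q :=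
  eqToIso (Localization.Construction.fac _ _)

theorem upsilonQuotient_map {X Y : Kb (Perm k G)} (f : X ⟶ Y) :
    (upsilonQuotient k G).map ((permQ k G).map f) = (upsilonQuotientIso k G).hom.app X ≫
      (acyclic (ModG k G)).trW.Q.map ((inclKb k G).map f) ≫
        (upsilonQuotientIso k G).inv.app Y := by
  have h := (upsilonQuotientIso k G).hom.naturality f
  rw [← Category.assoc, ← Functor.comp_map, ← Functor.comp_map]
  exact (Iso.eq_comp_inv ((upsilonQuotientIso k G).app Y)).2 h

instance : (upsilonQuotient k G).Additive :=
  have : Localization.Lifting (permQ k G) (acyclicPerm k G).trW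
      (inclKb k G ⋙ (acyclic (ModG k G)).trW.Q) (upsilonQuotient k G) := ⟨upsilonQuotientIso k G⟩
  (Localization.functor_additive_iff (permQ k G) (acyclicPerm k G).trW (upsilonQuotient k G)).2
    (Functor.additive_of_iso (upsilonQuotientIso k G).symm)

theorem exists_eq_permQ_obj (X : PermQuotient k G) :
    ∃ P, ∃ hP : IsBounded (Perm k G) P, X = (permQ k G).obj (Kb.of P hP) := by
  obtain ⟨X, rfl⟩ := (Localization.Construction.objEquiv (acyclicPerm k G).trW).surjective X
  obtain ⟨P, hP, rfl⟩ := X.exists_eq_of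
  exact ⟨P, hP, rfl⟩

theorem Q_map_eq_zero_of_trW {K L : CochainComplex (ModG k G) ℤ} (hK : IsBounded _ K)
    (hL : IsBounded _ L) (f : K ⟶ L)
    (h : (acyclic (ModG k G)).trW.Q.map (Kb.homOf hK hL f) = 0) : Q.map f = 0 := by
  have h1 := toDerived_map_homOf hK hL f
  rw [h, Functor.map_zero] at h1
  rw [← cancel_epi (toDerivedOfIso K hK).hom, ← cancel_mono (toDerivedOfIso L hL).inv,
    Category.assoc, ← h1, comp_zero, zero_comp]

/-- A chain map of complexes of permutation modules which vanishes in the derived category is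
null-homotopic after composition with a sufficiently free cover of its source, and the cover has a
section in the Verdier quotient. -/
instance : (upsilonQuotient k G).Faithful :=
  Functor.faithful_of_comp_cancel_zero_of_hasLeftCalculusOfFractions (permQ k G)
    (acyclicPerm k G).trW _ (by
      intro X Y f hf
      obtain ⟨P, hP, rfl⟩ := X.exists_eq_of
      obtain ⟨L, hL, rfl⟩ := Y.exists_eq_of
      obtain ⟨f, rfl⟩ := Kb.exists_eq_homOf f
      obtain ⟨⟨b, _⟩, -⟩ := id hL
      obtain ⟨Z, hZ, w, σ, hZ', hσ⟩ := exists_permQ_cover hP b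
      have h1 : (acyclic (ModG k G)).trW.Q.map ((inclKb k G).map (Kb.homOf hP hL f)) = 0 := by
        rw [upsilonQuotient_map] at hf
        simpa using hf
      have h2 : Q.map ((inclComplex k G).map (w ≫ f)) = 0 := by
        rw [inclKb_map_homOf] at h1
        rw [CategoryTheory.Functor.map_comp, CategoryTheory.Functor.map_comp,
          Q_map_eq_zero_of_trW _ _ _ h1, comp_zero]
      obtain ⟨-, ⟨c, _⟩⟩ := isBounded_inclComplex hZ
      have : ((inclComplex k G).obj L).IsStrictlyGE b :=
        inferInstanceAs (CochainComplex.IsStrictlyGE ((inclComplex k G).obj L) b)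
      have h3 := quotient_map_eq_zero b c hZ' _ h2
      have h4 : Kb.homOf hZ hL (w ≫ f) = 0 := by
        refine Kb.homOf_eq_zero _ _ _ ?_
        apply ((isPerm k G).ι.mapHomotopyCategory (ComplexShape.up ℤ)).map_injective
        rw [Functor.map_zero]
        exact h3
      rw [← Category.id_comp ((permQ k G).map (Kb.homOf hP hL f)), ← hσ, Category.assoc,
        ← Functor.map_comp, ← Kb.homOf_comp, h4, Functor.map_zero, comp_zero])

/-- A morphism in the derived category between complexes of permutation modules is a chain map after
composition with a sufficiently free cover of its source, and the cover has a section in the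
Verdier quotient. -/
instance : (upsilonQuotient k G).Full where
  map_surjective {X Y} φ := by
    obtain ⟨P, hP, rfl⟩ := exists_eq_permQ_obj X
    obtain ⟨L, hL, rfl⟩ := exists_eq_permQ_obj Y
    obtain ⟨⟨b, _⟩, -⟩ := id hL
    obtain ⟨Z, hZ, w, σ, hZ', hσ⟩ := exists_permQ_cover hP (b - 1)
    let ψ := (upsilonQuotientIso k G).inv.app (Kb.of Z hZ) ≫
      (upsilonQuotient k G).map ((permQ k G).map (Kb.homOf hZ hP w)) ≫ φ ≫
        (upsilonQuotientIso k G).hom.app (Kb.of L hL)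
    have hZ₁ := isBounded_inclComplex hZ
    have hL₁ := isBounded_inclComplex hL
    let ψ' : Db.of _ hZ₁ ⟶ Db.of _ hL₁ := ψ
    obtain ⟨-, ⟨c, _⟩⟩ := id hZ₁
    have : ((inclComplex k G).obj L).IsStrictlyGE (b - 1 + 1) := by
      rw [sub_add_cancel]
      exact inferInstanceAs (CochainComplex.IsStrictlyGE ((inclComplex k G).obj L) b)
    obtain ⟨f, hf⟩ := exists_Q_map_eq (b - 1) c hZ'
      ((toDerivedOfIso _ hZ₁).inv ≫ (toDerived _).map ψ' ≫ (toDerivedOfIso _ hL₁).hom)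
    obtain ⟨f, rfl⟩ := (inclComplex k G).map_surjective f
    have hψ' : ψ' = (acyclic (ModG k G)).trW.Q.map
        (Kb.homOf hZ₁ hL₁ ((inclComplex k G).map f)) := by
      apply (toDerived _).map_injective
      rw [toDerived_map_homOf, hf]
      simp
    have hψ : ψ = (acyclic (ModG k G)).trW.Q.map ((inclKb k G).map (Kb.homOf hZ hL f)) := hψ'
    have h1 : (upsilonQuotient k G).map ((permQ k G).map (Kb.homOf hZ hP w)) ≫ φ =
        (upsilonQuotient k G).map ((permQ k G).map (Kb.homOf hZ hL f)) := by
      rw [upsilonQuotient_map (Kb.homOf hZ hL f), ← hψ]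
      simp [ψ]
    refine ⟨σ ≫ (permQ k G).map (Kb.homOf hZ hL f), ?_⟩
    rw [Functor.map_comp, ← h1, ← Category.assoc, ← Functor.map_comp, hσ,
      CategoryTheory.Functor.map_id, Category.id_comp]

/-- Each object of the bounded derived category is a retract of an object of `𝒜(G;k)`, which is
represented by a complex of permutation modules. -/
theorem exists_retract_upsilonQuotient (Y : DbG k G) :
    ∃ (X : PermQuotient k G) (i : Y ⟶ (upsilonQuotient k G).obj X)
      (r : (upsilonQuotient k G).obj X ⟶ Y), i ≫ r = 𝟙 Y := by
  obtain ⟨Y', hY'⟩ := exists_catA_biprod Y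
  obtain ⟨hB, h⟩ := (Y ⊞ Y').exists_eq_of
  obtain ⟨Z, s, hZ, hs⟩ := (hasResolution_iff _ _).2 (hY' 0 le_rfl)
  obtain ⟨P, hP, rfl⟩ := exists_inclComplex_eq hZ
  have : IsIso ((acyclic (ModG k G)).trW.Q.map (Kb.homOf (isBounded_inclComplex hP) hB s)) :=
    Localization.inverts _ (acyclic (ModG k G)).trW _ ((acyclic_trW_homOf_iff _ _ _).2 hs)
  let e : (upsilonQuotient k G).obj ((permQ k G).obj (Kb.of P hP)) ≅ Y ⊞ Y' :=
    (upsilonQuotientIso k G).app (Kb.of P hP) ≪≫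
      @asIso _ _ _ _ _ this ≪≫
        eqToIso h.symm
  refine ⟨_, biprod.inl ≫ e.inv, e.hom ≫ biprod.fst, ?_⟩
  rw [Category.assoc, e.inv_hom_id_assoc, biprod.inl_fst]

variable (k G) in
theorem isEquivalence_upsilonBar [IsIdempotentComplete (DbG k G)] :
    (upsilonBar k G).IsEquivalence :=
  isEquivalence_functorExtension_obj _ exists_retract_upsilonQuotient

end PermutationModules

theorem mainTheorem5 (k : Type u) [Field k] (G : Type v) [Group G] [Finite G] :
    PermutationModules.catANat k G = ⊤ ∧
    (∃ _ : IsIdempotentComplete (PermutationModules.DbG k G),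
      (PermutationModules.upsilonBar k G).IsEquivalence) ∧
    (∀ p : ℕ, p.Prime → CharP k p → IsPGroup p G → PermutationModules.catA k G = ⊤) :=
  have h : IsIdempotentComplete (PermutationModules.DbG k G) :=
    BoundedHomotopy.isIdempotentComplete_Db
  ⟨PermutationModules.catANat_eq_top k G, ⟨h, PermutationModules.isEquivalence_upsilonBar k G⟩,
    fun _ hp _ hG ↦ PermutationModules.catA_eq_top_of_isPGroup k hp hG⟩
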